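/- **Setting.** Let $\mathcal H$ be a separable complex Hilbert space and $\Delta$ a self-adjoint, positive, invertible operator on $\mathcal H$ with compact resolvent. Put $\mathcal H^\infty=\bigcap_{n}\mathrm{Dom}(\Delta^n)$, and let $\Delta^z\in\mathrm{End}(\mathcal H^\infty)$, $z\in\mathbb C$, be the complex powers given by spectral calculus. Let $r\ge 1$ be an integer and let $(\mathcal D,\Delta,r)$ be an algebra of generalized differential operators: $\mathcal D$ is a (not necessarily unital) subalgebra of $\mathrm{End}(\mathcal H^\infty)$ with an increasing filtration by linear subspaces $(\mathcal D^q)_{q\in\mathbb N}$, such that $\mathcal D=\bigcup_q\mathcal D^q$, $\mathcal D^i\mathcal D^j\subset\mathcal D^{i+j}$, the unit of $\mathcal D$, if there is one, lies in $\mathcal D^0$, $[\Delta,\mathcal D^q]\subset\mathcal D^{q+r-1}$, and for every $X\in\mathcal D^q$ there is $\varepsilon>0$ with $\|\Delta^{q/r}v\|+\|v\|\ge\varepsilon\|Xv\|$ for all $v\in\mathcal H^\infty$. Put $\mathcal D^k=0$ for integers $k<0$. For $k\in\mathbb Z$ let $$\mathcal D[\Delta]^k=\sum_{i+rd=k,\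 i,d\in\mathbb N}\ \mathrm{span}\{X\Delta^j:\ X\in\mathcal D^i,\ 0\le j\le d\}$$ (so $\mathcal D[\Delta]^k=0$ for $k<0$); this is the filtration of the algebra $\mathcal D[\Delta]$. For $s\in\mathbb R$ let $\mathcal H^s$ be the completion of $\mathcal H^\infty$ for the norm $\|v\|_s=\|\Delta^{s/r}v\|$. For $t\in\mathbb R$ let $\mathrm{Op}^t$ be the space of those $T\in\mathrm{End}(\mathcal H^\infty)$ which extend to bounded operators $\mathcal H^{s+t}\to\mathcal H^s$ for every $s\in\mathbb R$, with the topology defined by all these operator norms. **Holomorphic families.** Let $F$ be one of the filtrations $\mathcal D^\bullet$, $\mathcal D[\Delta]^\bullet$, and let $k\in\mathbb Z$. An elementary family of type $k$ for $F$ is a family $z\mapsto p(z)X\Delta^{z-n}$ with $p$ a complex polynomial, $n\in\mathbb N$ and $X\in F^{rn+k}$. A family $(T_z)_{z\in\mathbb C}$ in $\mathrm{End}(\mathcal H^\infty)$ is a holomorphic family of type $k$ for $F$ if for all real $a,m$ there are finitely many elementary families $(T^j_z)$ of type $k$ for $F$ such that, on the half-plane $\mathrm{Re}\,z<a$, $T_z=\sum_jT^j_z+S_z$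 with $z\mapsto S_z$ holomorphic from this half-plane to $\mathrm{Op}^m$. **Reduction sequences.** Fix $P_1,\dots,P_n,Q_1,\dots,Q_n\in\mathcal D$. For $a,b\in\mathbb C^n$ and $W\in \mathrm{End}(\mathcal H^\infty)$ put $H_{a,b}(W)=\sum_i a_i[-Q_i,P_iW]+\sum_i b_i[P_i,Q_iW]$. Let $p\ge1$, let $(a^m,b^m)\in\mathbb R^n\times\mathbb R^n$ and $(\alpha_m,\beta_m)\in\mathbb R^2$ for $1\le m\le p$, the numbers $\alpha_m,\beta_m$ being not all zero. For $z'\in\mathbb C$ define $$T_{z'}=\prod_{m=1}^p\bigl(H_{a^m,b^m}-(\alpha_mz'+\beta_m)\mathrm{Id}\bigr),\quad b(z')=(-1)^{p+1}\prod_{m=1}^p(\alpha_mz'+\beta_m),\quad H_{z'}=T_{z'}+b(z')\mathrm{Id},$$ the factor with $m=1$ of the composition $T_{z'}$ being applied first. A sequence of linear endomorphisms $(T_s)_{s\in\mathbb N}$ of $\mathrm{End}(\mathcal H^\infty)$ is a reduction sequence with these data if $T_s$ is given by the formula above for every integer $s\ge1$, and $T_{q+ri}(X\Delta^i)\in\mathcal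 D[\Delta]^{q+ri-1}$ for all $q,i\in\mathbb N$ and all $X\in\mathcal D^q$. **Theorem 1.1.** Let $(T_s)_{s\in\mathbb N}$ be a reduction sequence, with associated $b$ and $(H_{z'})_{z'\in\mathbb C}$. Then for every $q_X\in\mathbb N$ and every $X\in\mathcal D^{q_X}$, $$\forall z\in\mathbb C,\qquad H_{rz+q_X}(X\Delta^z)=b(rz+q_X)\,X\Delta^z+R_z,$$ where $(R_z)_{z\in\mathbb C}$ is a holomorphic family of type $q_X-1$ for the filtration $\mathcal D[\Delta]^\bullet$. If moreover $\Delta\in\mathcal D^r$ (in which case $\mathcal D[\Delta]^\bullet=\mathcal D^\bullet$), or if $q_X\le r$, then $(R_z)$ is a holomorphic family of type $q_X-1$ for the filtration $\mathcal D^\bullet$ itself. -/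

import Mathlib

namespace GDO

noncomputable section

/-! ### The unbounded operator -/

/-- `K` is the bounded, everywhere defined inverse of `A - μ`. -/
structure IsResolventAt {H : Type*} [NormedAddCommGroup H] [InnerProductSpace ℂ H]
    (A : H →ₗ.[ℂ] H) (μ : ℂ) (K : H →L[ℂ] H) : Prop where
  mem_domain : ∀ y : H, K y ∈ A.domain
  right_inv : ∀ y : H, A ⟨K y, mem_domain y⟩ - μ • K y = y
  left_inv : ∀ x : A.domain, K (A x - μ • (x : H)) = x

/-- A self-adjoint, positive, invertible (unbounded) operator with compact resolvent. -/
structure LaplaceOperator (H : Type*) [NormedAddCommGroup H] [InnerProductSpace ℂ H]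
    [CompleteSpace H] where
  op : H →ₗ.[ℂ] H
  selfAdjoint : IsSelfAdjoint op
  nonneg : ∀ x : op.domain, 0 ≤ (inner ℂ (op x) (x : H)).re
  invertible : ∃ K : H →L[ℂ] H, IsResolventAt op 0 K
  compact_resolvent : ∀ (μ : ℂ) (K : H →L[ℂ] H), IsResolventAt op μ K → IsCompactOperator K

namespace LaplaceOperator

variable {H : Type*} [NormedAddCommGroup H] [InnerProductSpace ℂ H] [CompleteSpace H]
  (L : LaplaceOperator H)

/-- The domain of the `n`-th power of the operator. -/
def domPow : ℕ → Submodule ℂ H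
  | 0 => ⊤
  | n + 1 => ((domPow n).comap L.op.toFun).map L.op.domain.subtype

/-- The space of vectors common to the domains of all powers of the operator. -/
def smooth : Submodule ℂ H := ⨅ n : ℕ, L.domPow n

/-- The algebra of all linear endomorphisms of the space of smooth vectors. -/
abbrev EndSmooth : Type _ := Module.End ℂ L.smooth

theorem mem_domPow_succ {n : ℕ} {x : H} :
    x ∈ L.domPow (n + 1) ↔ ∃ h : x ∈ L.op.domain, L.op ⟨x, h⟩ ∈ L.domPow n := by
  simp only [domPow, Submodule.mem_map, Submodule.mem_comap]
  constructor
  · rintro ⟨⟨y, hy⟩, h1, rfl⟩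
    exact ⟨hy, h1⟩
  · rintro ⟨h, h1⟩
    exact ⟨⟨x, h⟩, h1, rfl⟩

theorem mem_domain_of_mem_smooth {x : H} (hx : x ∈ L.smooth) : x ∈ L.op.domain :=
  (L.mem_domPow_succ.1 ((Submodule.mem_iInf _).1 hx 1)).1

theorem op_mem_smooth (v : L.smooth) :
    L.op ⟨v, L.mem_domain_of_mem_smooth v.2⟩ ∈ L.smooth :=
  (Submodule.mem_iInf _).2 fun n =>
    (L.mem_domPow_succ.1 ((Submodule.mem_iInf _).1 v.2 (n + 1))).2

/-- The restriction of the operator to the smooth vectors. -/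
def opEnd : L.EndSmooth where
  toFun v := ⟨L.op ⟨v, L.mem_domain_of_mem_smooth v.2⟩, L.op_mem_smooth v⟩
  map_add' v w := Subtype.ext (L.op.map_add ⟨v, L.mem_domain_of_mem_smooth v.2⟩
    ⟨w, L.mem_domain_of_mem_smooth w.2⟩)
  map_smul' c v := Subtype.ext (L.op.map_smul c ⟨v, L.mem_domain_of_mem_smooth v.2⟩)

/-! ### Complex powers

The operator has pure point spectrum, so its spectral measure is the sum of the point masses at
the real numbers `μ`, weighted by the orthogonal projections onto the eigenspaces.  Spectral
calculus therefore gives the power of exponent `z` as `v ↦ ∑ μ ^ z P_μ v`, the sum being over all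
real `μ` (the terms vanish unless `μ` is one of the countably many eigenvalues, all positive). -/

/-- The eigenspace at the real number `μ`. -/
def eigenspace (μ : ℝ) : Submodule ℂ H where
  carrier := {x | ∃ h : x ∈ L.op.domain, L.op ⟨x, h⟩ = (μ : ℂ) • x}
  zero_mem' := ⟨L.op.domain.zero_mem, by
    rw [smul_zero]
    exact L.op.map_zero⟩
  add_mem' := by
    rintro x y ⟨hx, ex⟩ ⟨hy, ey⟩
    refine ⟨L.op.domain.add_mem hx hy, ?_⟩
    have := L.op.map_add ⟨x, hx⟩ ⟨y, hy⟩
    rw [smul_add, ← ex, ← ey, ← this]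
    rfl
  smul_mem' := by
    rintro c x ⟨hx, ex⟩
    refine ⟨L.op.domain.smul_mem c hx, ?_⟩
    have := L.op.map_smul c ⟨x, hx⟩
    rw [smul_comm, ← ex, ← this]
    rfl

theorem mem_eigenspace_iff {K : H →L[ℂ] H} (hK : IsResolventAt L.op 0 K) (μ : ℝ) (x : H) :
    x ∈ L.eigenspace μ ↔ x = (μ : ℂ) • K x := by
  constructor
  · rintro ⟨h, e⟩
    have := hK.left_inv ⟨x, h⟩
    rw [zero_smul, sub_zero, e, map_smul] at this
    exact this.symm
  · intro e
    have h : x ∈ L.op.domain := by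
      rw [e]
      exact L.op.domain.smul_mem _ (hK.mem_domain x)
    refine ⟨h, ?_⟩
    have h2 := L.op.map_smul (μ : ℂ) ⟨K x, hK.mem_domain x⟩
    have h3 := hK.right_inv x
    rw [zero_smul, sub_zero] at h3
    rw [h3] at h2
    rw [← h2]
    congr 1
    exact Subtype.ext e

instance instProj (μ : ℝ) : (L.eigenspace μ).HasOrthogonalProjection := by
  obtain ⟨K, hK⟩ := L.invertible
  have hc : IsClosed (L.eigenspace μ : Set H) := by
    have e : (L.eigenspace μ : Set H) = {x | x = (μ : ℂ) • K x} :=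
      Set.ext fun x => L.mem_eigenspace_iff hK μ x
    rw [e]
    exact isClosed_eq continuous_id (K.continuous.const_smul _)
  have : CompleteSpace (L.eigenspace μ) := hc.completeSpace_coe
  infer_instance

/-- The value `∑ μ ^ z P_μ v` of the power of exponent `z` at a vector `v` of its domain. -/
def cpowFun (z : ℂ) (v : H) : H :=
  ∑' μ : ℝ, ((μ : ℂ) ^ z) • (L.eigenspace μ).starProjection v

theorem symm_op (x y : L.op.domain) : inner ℂ (L.op x) (y : H) = inner ℂ (x : H) (L.op y) := by
  have h := LinearPMap.adjoint_isFormalAdjoint L.selfAdjoint.dense_domain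
  rw [LinearPMap.isSelfAdjoint_def.1 L.selfAdjoint] at h
  exact h x y

theorem eigenspace_orthogonal :
    OrthogonalFamily ℂ (fun μ : ℝ => L.eigenspace μ) fun μ => (L.eigenspace μ).subtypeₗᵢ := by
  intro μ ν hne
  rintro ⟨x, hx, ex⟩ ⟨y, hy, ey⟩
  have h := L.symm_op ⟨x, hx⟩ ⟨y, hy⟩
  rw [ex, ey, inner_smul_left, inner_smul_right, Complex.conj_ofReal] at h
  have h2 : ((μ : ℂ) - ν) * inner ℂ x y = 0 := by
    rw [sub_mul]
    exact sub_eq_zero.2 h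
  rcases mul_eq_zero.1 h2 with h3 | h3
  · exact absurd (by exact_mod_cast sub_eq_zero.1 h3) hne
  · exact h3

theorem proj_op (μ : ℝ) (x : L.op.domain) : (L.eigenspace μ).starProjection (L.op x) =
    (μ : ℂ) • (L.eigenspace μ).starProjection (x : H) := by
  rw [← sub_eq_zero, ← map_smul, ← map_sub, Submodule.starProjection_apply_eq_zero_iff,
    Submodule.mem_orthogonal]
  rintro w ⟨hw, ew⟩
  have h := L.symm_op ⟨w, hw⟩ x
  rw [ew, inner_smul_left, Complex.conj_ofReal] at h
  rw [inner_sub_right, inner_smul_right, ← h, sub_self]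

theorem eigenvalue_lower : ∃ c : ℝ, 0 < c ∧ ∀ μ : ℝ, ∀ x ∈ L.eigenspace μ, x ≠ 0 → c ≤ μ := by
  obtain ⟨K, hK⟩ := L.invertible
  refine ⟨(‖K‖ + 1)⁻¹, by positivity, fun μ x hx h0 => ?_⟩
  have hpos : 0 < ‖x‖ := norm_pos_iff.2 h0
  have hx2 := hx
  rw [L.mem_eigenspace_iff hK] at hx2
  obtain ⟨hd, e⟩ := hx
  have hn := L.nonneg ⟨x, hd⟩
  rw [e, inner_smul_left, Complex.conj_ofReal, inner_self_eq_norm_sq_to_K] at hn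
  have hn' : 0 ≤ μ * ‖x‖ ^ 2 := by
    have : (((μ : ℂ) * ((‖x‖ : ℂ)) ^ 2)).re = μ * ‖x‖ ^ 2 := by
      norm_cast
    rw [← this]
    exact hn
  have hμ : 0 ≤ μ := nonneg_of_mul_nonneg_left hn' (by positivity)
  have h1 : ‖x‖ ≤ μ * (‖K‖ * ‖x‖) := by
    calc ‖x‖ = ‖(μ : ℂ) • K x‖ := by rw [← hx2]
      _ = μ * ‖K x‖ := by rw [norm_smul, Complex.norm_real, Real.norm_of_nonneg hμ]
      _ ≤ μ * (‖K‖ * ‖x‖) := by gcongr; exact K.le_opNorm x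
  have h2 : 1 ≤ μ * (‖K‖ + 1) := by
    have : 1 ≤ μ * ‖K‖ := by
      by_contra hlt
      push Not at hlt
      nlinarith
    linarith
  rw [inv_le_iff_one_le_mul₀ (by positivity)]
  exact h2

theorem summable_proj (v : H) :
    Summable fun μ : ℝ => ‖(L.eigenspace μ).starProjection v‖ ^ 2 := by
  refine summable_of_sum_le (c := ‖v‖ ^ 2) (fun _ => by positivity) fun s => ?_
  have h1 := L.eigenspace_orthogonal.norm_sum
    (fun μ => (L.eigenspace μ).orthogonalProjectionOnto v) s
  have h2 : inner ℂ (∑ μ ∈ s, (L.eigenspace μ).starProjection v) v =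
      ((∑ μ ∈ s, ‖(L.eigenspace μ).starProjection v‖ ^ 2 : ℝ) : ℂ) := by
    rw [sum_inner, Complex.ofReal_sum]
    refine Finset.sum_congr rfl fun μ _ => ?_
    have h3 := (L.eigenspace μ).starProjection_inner_eq_zero v
      ((L.eigenspace μ).starProjection v) (Submodule.starProjection_apply_mem _ _)
    rw [inner_sub_left, sub_eq_zero] at h3
    rw [← inner_conj_symm, h3, inner_self_eq_norm_sq_to_K]
    simp
  set w := ∑ μ ∈ s, (L.eigenspace μ).starProjection v with hw
  set S := ∑ μ ∈ s, ‖(L.eigenspace μ).starProjection v‖ ^ 2 with hS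
  have h4 : ‖w‖ ^ 2 = S := h1
  have h5 : S ≤ ‖w‖ * ‖v‖ := by
    have h6 := norm_inner_le_norm (𝕜 := ℂ) w v
    rw [h2, Complex.norm_real] at h6
    exact (le_abs_self S).trans h6
  nlinarith [sq_nonneg (‖w‖ - ‖v‖), norm_nonneg w, norm_nonneg v]

theorem proj_iterate (μ : ℝ) (n : ℕ) (v : L.smooth) :
    (L.eigenspace μ).starProjection ((L.opEnd ^ n) v : L.smooth) =
      (μ : ℂ) ^ n • (L.eigenspace μ).starProjection (v : H) := by
  induction n generalizing v with
  | zero => simp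
  | succ n ih =>
    rw [pow_succ, Module.End.mul_apply, ih, pow_succ, mul_smul]
    congr 1
    exact L.proj_op μ ⟨v, L.mem_domain_of_mem_smooth v.2⟩

theorem summable_cpow (z : ℂ) (v : L.smooth) :
    Summable fun μ : ℝ => ((μ : ℂ) ^ z) • (L.eigenspace μ).starProjection (v : H) := by
  obtain ⟨c, hc, hlow⟩ := L.eigenvalue_lower
  obtain ⟨n, hn⟩ := exists_nat_ge z.re
  have key := (L.eigenspace_orthogonal.summable_iff_norm_sq_summable
    (fun μ : ℝ => ((μ : ℂ) ^ z) • (L.eigenspace μ).orthogonalProjectionOnto (v : H)))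
  have hs : Summable fun μ : ℝ =>
      ‖((μ : ℂ) ^ z) • (L.eigenspace μ).orthogonalProjectionOnto (v : H)‖ ^ 2 := by
    refine Summable.of_nonneg_of_le (fun _ => by positivity) (fun μ => ?_)
      ((L.summable_proj ((L.opEnd ^ n) v : L.smooth)).mul_left ((c ^ (z.re - n)) ^ 2))
    rw [L.proj_iterate, ← mul_pow]
    refine pow_le_pow_left₀ (norm_nonneg _) ?_ 2
    have hP : ‖(L.eigenspace μ).orthogonalProjectionOnto (v : H)‖ =
      ‖(L.eigenspace μ).starProjection (v : H)‖ := rfl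
    rw [norm_smul, norm_smul, hP]
    rcases eq_or_ne ((L.eigenspace μ).starProjection (v : H)) 0 with h0 | h0
    · simp [h0]
    · have hμ := hlow μ _ (Submodule.starProjection_apply_mem _ _) h0
      have hpos : 0 < μ := hc.trans_le hμ
      rw [← mul_assoc]
      refine mul_le_mul_of_nonneg_right ?_ (norm_nonneg _)
      rw [Complex.norm_cpow_eq_rpow_re_of_pos hpos, norm_pow, Complex.norm_real,
        Real.norm_of_nonneg hpos.le, ← Real.rpow_natCast μ n]
      calc μ ^ z.re = μ ^ (z.re - n) * μ ^ (n : ℝ) := by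
            rw [← Real.rpow_add hpos]; ring_nf
        _ ≤ c ^ (z.re - n) * μ ^ (n : ℝ) := by
            refine mul_le_mul_of_nonneg_right ?_ (by positivity)
            exact Real.rpow_le_rpow_of_nonpos hc hμ (by linarith)
  exact key.2 hs

theorem cpowFun_mem_domain (z : ℂ) (v : L.smooth) :
    ∃ h : L.cpowFun z v ∈ L.op.domain, L.op ⟨_, h⟩ = L.cpowFun z (L.opEnd v : L.smooth) := by
  obtain ⟨K, hK⟩ := L.invertible
  have e : L.cpowFun z v = K (L.cpowFun z (L.opEnd v : L.smooth)) := by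
    unfold cpowFun
    rw [ContinuousLinearMap.map_tsum K (L.summable_cpow z (L.opEnd v))]
    refine tsum_congr fun μ => ?_
    have h1 := L.proj_iterate μ 1 v
    rw [pow_one, pow_one] at h1
    rw [h1, map_smul, map_smul]
    have h2 : (L.eigenspace μ).starProjection (v : H) ∈ L.eigenspace μ :=
      Submodule.starProjection_apply_mem _ _
    rw [L.mem_eigenspace_iff hK] at h2
    rw [← h2]
  have hd : L.cpowFun z v ∈ L.op.domain := by
    rw [e]; exact hK.mem_domain _
  refine ⟨hd, ?_⟩
  have h3 := hK.right_inv (L.cpowFun z (L.opEnd v : L.smooth))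
  rw [zero_smul, sub_zero] at h3
  rw [← h3]
  congr 1
  exact Subtype.ext e

theorem cpowFun_mem_smooth (z : ℂ) (v : L.smooth) : L.cpowFun z v ∈ L.smooth := by
  refine (Submodule.mem_iInf _).2 fun n => ?_
  induction n generalizing v with
  | zero => exact Submodule.mem_top
  | succ n ih =>
    obtain ⟨h, e⟩ := L.cpowFun_mem_domain z v
    exact L.mem_domPow_succ.2 ⟨h, by rw [e]; exact ih _⟩

/-- The complex power of exponent `z`, as an endomorphism of the space of smooth vectors. -/
def cpow (z : ℂ) : L.EndSmooth where
  toFun v := ⟨L.cpowFun z v, L.cpowFun_mem_smooth z v⟩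
  map_add' v w := by
    refine Subtype.ext ?_
    have := (L.summable_cpow z v).tsum_add (L.summable_cpow z w)
    simp only [cpowFun, Submodule.coe_add, map_add, smul_add]
    exact this
  map_smul' c v := by
    refine Subtype.ext ?_
    have := (L.summable_cpow z v).tsum_const_smul c
    simp only [cpowFun, Submodule.coe_smul, map_smul, RingHom.id_apply, ← this]
    exact tsum_congr fun μ => smul_comm _ _ _

/-! ### Sobolev norms and analytic order -/

/-- The Sobolev norm `‖Δ ^ (s / r) v‖` of a smooth vector.  The Sobolev space of exponent `s` is
the completion of the space of smooth vectors for this norm. -/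
def sobNorm (r : ℕ) (s : ℝ) (v : L.smooth) : ℝ := ‖L.cpow ((s / r : ℝ) : ℂ) v‖

/-- Operators of analytic order at most `t`: those which extend to a bounded operator from the
Sobolev space of exponent `s + t` to the one of exponent `s`, for every real `s`. -/
def IsOp (r : ℕ) (t : ℝ) (T : L.EndSmooth) : Prop :=
  ∀ s : ℝ, ∃ C : ℝ, ∀ v : L.smooth, L.sobNorm r s (T v) ≤ C * L.sobNorm r (s + t) v

/-- `R` is holomorphic from the half-plane `Re z < a` to the space of operators of analytic order
at most `m`, which is topologized by the operator norms from the Sobolev space of exponent `s + m`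
to the one of exponent `s`, for all real `s`. -/
def IsHolomorphicInOp (r : ℕ) (m a : ℝ) (R : ℂ → L.EndSmooth) : Prop :=
  ∀ z₀ : ℂ, z₀.re < a → L.IsOp r m (R z₀) ∧ ∃ R' : L.EndSmooth, L.IsOp r m R' ∧
    ∀ s : ℝ, ∀ ε : ℝ, 0 < ε → ∃ δ : ℝ, 0 < δ ∧ ∀ z : ℂ, ‖z - z₀‖ < δ → ∀ v : L.smooth,
      L.sobNorm r s ((R z - R z₀ - (z - z₀) • R') v) ≤ ε * ‖z - z₀‖ * L.sobNorm r (s + m) v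

/-! ### Holomorphic families -/

/-- Elementary holomorphic families of type `k`, for a family `F` of spaces of operators of given
order: `z ↦ p(z) X Δ ^ (z - n)` with `p` a polynomial, `n` a natural number and `X` of order at most
`r n + k`. -/
def IsElementaryFamily (r : ℕ) (F : ℤ → Submodule ℂ L.EndSmooth) (k : ℤ)
    (T : ℂ → L.EndSmooth) : Prop :=
  ∃ (p : Polynomial ℂ) (n : ℕ) (X : L.EndSmooth), X ∈ F ((r : ℤ) * n + k) ∧
    ∀ z : ℂ, T z = p.eval z • (X * L.cpow (z - n))

/-- Holomorphic families of type `k`: for all real `a` and `m` there is a Taylor expansion of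
order `m` and of frontier `a`. -/
def IsHolFamily (r : ℕ) (F : ℤ → Submodule ℂ L.EndSmooth) (k : ℤ)
    (T : ℂ → L.EndSmooth) : Prop :=
  ∀ a m : ℝ, ∃ (N : ℕ) (S : Fin N → ℂ → L.EndSmooth) (R : ℂ → L.EndSmooth),
    (∀ j, L.IsElementaryFamily r F k (S j)) ∧ L.IsHolomorphicInOp r m a R ∧
    ∀ z : ℂ, z.re < a → T z = ∑ j, S j z + R z

/-! ### Algebras of generalized differential operators -/

/-- An algebra of generalized differential operators for which the given operator is a generalized
Laplace operator of order `r`.  The algebra is not assumed to be unital. -/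
structure DiffAlgebra (r : ℕ) where
  r_pos : 0 < r
  carrier : NonUnitalSubalgebra ℂ L.EndSmooth
  filt : ℕ → Submodule ℂ L.EndSmooth
  filt_mono : Monotone filt
  mem_carrier : ∀ X : L.EndSmooth, X ∈ carrier ↔ ∃ q, X ∈ filt q
  filt_mul : ∀ i j : ℕ, ∀ X ∈ filt i, ∀ Y ∈ filt j, X * Y ∈ filt (i + j)
  filt_unit : ∀ U ∈ carrier, (∀ X ∈ carrier, U * X = X ∧ X * U = X) → U ∈ filt 0
  filt_comm : ∀ q : ℕ, ∀ X ∈ filt q, ⁅L.opEnd, X⁆ ∈ filt (q + r - 1)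
  garding : ∀ q : ℕ, ∀ X ∈ filt q, ∃ ε : ℝ, 0 < ε ∧ ∀ v : L.smooth,
    ε * ‖X v‖ ≤ ‖L.cpow (((q : ℝ) / r : ℝ) : ℂ) v‖ + ‖v‖

namespace DiffAlgebra

variable {L} {r : ℕ} (D : L.DiffAlgebra r)

/-- The filtration, extended by zero to negative orders. -/
def filtZ (k : ℤ) : Submodule ℂ L.EndSmooth := if 0 ≤ k then D.filt k.toNat else ⊥

/-- The filtration of the algebra of polynomials in the Laplace operator with coefficients in `D`:
the sum, over all `i` and `d` with `i + r d = k`, of the spaces of polynomials of degree at most `d`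
with coefficients of order at most `i`.  It is zero for negative `k`. -/
def polyFilt (k : ℤ) : Submodule ℂ L.EndSmooth :=
  ⨆ (i : ℕ) (d : ℕ) (_ : (i : ℤ) + r * d = k),
    Submodule.span ℂ {Y | ∃ X ∈ D.filt i, ∃ j ≤ d, Y = X * L.opEnd ^ j}

end DiffAlgebra

/-! ### Reduction sequences -/

/-- The operator `W ↦ ∑ aᵢ [-Qᵢ, Pᵢ W] + ∑ bᵢ [Pᵢ, Qᵢ W]`. -/
def commOp {n : ℕ} (P Q : Fin n → L.EndSmooth) (a b : Fin n → ℂ) : Module.End ℂ L.EndSmooth where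
  toFun W := ∑ i, a i • ⁅-Q i, P i * W⁆ + ∑ i, b i • ⁅P i, Q i * W⁆
  map_add' W W' := by
    simp only [Ring.lie_def, mul_add, add_mul, smul_add, smul_sub, Finset.sum_add_distrib,
      Finset.sum_sub_distrib]
    abel
  map_smul' c W := by
    simp only [Ring.lie_def, mul_smul_comm, smul_mul_assoc, smul_add, smul_sub, Finset.smul_sum,
      RingHom.id_apply, smul_comm c]

end LaplaceOperator

/-- The numerical data of a reduction sequence: pairs `(a m, b m)` of real vectors and pairs
`(α m, β m)` of real numbers, for `m` in a nonempty finite range. -/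
structure ReductionData (n p : ℕ) where
  p_pos : 0 < p
  a : Fin p → Fin n → ℝ
  b : Fin p → Fin n → ℝ
  α : Fin p → ℝ
  β : Fin p → ℝ
  nonzero : ¬ (α = 0 ∧ β = 0)

namespace ReductionData

variable {H : Type*} [NormedAddCommGroup H] [InnerProductSpace ℂ H] [CompleteSpace H]
  {L : LaplaceOperator H} {n p : ℕ} (Λ : ReductionData n p)

/-- The composition, over `m`, of the operators `H_{a m, b m} - (α m z + β m) Id`, the one with
`m = 0` being applied first. -/
def opT (P Q : Fin n → L.EndSmooth) (z : ℂ) : Module.End ℂ L.EndSmooth :=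
  (List.ofFn fun m : Fin p =>
    L.commOp P Q (fun i => (Λ.a m i : ℂ)) (fun i => (Λ.b m i : ℂ)) -
      ((Λ.α m : ℂ) * z + (Λ.β m : ℂ)) • (1 : Module.End ℂ L.EndSmooth)).reverse.prod

/-- The associated polynomial function. -/
def bFun (z : ℂ) : ℂ := (-1) ^ (p + 1) * ∏ m : Fin p, ((Λ.α m : ℂ) * z + (Λ.β m : ℂ))

/-- The operator `T_z + b(z) Id`. -/
def opH (P Q : Fin n → L.EndSmooth) (z : ℂ) : Module.End ℂ L.EndSmooth :=
  Λ.opT P Q z + Λ.bFun z • (1 : Module.End ℂ L.EndSmooth)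

/-- `T` is a reduction sequence, with data `Λ`. -/
structure IsReductionSequence {r : ℕ} (D : L.DiffAlgebra r) (P Q : Fin n → L.EndSmooth)
    (T : ℕ → Module.End ℂ L.EndSmooth) : Prop where
  eq_opT : ∀ s : ℕ, 1 ≤ s → T s = Λ.opT P Q (s : ℂ)
  reduces : ∀ q i : ℕ, ∀ X ∈ D.filt q,
    T (q + r * i) (X * L.opEnd ^ i) ∈ D.polyFilt ((q : ℤ) + r * i - 1)

end ReductionData

end

end GDO

namespace GDO

open Filter Topology

noncomputable section

namespace LaplaceOperator

variable {H : Type*} [NormedAddCommGroup H] [InnerProductSpace ℂ H] [CompleteSpace H]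
  (L : LaplaceOperator H)

/-! ### Spectral decomposition -/

/-! By definition of $H_{z'}$, the remainder is $R_z = T_{rz+q}(X\Delta^z)$. Expanding the
composition defining $T$ writes it as a finite sum $\sum_l p_l(z)\,A_l\Delta^zB_l$ with polynomial
$p_l$ (`exists_opT_eq`). Insert the expansion $\Delta^zB\sim\sum_k\binom
zk\,\mathrm{ad}_\Delta^k(B)\,\Delta^{z-k}$. Each commutator raises the order by $r-1$ and each
$\Delta^{-1}$ lowers it by $r$, so the $k$-th term loses $k$ orders and all terms with $k\ge K$ are
elementary families of type $q-1$ for $K$ large (`coeff_mem_filtZ`).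

The finitely many terms with $k<K$ form `leading`, whose a priori order is too large; only here does
the reduction hypothesis enter. At an integer $i$ the expansion is an exact finite formula, so the
hypothesis on $T_{q+ri}(X\Delta^i)$ puts the value of `leading` at $i$ in $\mathcal
D[\Delta]^{ri+q-1}$ (`leading_natCast_mem`). Since `leading` times $\Delta^{-z}$ is polynomial in
$z$, Lagrange interpolation at integers recovers it from these values, and the interpolation formula
is itself a sum of elementary families of type $q-1$ (`exists_leading_eq`).

The analytic part shows that the expansion is asymptotic, with holomorphic remainders
(`exists_isHolomorphicInOp_rem`). Between eigenspaces for $\mu$ and $\nu$, the remainder multiplies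
the coefficient of $B$ by the Taylor remainder of $x\mapsto x^z$. For $-1<\mathrm{Re}\,z<0$ this
factor is an integral of resolvents, equivalently of
$(t+\Delta)^{-1}\mathrm{ad}^N(B)(t+\Delta)^{-N}$, which gains $N$ orders up to a fixed loss. The
cocycle identity `rem_add` carries the bound to all half-planes. Local bounds and entire matrix
coefficients then give holomorphy through Cauchy estimates. -/

theorem eigenspace_le_smooth (μ : ℝ) : L.eigenspace μ ≤ L.smooth := by
  intro x hx
  refine (Submodule.mem_iInf _).2 fun n => ?_
  induction n generalizing x with
  | zero => exact Submodule.mem_top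
  | succ n ih =>
    have hx' := hx
    obtain ⟨h, e⟩ := hx
    exact L.mem_domPow_succ.2 ⟨h, by rw [e]; exact Submodule.smul_mem _ _ (ih hx')⟩

theorem resolvent_isSymmetric {K : H →L[ℂ] H} (hK : IsResolventAt L.op 0 K) :
    (K : H →ₗ[ℂ] H).IsSymmetric := by
  intro x y
  have h := L.symm_op ⟨K x, hK.mem_domain x⟩ ⟨K y, hK.mem_domain y⟩
  have hx := hK.right_inv x
  have hy := hK.right_inv y
  rw [zero_smul, sub_zero] at hx hy
  rw [hx, hy] at h
  exact h.symm

/-- The inverse `K` is compact and symmetric, so its eigenvectors span a dense subspace. Its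
eigenvalues are real, and nonzero because `K` is injective; hence an eigenvector of `K` for `a` is
one of the operator for `a⁻¹`. -/
theorem eq_zero_of_forall_proj_eq_zero {v : H}
    (hv : ∀ μ : ℝ, (L.eigenspace μ).starProjection v = 0) : v = 0 := by
  obtain ⟨K, hK⟩ := L.invertible
  have hsym := L.resolvent_isSymmetric hK
  have hbot := ContinuousLinearMap.orthogonalComplement_iSup_eigenspaces_eq_bot
    (L.compact_resolvent 0 K hK) hsym
  suffices hmem : v ∈ (⨆ μ, Module.End.eigenspace (K : Module.End ℂ H) μ)ᗮ by
    rw [hbot] at hmem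
    exact (Submodule.mem_bot ℂ).1 hmem
  rw [← Submodule.iInf_orthogonal, Submodule.mem_iInf]
  intro l
  rw [Submodule.mem_orthogonal]
  intro x hx
  rcases eq_or_ne x 0 with rfl | hx0
  · exact inner_zero_left _
  have hKx : K x = l • x := Module.End.mem_eigenspace_iff.1 hx
  have hl : Module.End.HasEigenvalue (K : Module.End ℂ H) l :=
    Module.End.hasEigenvalue_of_hasEigenvector ⟨hx, hx0⟩
  have hreal := hsym.conj_eigenvalue_eq_self hl
  obtain ⟨a, ha⟩ := Complex.conj_eq_iff_real.1 hreal
  have hl0 : l ≠ 0 := by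
    rintro rfl
    have h1 := hK.right_inv x
    rw [zero_smul, sub_zero] at h1
    have h2 : (⟨K x, hK.mem_domain x⟩ : L.op.domain) = 0 := Subtype.ext (by simpa using hKx)
    rw [h2] at h1
    exact hx0 (h1.symm.trans L.op.map_zero)
  have hxe : x ∈ L.eigenspace a⁻¹ := by
    rw [L.mem_eigenspace_iff hK, hKx, smul_smul, ha, Complex.ofReal_inv, ← ha,
      inv_mul_cancel₀ hl0, one_smul]
  have := hv a⁻¹
  rw [Submodule.starProjection_apply_eq_zero_iff, Submodule.mem_orthogonal] at this
  exact this x hxe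

theorem proj_of_mem {μ : ℝ} {x : H} (hx : x ∈ L.eigenspace μ) :
    (L.eigenspace μ).starProjection x = x :=
  Submodule.starProjection_eq_self_iff.2 hx

theorem proj_of_mem_ne {μ ν : ℝ} (h : μ ≠ ν) {x : H} (hx : x ∈ L.eigenspace ν) :
    (L.eigenspace μ).starProjection x = 0 := by
  rw [Submodule.starProjection_apply_eq_zero_iff, Submodule.mem_orthogonal]
  intro y hy
  exact L.eigenspace_orthogonal h ⟨y, hy⟩ ⟨x, hx⟩

theorem proj_hasSum {y : ℝ → H} {s : H} (hy : ∀ ν, y ν ∈ L.eigenspace ν) (hs : HasSum y s)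
    (μ : ℝ) : (L.eigenspace μ).starProjection s = y μ := by
  have h1 := (L.eigenspace μ).starProjection.hasSum hs
  refine h1.unique ?_
  have h2 := hasSum_single (f := fun ν => (L.eigenspace μ).starProjection (y ν)) μ
    fun ν hν => L.proj_of_mem_ne hν.symm (hy ν)
  rwa [L.proj_of_mem (hy μ)] at h2

theorem summable_of_norm_sq {y : ℝ → H} (hy : ∀ ν, y ν ∈ L.eigenspace ν)
    (hs : Summable fun ν => ‖y ν‖ ^ 2) : Summable y :=
  (L.eigenspace_orthogonal.summable_iff_norm_sq_summable
    (fun ν : ℝ => (⟨y ν, hy ν⟩ : L.eigenspace ν))).2 hs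

theorem hasSum_proj (v : H) : HasSum (fun μ => (L.eigenspace μ).starProjection v) v := by
  have hm : ∀ μ, (L.eigenspace μ).starProjection v ∈ L.eigenspace μ :=
    fun μ => Submodule.starProjection_apply_mem _ _
  obtain ⟨s, hs⟩ := L.summable_of_norm_sq hm (L.summable_proj v)
  have : v - s = 0 := L.eq_zero_of_forall_proj_eq_zero fun μ => by
    rw [map_sub, L.proj_hasSum hm hs, sub_self]
  have e : s = v := (sub_eq_zero.1 this).symm
  rwa [e] at hs

theorem inner_proj_self (μ : ℝ) (v w : H) :
    inner ℂ ((L.eigenspace μ).starProjection v) w =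
      inner ℂ ((L.eigenspace μ).starProjection v) ((L.eigenspace μ).starProjection w) := by
  have h := (L.eigenspace μ).starProjection_inner_eq_zero w
    ((L.eigenspace μ).starProjection v) (Submodule.starProjection_apply_mem _ _)
  rw [inner_sub_left, sub_eq_zero] at h
  rw [← inner_conj_symm, h, inner_conj_symm]

theorem hasSum_norm_sq_proj (v : H) :
    HasSum (fun μ => ‖(L.eigenspace μ).starProjection v‖ ^ 2) (‖v‖ ^ 2) := by
  have h := (innerSL ℂ v).hasSum (L.hasSum_proj v)
  have h2 := Complex.hasSum_re h
  convert h2 using 1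
  · ext μ
    simp only [innerSL_apply_apply]
    rw [← inner_conj_symm, L.inner_proj_self, inner_self_eq_norm_sq_to_K]
    norm_cast
  · simp only [innerSL_apply_apply]
    rw [inner_self_eq_norm_sq_to_K]
    norm_cast

theorem ext_proj {v w : H}
    (h : ∀ μ, (L.eigenspace μ).starProjection v = (L.eigenspace μ).starProjection w) : v = w :=
  sub_eq_zero.1 (L.eq_zero_of_forall_proj_eq_zero fun μ => by rw [map_sub, h, sub_self])

/-- The orthogonal projection to an eigenspace, on smooth vectors. -/
def projEnd (μ : ℝ) : L.EndSmooth where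
  toFun v := ⟨(L.eigenspace μ).starProjection (v : H),
    L.eigenspace_le_smooth μ (Submodule.starProjection_apply_mem _ _)⟩
  map_add' _ _ := Subtype.ext (map_add _ _ _)
  map_smul' _ _ := Subtype.ext (map_smul _ _ _)

theorem coe_projEnd (μ : ℝ) (v : L.smooth) :
    (L.projEnd μ v : H) = (L.eigenspace μ).starProjection (v : H) := rfl

theorem projEnd_mem (μ : ℝ) (v : L.smooth) : (L.projEnd μ v : H) ∈ L.eigenspace μ :=
  Submodule.starProjection_apply_mem _ _

theorem ext_projEnd {v w : L.smooth} (h : ∀ μ, L.projEnd μ v = L.projEnd μ w) : v = w :=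
  Subtype.ext (L.ext_proj fun μ => congrArg (fun x : L.smooth => (x : H)) (h μ))

theorem projEnd_projEnd (μ : ℝ) (v : L.smooth) : L.projEnd μ (L.projEnd μ v) = L.projEnd μ v :=
  Subtype.ext (L.proj_of_mem (L.projEnd_mem μ v))

theorem projEnd_projEnd_ne {μ ν : ℝ} (h : μ ≠ ν) (v : L.smooth) :
    L.projEnd μ (L.projEnd ν v) = 0 :=
  Subtype.ext (L.proj_of_mem_ne h (L.projEnd_mem ν v))

/-- A positive lower bound for the eigenvalues. -/
def bottom : ℝ := L.eigenvalue_lower.choose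

theorem bottom_pos : 0 < L.bottom := L.eigenvalue_lower.choose_spec.1

theorem projEnd_eq_zero {μ : ℝ} (h : μ < L.bottom) (v : L.smooth) : L.projEnd μ v = 0 := by
  by_contra h0
  exact absurd (L.eigenvalue_lower.choose_spec.2 μ _ (L.projEnd_mem μ v)
    fun h1 => h0 (Subtype.ext h1)) (not_le.2 h)

theorem projEnd_opEnd_pow (μ : ℝ) (n : ℕ) (v : L.smooth) :
    L.projEnd μ ((L.opEnd ^ n) v) = ((μ : ℂ) ^ n) • L.projEnd μ v :=
  Subtype.ext (L.proj_iterate μ n v)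

theorem projEnd_opEnd (μ : ℝ) (v : L.smooth) :
    L.projEnd μ (L.opEnd v) = (μ : ℂ) • L.projEnd μ v := by
  simpa using L.projEnd_opEnd_pow μ 1 v

theorem projEnd_cpow (μ : ℝ) (z : ℂ) (v : L.smooth) :
    L.projEnd μ (L.cpow z v) = ((μ : ℂ) ^ z) • L.projEnd μ v :=
  Subtype.ext (L.proj_hasSum
    (fun _ => Submodule.smul_mem _ _ (Submodule.starProjection_apply_mem _ _))
    (L.summable_cpow z v).hasSum μ)

/-- Testing only at `μ ≥ bottom > 0` avoids the conventional values of `0 ^ z` and of powers of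
negative numbers, for which the exponent law may fail. -/
theorem end_ext {S T : L.EndSmooth} (h : ∀ μ, L.bottom ≤ μ → ∀ v,
    L.projEnd μ (S v) = L.projEnd μ (T v)) : S = T := by
  refine LinearMap.ext fun v => L.ext_projEnd fun μ => ?_
  rcases lt_or_ge μ L.bottom with hμ | hμ
  · rw [L.projEnd_eq_zero hμ, L.projEnd_eq_zero hμ]
  · exact h μ hμ v

/-! ### Complex powers and functional calculus -/

theorem cpow_add (z w : ℂ) : L.cpow (z + w) = L.cpow z * L.cpow w := by
  refine L.end_ext fun μ hμ v => ?_
  have h0 : (μ : ℂ) ≠ 0 := Complex.ofReal_ne_zero.2 (L.bottom_pos.trans_le hμ).ne'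
  rw [Module.End.mul_apply, L.projEnd_cpow, L.projEnd_cpow, L.projEnd_cpow, smul_smul,
    Complex.cpow_add _ _ h0]

theorem cpow_natCast (n : ℕ) : L.cpow (n : ℂ) = L.opEnd ^ n := by
  refine L.end_ext fun μ _ v => ?_
  rw [L.projEnd_cpow, L.projEnd_opEnd_pow, Complex.cpow_natCast]

theorem cpow_zero : L.cpow 0 = 1 := by
  simpa using L.cpow_natCast 0

theorem cpow_one : L.cpow 1 = L.opEnd := by
  simpa using L.cpow_natCast 1

theorem cpow_add_apply (z w : ℂ) (v : L.smooth) : L.cpow (z + w) v = L.cpow z (L.cpow w v) := by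
  rw [cpow_add, Module.End.mul_apply]

/-- The bounded functional calculus acts on smooth vectors. -/
theorem exists_multiplier (g : ℝ → ℂ) {C : ℝ} (hg : ∀ μ, L.bottom ≤ μ → ‖g μ‖ ≤ C) :
    ∃ G : L.EndSmooth, ∀ μ v, L.projEnd μ (G v) = g μ • L.projEnd μ v := by
  obtain ⟨K, hK⟩ := L.invertible
  have hm : ∀ (v : H) (μ : ℝ), g μ • (L.eigenspace μ).starProjection v ∈ L.eigenspace μ :=
    fun v μ => Submodule.smul_mem _ _ (Submodule.starProjection_apply_mem _ _)
  have hsum : ∀ v : L.smooth, Summable fun μ => g μ • (L.eigenspace μ).starProjection (v : H) := by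
    intro v
    refine L.summable_of_norm_sq (hm v) (Summable.of_nonneg_of_le (fun _ => by positivity)
      (fun μ => ?_) ((L.summable_proj v).mul_left (C ^ 2)))
    rw [← mul_pow]
    refine pow_le_pow_left₀ (norm_nonneg _) ?_ 2
    rw [norm_smul]
    rcases lt_or_ge μ L.bottom with hμ | hμ
    · have := congrArg Subtype.val (L.projEnd_eq_zero hμ v)
      rw [coe_projEnd] at this
      simp [this]
    · exact mul_le_mul_of_nonneg_right (hg μ hμ) (norm_nonneg _)
  have hproj : ∀ (v : L.smooth) (μ : ℝ), (L.eigenspace μ).starProjection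
      (∑' μ, g μ • (L.eigenspace μ).starProjection (v : H)) =
        g μ • (L.eigenspace μ).starProjection (v : H) :=
    fun v μ => L.proj_hasSum (hm v) (hsum v).hasSum μ
  have hdom : ∀ v : L.smooth, ∃ h : (∑' μ, g μ • (L.eigenspace μ).starProjection (v : H)) ∈
      L.op.domain, L.op ⟨_, h⟩ =
        ∑' μ, g μ • (L.eigenspace μ).starProjection (L.opEnd v : H) := by
    intro v
    -- The multiplier at `v` is `K` applied to the multiplier at `Δ v`. Hence it maps into the
    -- domain and commutes with `Δ`; iterating gives smoothness.
    have e : (∑' μ, g μ • (L.eigenspace μ).starProjection (v : H)) =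
        K (∑' μ, g μ • (L.eigenspace μ).starProjection (L.opEnd v : H)) := by
      rw [ContinuousLinearMap.map_tsum K (hsum (L.opEnd v))]
      refine tsum_congr fun μ => ?_
      have h1 := congrArg Subtype.val (L.projEnd_opEnd μ v)
      simp only [Submodule.coe_smul, coe_projEnd] at h1
      rw [h1, map_smul, map_smul]
      have h2 := (L.mem_eigenspace_iff hK μ _).1 (L.projEnd_mem μ v)
      rw [coe_projEnd] at h2
      rw [← h2]
    have hd : (∑' μ, g μ • (L.eigenspace μ).starProjection (v : H)) ∈ L.op.domain := by
      rw [e]; exact hK.mem_domain _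
    refine ⟨hd, ?_⟩
    have h3 := hK.right_inv (∑' μ, g μ • (L.eigenspace μ).starProjection (L.opEnd v : H))
    rw [zero_smul, sub_zero] at h3
    rw [← h3]
    congr 1
    exact Subtype.ext e
  have hsm : ∀ v : L.smooth, (∑' μ, g μ • (L.eigenspace μ).starProjection (v : H)) ∈ L.smooth := by
    intro v
    refine (Submodule.mem_iInf _).2 fun n => ?_
    induction n generalizing v with
    | zero => exact Submodule.mem_top
    | succ n ih =>
      obtain ⟨h, e⟩ := hdom v
      exact L.mem_domPow_succ.2 ⟨h, by rw [e]; exact ih _⟩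
  refine ⟨{ toFun := fun v => ⟨_, hsm v⟩, map_add' := fun v w => ?_, map_smul' := fun c v => ?_ },
    fun μ v => Subtype.ext (hproj v μ)⟩
  · refine Subtype.ext (L.ext_proj fun μ => (hproj (v + w) μ).trans ?_)
    rw [Submodule.coe_add, map_add, smul_add, ← hproj v μ, ← hproj w μ, ← map_add]
    rfl
  · refine Subtype.ext (L.ext_proj fun μ => (hproj (c • v) μ).trans ?_)
    rw [Submodule.coe_smul, map_smul, smul_comm, ← hproj v μ, ← map_smul]
    rfl

/-- Above, `log μ ≤ μ`; below, `-log μ ≤ μ⁻¹`, and `μ⁻¹ ≤ bottom⁻² μ`. A crude linear bound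
suffices, since `logEnd` only needs some finite analytic order. -/
theorem abs_log_le {μ : ℝ} (hμ : L.bottom ≤ μ) :
    |Real.log μ| ≤ (1 + (L.bottom⁻¹) ^ 2) * μ := by
  have hb := L.bottom_pos
  have hμ0 : 0 < μ := hb.trans_le hμ
  have h1 := Real.log_le_self hμ0.le
  have h2 := Real.log_le_self (inv_pos.2 hμ0).le
  rw [Real.log_inv] at h2
  have h3 : μ⁻¹ ≤ L.bottom⁻¹ := inv_anti₀ hb hμ
  have h4 : μ⁻¹ ≤ (L.bottom⁻¹) ^ 2 * μ := by
    calc μ⁻¹ = μ⁻¹ ^ 2 * μ := by field_simp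
      _ ≤ _ := by gcongr
  rw [abs_le]
  have : 0 ≤ (L.bottom⁻¹) ^ 2 * μ := by positivity
  constructor <;> nlinarith

theorem exists_log : ∃ G : L.EndSmooth, ∀ μ v,
    L.projEnd μ (G v) = (Real.log μ : ℂ) • L.projEnd μ v := by
  have hb := L.bottom_pos
  -- The logarithm is unbounded, so it is factored as the bounded multiplier `log μ / μ` times `Δ`.
  obtain ⟨G, hG⟩ := L.exists_multiplier (fun μ => ((Real.log μ / μ : ℝ) : ℂ))
    (C := 1 + (L.bottom⁻¹) ^ 2) (fun μ hμ => by
      have hμ0 : 0 < μ := hb.trans_le hμ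
      rw [Complex.norm_real, Real.norm_eq_abs, abs_div, abs_of_pos hμ0, div_le_iff₀ hμ0]
      exact L.abs_log_le hμ)
  refine ⟨G * L.opEnd, fun μ v => ?_⟩
  rw [Module.End.mul_apply, hG, L.projEnd_opEnd, smul_smul]
  rcases lt_or_ge μ L.bottom with hμ | hμ
  · simp [L.projEnd_eq_zero hμ]
  · rw [← Complex.ofReal_mul, div_mul_cancel₀ _ (hb.trans_le hμ).ne']

/-- The logarithm of the operator, as an endomorphism of the space of smooth vectors. -/
def logEnd : L.EndSmooth := L.exists_log.choose

theorem projEnd_logEnd (μ : ℝ) (v : L.smooth) :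
    L.projEnd μ (L.logEnd v) = (Real.log μ : ℂ) • L.projEnd μ v :=
  L.exists_log.choose_spec μ v

end LaplaceOperator

namespace LaplaceOperator

variable {H : Type*} [NormedAddCommGroup H] [InnerProductSpace ℂ H] [CompleteSpace H]
  (L : LaplaceOperator H)

/-! ### Sobolev norms -/

theorem norm_projEnd_cpow {μ : ℝ} (hμ : L.bottom ≤ μ) (z : ℂ) (v : L.smooth) :
    ‖L.projEnd μ (L.cpow z v)‖ = μ ^ z.re * ‖L.projEnd μ v‖ := by
  rw [L.projEnd_cpow, norm_smul, Complex.norm_cpow_eq_rpow_re_of_pos (L.bottom_pos.trans_le hμ)]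

theorem norm_le_of_forall_projEnd {v w : L.smooth} {C : ℝ} (hC : 0 ≤ C)
    (h : ∀ μ, L.bottom ≤ μ → ‖L.projEnd μ w‖ ≤ C * ‖L.projEnd μ v‖) : ‖w‖ ≤ C * ‖v‖ := by
  have hw := L.hasSum_norm_sq_proj (w : H)
  have hv := (L.hasSum_norm_sq_proj (v : H)).mul_left (C ^ 2)
  have := hasSum_le (fun μ => ?_) hw hv
  · rw [← mul_pow] at this
    exact (sq_le_sq₀ (norm_nonneg _) (by positivity)).1 this
  · rw [← mul_pow]
    refine pow_le_pow_left₀ (norm_nonneg _) ?_ 2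
    rcases lt_or_ge μ L.bottom with hμ | hμ
    · have h1 : ‖L.projEnd μ w‖ ≤ C * ‖L.projEnd μ v‖ := by
        simp [L.projEnd_eq_zero hμ]
      exact h1
    · exact h μ hμ

theorem sobNorm_nonneg (r : ℕ) (s : ℝ) (v : L.smooth) : 0 ≤ L.sobNorm r s v := norm_nonneg _

theorem sobNorm_add_le (r : ℕ) (s : ℝ) (v w : L.smooth) :
    L.sobNorm r s (v + w) ≤ L.sobNorm r s v + L.sobNorm r s w := by
  unfold sobNorm
  rw [map_add]
  exact norm_add_le _ _

theorem sobNorm_sub_le (r : ℕ) (s : ℝ) (v w : L.smooth) :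
    L.sobNorm r s (v - w) ≤ L.sobNorm r s v + L.sobNorm r s w := by
  unfold sobNorm
  rw [map_sub]
  exact norm_sub_le _ _

theorem sobNorm_smul (r : ℕ) (s : ℝ) (c : ℂ) (v : L.smooth) :
    L.sobNorm r s (c • v) = ‖c‖ * L.sobNorm r s v := by
  unfold sobNorm
  rw [map_smul, norm_smul]

theorem sobNorm_neg (r : ℕ) (s : ℝ) (v : L.smooth) : L.sobNorm r s (-v) = L.sobNorm r s v := by
  unfold sobNorm
  rw [map_neg, norm_neg]

theorem sobNorm_zero_right (r : ℕ) (s : ℝ) : L.sobNorm r s 0 = 0 := by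
  unfold sobNorm
  rw [map_zero, norm_zero]

theorem sobNorm_zero (r : ℕ) (v : L.smooth) : L.sobNorm r 0 v = ‖v‖ := by
  simp [sobNorm, cpow_zero]

theorem sobNorm_le_of_forall_projEnd {r : ℕ} {s t : ℝ} {v w : L.smooth} {C : ℝ} (hC : 0 ≤ C)
    (h : ∀ μ, L.bottom ≤ μ →
      μ ^ (s / r) * ‖L.projEnd μ w‖ ≤ C * (μ ^ (t / r) * ‖L.projEnd μ v‖)) :
    L.sobNorm r s w ≤ C * L.sobNorm r t v := by
  refine L.norm_le_of_forall_projEnd hC fun μ hμ => ?_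
  rw [L.norm_projEnd_cpow hμ, L.norm_projEnd_cpow hμ, Complex.ofReal_re, Complex.ofReal_re]
  exact h μ hμ

theorem sobNorm_cpow_ofReal {r : ℕ} (hr : 0 < r) (s x : ℝ) (v : L.smooth) :
    L.sobNorm r s (L.cpow (x : ℂ) v) = L.sobNorm r (s + r * x) v := by
  unfold sobNorm
  rw [← cpow_add_apply]
  have hr' : (r : ℝ) ≠ 0 := by positivity
  have : s / r + x = (s + r * x) / r := by field_simp
  rw [← this, Complex.ofReal_add]

theorem sobNorm_le_of_le (r : ℕ) {s t : ℝ} (h : s ≤ t) :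
    ∃ C : ℝ, 0 ≤ C ∧ ∀ v, L.sobNorm r s v ≤ C * L.sobNorm r t v := by
  have hb := L.bottom_pos
  refine ⟨L.bottom ^ (s / r - t / r), by positivity, fun v =>
    L.sobNorm_le_of_forall_projEnd (by positivity) fun μ hμ => ?_⟩
  have hμ0 := hb.trans_le hμ
  rw [← mul_assoc]
  refine mul_le_mul_of_nonneg_right ?_ (norm_nonneg _)
  calc μ ^ (s / r) = μ ^ (s / r - t / r) * μ ^ (t / r) := by
        rw [← Real.rpow_add hμ0]; ring_nf
    _ ≤ _ := by
        refine mul_le_mul_of_nonneg_right ?_ (by positivity)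
        exact Real.rpow_le_rpow_of_nonpos hb hμ (by
          have : s / r ≤ t / r := by gcongr
          linarith)

/-! ### Duality and density -/

theorem hasSum_inner_proj (u w : L.smooth) :
    HasSum (fun μ => inner ℂ (L.projEnd μ u) (L.projEnd μ w)) (inner ℂ u w) := by
  have h := (innerSL ℂ (u : H)).hasSum (L.hasSum_proj (w : H))
  simp only [innerSL_apply_apply] at h
  have e : (fun μ => (inner ℂ (L.projEnd μ u) (L.projEnd μ w) : ℂ)) =
      fun μ => inner ℂ (u : H) ((L.eigenspace μ).starProjection (w : H)) := by
    funext μ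
    have h1 := L.inner_proj_self μ (w : H) (u : H)
    rw [← inner_conj_symm (u : H), h1, inner_conj_symm]
    rfl
  rw [e]
  exact h

theorem inner_cpow_ofReal (x : ℝ) (u w : L.smooth) :
    inner ℂ (L.cpow (x : ℂ) u) w = inner ℂ u (L.cpow (x : ℂ) w) := by
  refine (L.hasSum_inner_proj _ _).unique ?_
  convert L.hasSum_inner_proj u (L.cpow (x : ℂ) w) using 2 with μ
  rcases lt_or_ge μ L.bottom with hμ | hμ
  · simp [L.projEnd_eq_zero hμ]
  · rw [L.projEnd_cpow, L.projEnd_cpow, inner_smul_left, inner_smul_right,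
      ← Complex.ofReal_cpow (L.bottom_pos.trans_le hμ).le, Complex.conj_ofReal]

theorem norm_inner_le_sobNorm (r : ℕ) (s : ℝ) (u w : L.smooth) :
    ‖(inner ℂ u w : ℂ)‖ ≤ L.sobNorm r (-s) u * L.sobNorm r s w := by
  have h : (inner ℂ u w : ℂ) =
      inner ℂ (L.cpow ((-s / r : ℝ) : ℂ) u) (L.cpow ((s / r : ℝ) : ℂ) w) := by
    rw [inner_cpow_ofReal, ← cpow_add_apply, ← Complex.ofReal_add]
    have : -s / r + s / r = 0 := by ring
    rw [this, Complex.ofReal_zero, cpow_zero, Module.End.one_apply]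
  rw [h]
  exact norm_inner_le_norm _ _

/-- The spectral projection to a finite set of eigenvalues. -/
def trunc (F : Finset ℝ) : L.EndSmooth := ∑ μ ∈ F, L.projEnd μ

theorem trunc_apply (F : Finset ℝ) (v : L.smooth) : L.trunc F v = ∑ μ ∈ F, L.projEnd μ v := by
  simp [trunc]

theorem projEnd_trunc (F : Finset ℝ) (μ : ℝ) (v : L.smooth) [Decidable (μ ∈ F)] :
    L.projEnd μ (L.trunc F v) = if μ ∈ F then L.projEnd μ v else 0 := by
  rw [trunc_apply, map_sum]
  split_ifs with h
  · rw [Finset.sum_eq_single μ, projEnd_projEnd]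
    · exact fun ν _ hν => L.projEnd_projEnd_ne hν.symm v
    · exact fun h' => absurd h h'
  · exact Finset.sum_eq_zero fun ν hν => L.projEnd_projEnd_ne (by rintro rfl; exact h hν) v

theorem trunc_trunc (F : Finset ℝ) (v : L.smooth) : L.trunc F (L.trunc F v) = L.trunc F v := by
  classical
  refine L.ext_projEnd fun μ => ?_
  rw [projEnd_trunc]
  split_ifs with h
  · rfl
  · rw [projEnd_trunc, if_neg h]

theorem cpow_trunc (F : Finset ℝ) (z : ℂ) (v : L.smooth) :
    L.cpow z (L.trunc F v) = L.trunc F (L.cpow z v) := by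
  classical
  refine L.ext_projEnd fun μ => ?_
  rw [projEnd_trunc, projEnd_cpow, projEnd_cpow, projEnd_trunc]
  split_ifs <;> simp

theorem tendsto_trunc (v : L.smooth) :
    Tendsto (fun F => ‖v - L.trunc F v‖) atTop (𝓝 0) := by
  have h := L.hasSum_proj (v : H)
  have h2 : Tendsto (fun F : Finset ℝ => ‖(v : H) - ∑ μ ∈ F, (L.eigenspace μ).starProjection (v : H)‖)
      atTop (𝓝 ‖(v : H) - v‖) := (tendsto_const_nhds.sub h).norm
  rw [sub_self, norm_zero] at h2
  refine h2.congr fun F => ?_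
  rw [trunc_apply]
  simp only [← coe_projEnd, ← AddSubmonoidClass.coe_finsetSum, ← AddSubgroupClass.coe_sub]
  rfl

theorem trunc_filter (F : Finset ℝ) (v : L.smooth) :
    L.trunc (F.filter (L.bottom ≤ ·)) v = L.trunc F v := by
  rw [trunc_apply, trunc_apply, Finset.sum_filter]
  refine Finset.sum_congr rfl fun μ _ => ?_
  split_ifs with h
  · rfl
  · rw [L.projEnd_eq_zero (not_le.1 h)]

theorem inner_trunc_self (F : Finset ℝ) (v : L.smooth) :
    inner ℂ (L.trunc F v) v = ((‖L.trunc F v‖ ^ 2 : ℝ) : ℂ) := by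
  classical
  have h1 : inner ℂ (L.trunc F v) v = inner ℂ (L.trunc F v) (L.trunc F v) := by
    refine (L.hasSum_inner_proj _ _).unique ?_
    convert L.hasSum_inner_proj (L.trunc F v) (L.trunc F v) using 2 with μ
    rw [projEnd_trunc]
    split_ifs <;> simp
  rw [h1, inner_self_eq_norm_sq_to_K]
  norm_cast

/-- Duality of the Sobolev norms of exponents `s` and `-s`. With `y = Δ ^ (s / r) w`, the test
vector `Δ ^ (s / r) (trunc G y)` pairs with `w` to `‖trunc G y‖ ^ 2` and has dual norm `‖trunc G
y‖`; then `G` grows. Finite spectral support of the test vectors later makes every matrix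
coefficient a finite sum. -/
theorem sobNorm_le_of_inner {r : ℕ} {s C : ℝ} {w : L.smooth}
    (h : ∀ F : Finset ℝ, (∀ μ ∈ F, L.bottom ≤ μ) → ∀ u : L.smooth, L.trunc F u = u →
      ‖(inner ℂ u w : ℂ)‖ ≤ L.sobNorm r (-s) u * C) (hC : 0 ≤ C) :
    L.sobNorm r s w ≤ C := by
  set y := L.cpow ((s / r : ℝ) : ℂ) w with hy
  have key : ∀ F : Finset ℝ, ‖L.trunc F y‖ ≤ C := by
    intro F
    rw [← trunc_filter]
    set G := F.filter (L.bottom ≤ ·)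
    have h1 := h G (fun μ hμ => (Finset.mem_filter.1 hμ).2) (L.cpow ((s / r : ℝ) : ℂ) (L.trunc G y))
      (by rw [← cpow_trunc, trunc_trunc])
    have h2 : L.sobNorm r (-s) (L.cpow ((s / r : ℝ) : ℂ) (L.trunc G y)) = ‖L.trunc G y‖ := by
      unfold sobNorm
      rw [← cpow_add_apply, ← Complex.ofReal_add]
      have : -s / r + s / r = 0 := by ring
      rw [this, Complex.ofReal_zero, cpow_zero, Module.End.one_apply]
    rw [h2, inner_cpow_ofReal, ← hy, inner_trunc_self, Complex.norm_real, Real.norm_of_nonneg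
      (by positivity), pow_two] at h1
    rcases (norm_nonneg (L.trunc G y)).eq_or_lt with h0 | h0
    · rw [← h0]; exact hC
    · exact le_of_mul_le_mul_left h1 h0
  have h3 : ∀ F : Finset ℝ, ‖y‖ - ‖y - L.trunc F y‖ ≤ C := fun F => by
    have := norm_sub_norm_le y (y - L.trunc F y)
    rw [sub_sub_cancel] at this
    exact this.trans (key F)
  have h4 := (tendsto_const_nhds (x := ‖y‖)).sub (L.tendsto_trunc y)
  rw [sub_zero] at h4
  exact le_of_tendsto h4 (Eventually.of_forall h3)

theorem sobNorm_trunc_le (r : ℕ) (s : ℝ) (F : Finset ℝ) (v : L.smooth) :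
    L.sobNorm r s (L.trunc F v) ≤ L.sobNorm r s v := by
  classical
  have := L.sobNorm_le_of_forall_projEnd (r := r) (s := s) (t := s) (v := v) (w := L.trunc F v)
    zero_le_one fun μ hμ => by
      have := L.bottom_pos.trans_le hμ
      rw [one_mul, projEnd_trunc]
      split_ifs
      · exact le_rfl
      · rw [norm_zero, mul_zero]; positivity
  rwa [one_mul] at this

variable {L}

/-- Matrix coefficients between finite spectral vectors control the operator norm. The a priori
order `t` may be far from optimal and does not enter the constant: it only gives the continuity
needed to pass from truncated vectors to all smooth ones. -/
theorem IsOp.sobNorm_le_of_inner {r : ℕ} {t : ℝ} {T : L.EndSmooth} (hT : L.IsOp r t T)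
    {s σ C : ℝ} (hC : 0 ≤ C)
    (h : ∀ F G : Finset ℝ, (∀ μ ∈ F, L.bottom ≤ μ) → (∀ ν ∈ G, L.bottom ≤ ν) →
      ∀ u v : L.smooth, L.trunc F u = u → L.trunc G v = v →
        ‖(inner ℂ u (T v) : ℂ)‖ ≤ C * L.sobNorm r (-s) u * L.sobNorm r σ v) (v : L.smooth) :
    L.sobNorm r s (T v) ≤ C * L.sobNorm r σ v := by
  obtain ⟨C', hC'⟩ := hT s
  have key : ∀ G : Finset ℝ, L.sobNorm r s (T (L.trunc G v)) ≤ C * L.sobNorm r σ v := by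
    intro G
    rw [← trunc_filter]
    refine (L.sobNorm_le_of_inner (C := C * L.sobNorm r σ (L.trunc (G.filter (L.bottom ≤ ·)) v))
      (fun F hF u hu => ?_) (mul_nonneg hC (L.sobNorm_nonneg _ _ _))).trans
      (mul_le_mul_of_nonneg_left (L.sobNorm_trunc_le _ _ _ _) hC)
    exact (h F _ hF (fun μ hμ => (Finset.mem_filter.1 hμ).2) u _ hu (L.trunc_trunc _ _)).trans_eq
      (by ring)
  have h3 : ∀ G : Finset ℝ,
      L.sobNorm r s (T v) - C' * L.sobNorm r (s + t) (v - L.trunc G v) ≤ C * L.sobNorm r σ v := by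
    intro G
    have h5 := L.sobNorm_add_le r s (T (L.trunc G v)) (T (v - L.trunc G v))
    rw [← map_add, add_sub_cancel] at h5
    linarith [key G, hC' (v - L.trunc G v)]
  have h4 : Tendsto (fun G => L.sobNorm r (s + t) (v - L.trunc G v)) atTop (𝓝 0) := by
    refine (L.tendsto_trunc (L.cpow (((s + t) / r : ℝ) : ℂ) v)).congr fun G => ?_
    rw [sobNorm, map_sub, cpow_trunc]
  have h6 := (tendsto_const_nhds (x := L.sobNorm r s (T v))).sub (h4.const_mul C')
  rw [mul_zero, sub_zero] at h6
  exact le_of_tendsto h6 (Eventually.of_forall h3)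

/-! ### Locally bounded families -/

/-- Families of operators which are locally bounded, on a set of parameters, for the topology of
the operators of analytic order at most `t`. -/
def IsLocBdd (r : ℕ) (t : ℝ) (U : Set ℂ) (T : ℂ → L.EndSmooth) : Prop :=
  ∀ s : ℝ, ∀ z₀ ∈ U, ∃ C : ℝ, 0 ≤ C ∧ ∀ᶠ z in 𝓝 z₀, ∀ v : L.smooth,
    L.sobNorm r s (T z v) ≤ C * L.sobNorm r (s + t) v

theorem IsOp.exists_nonneg {r : ℕ} {t : ℝ} {T : L.EndSmooth} (hT : L.IsOp r t T) (s : ℝ) :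
    ∃ C : ℝ, 0 ≤ C ∧ ∀ v, L.sobNorm r s (T v) ≤ C * L.sobNorm r (s + t) v := by
  obtain ⟨C, hC⟩ := hT s
  exact ⟨|C|, abs_nonneg C, fun v => (hC v).trans
    (mul_le_mul_of_nonneg_right (le_abs_self C) (L.sobNorm_nonneg _ _ _))⟩

theorem IsOp.isLocBdd {r : ℕ} {t : ℝ} {T : L.EndSmooth} (hT : L.IsOp r t T) (U : Set ℂ) :
    IsLocBdd r t U fun _ => T := by
  intro s _ _
  obtain ⟨C, h0, hC⟩ := hT.exists_nonneg s
  exact ⟨C, h0, Eventually.of_forall fun _ => hC⟩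

namespace IsLocBdd

variable {r : ℕ} {t t' : ℝ} {U V : Set ℂ} {S T : ℂ → L.EndSmooth}

theorem isOp (hT : IsLocBdd r t U T) {z : ℂ} (hz : z ∈ U) : L.IsOp r t (T z) := by
  intro s
  obtain ⟨C, -, hC⟩ := hT s z hz
  exact ⟨C, hC.self_of_nhds⟩

theorem congr (hT : IsLocBdd r t U T) (hU : IsOpen U) (h : ∀ z ∈ U, S z = T z) :
    IsLocBdd r t U S := by
  intro s z hz
  obtain ⟨C, h0, hC⟩ := hT s z hz
  refine ⟨C, h0, ?_⟩
  filter_upwards [hC, hU.mem_nhds hz] with w hw hwU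
  rw [h w hwU]
  exact hw

theorem mono (hT : IsLocBdd r t U T) (h : t ≤ t') : IsLocBdd r t' U T := by
  intro s z hz
  obtain ⟨C, h0, hC⟩ := hT s z hz
  obtain ⟨C', h0', hC'⟩ := L.sobNorm_le_of_le r (add_le_add_right h s)
  refine ⟨C * C', mul_nonneg h0 h0', hC.mono fun w hw v => (hw v).trans ?_⟩
  rw [mul_assoc]
  exact mul_le_mul_of_nonneg_left (hC' v) h0

theorem mono_set (hT : IsLocBdd r t U T) (h : V ⊆ U) : IsLocBdd r t V T :=
  fun s z hz => hT s z (h hz)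

theorem add (hS : IsLocBdd r t U S) (hT : IsLocBdd r t U T) :
    IsLocBdd r t U fun z => S z + T z := by
  intro s z hz
  obtain ⟨C, h0, hC⟩ := hS s z hz
  obtain ⟨C', h0', hC'⟩ := hT s z hz
  refine ⟨C + C', add_nonneg h0 h0', ?_⟩
  filter_upwards [hC, hC'] with w hw hw' v
  rw [add_mul]
  exact (L.sobNorm_add_le r s _ _).trans (add_le_add (hw v) (hw' v))

theorem zero : IsLocBdd r t U fun _ => (0 : L.EndSmooth) := fun s z _ =>
  ⟨0, le_rfl, Eventually.of_forall fun _ v => by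
    rw [LinearMap.zero_apply, sobNorm_zero_right, zero_mul]⟩

theorem sum {ι : Type*} {A : Finset ι} {F : ι → ℂ → L.EndSmooth}
    (h : ∀ i ∈ A, IsLocBdd r t U (F i)) : IsLocBdd r t U fun z => ∑ i ∈ A, F i z := by
  classical
  induction A using Finset.induction_on with
  | empty => simpa using zero
  | insert i A hi ih =>
    simp only [Finset.sum_insert hi]
    exact (h i (Finset.mem_insert_self _ _)).add
      (ih fun j hj => h j (Finset.mem_insert_of_mem hj))

theorem smul {f : ℂ → ℂ} (hT : IsLocBdd r t U T) (hf : Continuous f) :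
    IsLocBdd r t U fun z => f z • T z := by
  intro s z hz
  obtain ⟨C, h0, hC⟩ := hT s z hz
  have hfz : ∀ᶠ w in 𝓝 z, ‖f w‖ < ‖f z‖ + 1 :=
    (hf.norm.continuousAt).eventually_lt continuousAt_const (by simp)
  refine ⟨(‖f z‖ + 1) * C, by positivity, ?_⟩
  filter_upwards [hC, hfz] with w hw hfw v
  rw [LinearMap.smul_apply, sobNorm_smul, mul_assoc]
  exact mul_le_mul hfw.le (hw v) (L.sobNorm_nonneg _ _ _) (by positivity)

theorem neg (hT : IsLocBdd r t U T) : IsLocBdd r t U fun z => -T z := by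
  intro s z hz
  obtain ⟨C, h0, hC⟩ := hT s z hz
  refine ⟨C, h0, hC.mono fun w hw v => ?_⟩
  rw [LinearMap.neg_apply, sobNorm_neg]
  exact hw v

theorem sub (hS : IsLocBdd r t U S) (hT : IsLocBdd r t U T) :
    IsLocBdd r t U fun z => S z - T z := by
  simpa [sub_eq_add_neg] using hS.add hT.neg

theorem mul (hS : IsLocBdd r t U S) (hT : IsLocBdd r t' U T) :
    IsLocBdd r (t + t') U fun z => S z * T z := by
  intro s z hz
  obtain ⟨C, h0, hC⟩ := hS s z hz
  obtain ⟨C', h0', hC'⟩ := hT (s + t) z hz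
  refine ⟨C * C', mul_nonneg h0 h0', ?_⟩
  filter_upwards [hC, hC'] with w hw hw' v
  rw [Module.End.mul_apply, mul_assoc, ← add_assoc]
  exact (hw _).trans (mul_le_mul_of_nonneg_left (hw' v) h0)

theorem comp (hT : IsLocBdd r t U T) {φ : ℂ → ℂ} (hφ : Continuous φ) (h : ∀ z ∈ V, φ z ∈ U) :
    IsLocBdd r t V fun z => T (φ z) := by
  intro s z hz
  obtain ⟨C, h0, hC⟩ := hT s (φ z) (h z hz)
  exact ⟨C, h0, hφ.continuousAt.eventually hC⟩

theorem cpow (hr : 0 < r) (hU : IsOpen U) {φ : ℂ → ℂ} (hφ : Continuous φ)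
    (h : ∀ z ∈ U, r * (φ z).re ≤ t) : IsLocBdd r t U fun z => L.cpow (φ z) := by
  have hb := L.bottom_pos
  intro s z hz
  have hc : Continuous fun w => L.bottom ^ ((φ w).re - t / r) :=
    Continuous.rpow continuous_const (by fun_prop) fun _ => Or.inl hb.ne'
  have hev : ∀ᶠ w in 𝓝 z, L.bottom ^ ((φ w).re - t / r) < L.bottom ^ ((φ z).re - t / r) + 1 :=
    hc.continuousAt.eventually_lt continuousAt_const (by simp)
  -- For a nonpositive exponent, `μ ^ x ≤ bottom ^ x`; the added `1` absorbs the variation of the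
  -- exponent near `z`.
  refine ⟨L.bottom ^ ((φ z).re - t / r) + 1, by positivity, ?_⟩
  filter_upwards [hev, hU.mem_nhds hz] with w hw hwU v
  refine L.sobNorm_le_of_forall_projEnd (by positivity) fun μ hμ => ?_
  have hμ0 := hb.trans_le hμ
  rw [L.norm_projEnd_cpow hμ, ← mul_assoc, ← mul_assoc]
  refine mul_le_mul_of_nonneg_right ?_ (norm_nonneg _)
  have hr' : (0 : ℝ) < r := by positivity
  calc μ ^ (s / r) * μ ^ (φ w).re = μ ^ ((φ w).re - t / r) * μ ^ ((s + t) / r) := by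
        rw [← Real.rpow_add hμ0, ← Real.rpow_add hμ0]; ring_nf
    _ ≤ _ := by
        refine mul_le_mul_of_nonneg_right ?_ (by positivity)
        refine (Real.rpow_le_rpow_of_nonpos hb hμ ?_).trans hw.le
        have := h w hwU
        rw [sub_nonpos, le_div_iff₀ hr']
        linarith

end IsLocBdd

theorem IsOp.mul {r : ℕ} {t t' : ℝ} {S T : L.EndSmooth} (hS : L.IsOp r t S) (hT : L.IsOp r t' T) :
    L.IsOp r (t + t') (S * T) :=
  ((hS.isLocBdd Set.univ).mul (hT.isLocBdd Set.univ)).isOp (Set.mem_univ 0)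

theorem IsOp.cpow {r : ℕ} (hr : 0 < r) {t : ℝ} {z : ℂ} (h : r * z.re ≤ t) :
    L.IsOp r t (L.cpow z) :=
  (IsLocBdd.cpow hr isOpen_univ (continuous_const (y := z)) fun _ _ => h).isOp (Set.mem_univ 0)

end LaplaceOperator

namespace LaplaceOperator

variable {H : Type*} [NormedAddCommGroup H] [InnerProductSpace ℂ H] [CompleteSpace H]
  (L : LaplaceOperator H)

/-! ### Iterated commutators -/

/-- The iterated commutator with the Laplace operator. -/
def adPow (k : ℕ) (B : L.EndSmooth) : L.EndSmooth := (fun Y => ⁅L.opEnd, Y⁆)^[k] B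

theorem adPow_zero (B : L.EndSmooth) : L.adPow 0 B = B := rfl

theorem adPow_succ (k : ℕ) (B : L.EndSmooth) :
    L.adPow (k + 1) B = ⁅L.opEnd, L.adPow k B⁆ := by
  unfold adPow
  rw [Function.iterate_succ_apply']

theorem adPow_one (B : L.EndSmooth) : L.adPow 1 B = ⁅L.opEnd, B⁆ := rfl

theorem adPow_adPow (j k : ℕ) (B : L.EndSmooth) : L.adPow j (L.adPow k B) = L.adPow (k + j) B := by
  unfold adPow
  rw [add_comm k j, Function.iterate_add_apply]

theorem adPow_succ_one (k : ℕ) : L.adPow (k + 1) 1 = 0 := by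
  induction k with
  | zero => rw [adPow_one, Ring.lie_def, mul_one, one_mul, sub_self]
  | succ k ih => rw [adPow_succ, ih, Ring.lie_def, mul_zero, zero_mul, sub_zero]

theorem opEnd_projEnd (ν : ℝ) (v : L.smooth) :
    L.opEnd (L.projEnd ν v) = (ν : ℂ) • L.projEnd ν v := by
  refine L.ext_projEnd fun μ => ?_
  rw [projEnd_opEnd, map_smul]
  rcases eq_or_ne μ ν with rfl | h
  · rfl
  · rw [L.projEnd_projEnd_ne h, smul_zero, smul_zero]

theorem cpow_projEnd (ν : ℝ) (z : ℂ) (v : L.smooth) :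
    L.cpow z (L.projEnd ν v) = (ν : ℂ) ^ z • L.projEnd ν v := by
  refine L.ext_projEnd fun μ => ?_
  rw [projEnd_cpow, map_smul]
  rcases eq_or_ne μ ν with rfl | h
  · rfl
  · rw [L.projEnd_projEnd_ne h, smul_zero, smul_zero]

/-- This turns the commutator expansion into the scalar Taylor expansion of `x ↦ x ^ z` at `ν`,
evaluated at `μ`. -/
theorem projEnd_adPow_projEnd (k : ℕ) (B : L.EndSmooth) (μ ν : ℝ) (v : L.smooth) :
    L.projEnd μ (L.adPow k B (L.projEnd ν v)) =
      ((μ : ℂ) - ν) ^ k • L.projEnd μ (B (L.projEnd ν v)) := by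
  induction k with
  | zero => simp [adPow_zero]
  | succ k ih =>
    rw [adPow_succ, Ring.lie_def, LinearMap.sub_apply, Module.End.mul_apply, Module.End.mul_apply,
      opEnd_projEnd, map_sub, map_smul, map_smul, projEnd_opEnd, ih, ← sub_smul, smul_smul, pow_succ,
      mul_comm]

/-! ### Remainders of the expansion of `Δ ^ z B` -/

/-- The remainder of the expansion of `Δ ^ z B` after `N` terms. -/
def rem (N : ℕ) (z : ℂ) (B : L.EndSmooth) : L.EndSmooth :=
  L.cpow z * B - ∑ k ∈ Finset.range N, Ring.choose z k • (L.adPow k B * L.cpow (z - k))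

theorem cpow_mul_eq (N : ℕ) (z : ℂ) (B : L.EndSmooth) : L.cpow z * B =
    ∑ k ∈ Finset.range N, Ring.choose z k • (L.adPow k B * L.cpow (z - k)) + L.rem N z B := by
  unfold rem
  abel

/-- Expand `Δ ^ w B` to order `N`, then move `Δ ^ z` past each `ad ^ k B`, to order `N - k`;
Vandermonde's identity recombines the binomial coefficients. Through this cocycle identity, bounds
on a strip propagate to half-planes. -/
theorem rem_add (N : ℕ) (z w : ℂ) (B : L.EndSmooth) :
    L.rem N (z + w) B = L.cpow z * L.rem N w B +
      ∑ k ∈ Finset.range N, Ring.choose w k • (L.rem (N - k) z (L.adPow k B) * L.cpow (w - k)) := by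
  have h1 : ∀ k ∈ Finset.range N,
      Ring.choose w k • (L.rem (N - k) z (L.adPow k B) * L.cpow (w - k)) =
        Ring.choose w k • (L.cpow z * (L.adPow k B * L.cpow (w - k))) -
          ∑ j ∈ Finset.range (N - k), (Ring.choose w k * Ring.choose z j) •
            (L.adPow (k + j) B * L.cpow (z + w - (k + j : ℕ))) := by
    intro k _
    rw [rem, sub_mul, smul_sub, mul_assoc, Finset.sum_mul, Finset.smul_sum]
    congr 1
    refine Finset.sum_congr rfl fun j _ => ?_
    rw [smul_mul_assoc, smul_smul, mul_assoc, ← cpow_add, adPow_adPow]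
    congr 4
    push_cast
    ring
  rw [Finset.sum_congr rfl h1, Finset.sum_sub_distrib, ← Finset.sum_range_diag_flip N
    fun k j => (Ring.choose w k * Ring.choose z j) •
            (L.adPow (k + j) B * L.cpow (z + w - (k + j : ℕ)))]
  have h2 : ∀ m ∈ Finset.range N, ∑ k ∈ Finset.range (m + 1),
      (Ring.choose w k * Ring.choose z (m - k)) •
            (L.adPow (k + (m - k)) B * L.cpow (z + w - (k + (m - k) : ℕ))) =
      Ring.choose (z + w) m • (L.adPow m B * L.cpow (z + w - m)) := by
    intro m _
    rw [add_comm z w, Ring.add_choose_eq m (Commute.all w z),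
      Finset.Nat.sum_antidiagonal_eq_sum_range_succ_mk, Finset.sum_smul]
    refine Finset.sum_congr rfl fun k hk => ?_
    rw [Nat.add_sub_of_le (Nat.lt_succ_iff.1 (Finset.mem_range.1 hk))]
  rw [Finset.sum_congr rfl h2]
  rw [rem, rem, mul_sub, ← mul_assoc, ← cpow_add, Finset.mul_sum]
  simp only [mul_smul_comm]
  abel

theorem rem_zero_right {N : ℕ} (hN : 0 < N) (B : L.EndSmooth) : L.rem N 0 B = 0 := by
  obtain ⟨N, rfl⟩ := Nat.exists_eq_succ_of_ne_zero hN.ne'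
  rw [rem, Finset.sum_range_succ', Finset.sum_eq_zero fun k _ => ?_]
  · simp [cpow_zero, adPow_zero]
  · rw [Ring.choose_zero_succ, zero_smul]

theorem choose_one_add_two (k : ℕ) : Ring.choose (1 : ℂ) (k + 2) = 0 := by
  have := Ring.choose_natCast (R := ℂ) 1 (k + 2)
  rwa [Nat.choose_eq_zero_of_lt (by omega), Nat.cast_one, Nat.cast_zero] at this

theorem rem_one_right {N : ℕ} (hN : 1 < N) (B : L.EndSmooth) : L.rem N 1 B = 0 := by
  obtain ⟨N, rfl⟩ := Nat.exists_eq_add_of_lt hN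
  rw [rem, show 1 + N + 1 = N + 2 by ring, Finset.sum_range_succ', Finset.sum_range_succ',
    Finset.sum_eq_zero fun k _ => ?_]
  · simp [cpow_zero, adPow_zero, cpow_one, adPow_one, Ring.lie_def]
  · rw [choose_one_add_two, zero_smul]

/-- For natural exponents the expansion is an exact Leibniz formula. Adding `1` to the exponent
through `rem_add` leaves only `k = 0, 1`, for which `n < N - k` still holds. -/
theorem rem_natCast {n N : ℕ} (hN : n < N) (B : L.EndSmooth) : L.rem N n B = 0 := by
  induction n generalizing N B with
  | zero => simpa using L.rem_zero_right hN B
  | succ n ih =>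
    rw [Nat.cast_succ, rem_add, L.rem_one_right (by omega), mul_zero, zero_add]
    refine Finset.sum_eq_zero fun k _ => ?_
    rcases lt_or_ge k 2 with hk | hk
    · rw [ih (by omega), zero_mul, smul_zero]
    · obtain ⟨j, rfl⟩ := Nat.exists_eq_add_of_le' hk
      rw [choose_one_add_two, zero_smul]

theorem rem_one_left {N : ℕ} (hN : 0 < N) (z : ℂ) : L.rem N z 1 = 0 := by
  obtain ⟨N, rfl⟩ := Nat.exists_eq_succ_of_ne_zero hN.ne'
  rw [rem, Finset.sum_range_succ', Finset.sum_eq_zero fun k _ => ?_]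
  · simp [adPow_zero]
  · rw [adPow_succ_one, zero_mul, smul_zero]

/-! ### Analytic order of generalized differential operators -/

namespace DiffAlgebra

variable {L} {r : ℕ} (D : L.DiffAlgebra r)

theorem adPow_mem {b : ℕ} {B : L.EndSmooth} (hB : B ∈ D.filt b) (k : ℕ) :
    L.adPow k B ∈ D.filt (b + k * (r - 1)) := by
  induction k with
  | zero => simpa [adPow_zero] using hB
  | succ k ih =>
    rw [adPow_succ]
    have := D.filt_comm _ _ ih
    have hr := D.r_pos
    rwa [show b + k * (r - 1) + r - 1 = b + (k + 1) * (r - 1) by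
      rw [add_mul, one_mul]; omega] at this

/-- The sharp Sobolev estimate at the exponent `s`. -/
def SharpAt (s : ℝ) : Prop :=
  ∀ q : ℕ, ∀ X ∈ D.filt q, ∃ C : ℝ, 0 ≤ C ∧ ∀ v, L.sobNorm r s (X v) ≤ C * L.sobNorm r (s + q) v

/-- This is the Gårding inequality, its extra term `‖v‖` being absorbed because the spectrum is
bounded below by a positive number. -/
theorem sharpAt_zero : D.SharpAt 0 := by
  intro q X hX
  obtain ⟨ε, hε, h⟩ := D.garding q X hX
  obtain ⟨C, hC0, hC⟩ := L.sobNorm_le_of_le r (Nat.cast_nonneg q : (0 : ℝ) ≤ q)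
  refine ⟨ε⁻¹ * (1 + C), by positivity, fun v => ?_⟩
  have h1 := h v
  have h2 := hC v
  rw [sobNorm_zero] at h2
  rw [sobNorm_zero, zero_add, mul_assoc, ← div_eq_inv_mul, le_div_iff₀ hε, add_mul, one_mul,
    mul_comm]
  exact h1.trans (add_le_add le_rfl h2)

theorem opEnd_mul_eq (X : L.EndSmooth) (v : L.smooth) :
    L.opEnd (X v) = X (L.opEnd v) + ⁅L.opEnd, X⁆ v := by
  rw [Ring.lie_def, LinearMap.sub_apply, Module.End.mul_apply, Module.End.mul_apply]
  abel

theorem sobNorm_opEnd (D : L.DiffAlgebra r) (s : ℝ) (v : L.smooth) :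
    L.sobNorm r s (L.opEnd v) = L.sobNorm r (s + r) v := by
  have := L.sobNorm_cpow_ofReal D.r_pos s 1 v
  rwa [Complex.ofReal_one, cpow_one, mul_one] at this

theorem cast_add_sub_one (D : L.DiffAlgebra r) (q : ℕ) : ((q + r - 1 : ℕ) : ℝ) = q + r - 1 := by
  have := D.r_pos
  rw [Nat.cast_sub (by omega)]
  push_cast
  ring

/-- Raising the exponent by `r` amounts to applying `Δ`; in `Δ X = X Δ + [Δ, X]` the commutator has
order one less than the main term. -/
theorem SharpAt.add {s : ℝ} (h : D.SharpAt s) : D.SharpAt (s + r) := by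
  intro q X hX
  obtain ⟨C, hC0, hC⟩ := h q X hX
  obtain ⟨C', hC0', hC'⟩ := h _ _ (D.filt_comm q X hX)
  obtain ⟨E, hE0, hE⟩ := L.sobNorm_le_of_le r
    (show s + (q + r - 1 : ℕ) ≤ s + r + q by rw [D.cast_add_sub_one]; linarith)
  refine ⟨C + C' * E, by positivity, fun v => ?_⟩
  rw [← D.sobNorm_opEnd, opEnd_mul_eq]
  refine (L.sobNorm_add_le _ _ _ _).trans ?_
  rw [add_mul]
  refine add_le_add ((hC _).trans_eq ?_) ((hC' v).trans ?_)
  · rw [D.sobNorm_opEnd, add_right_comm]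
  · rw [mul_assoc]
    exact mul_le_mul_of_nonneg_left (hE v) hC0'

/-- Lowering the exponent uses `v = Δ w` and `X Δ w = Δ X w - [Δ, X] w`. The commutator must be
estimated at the same exponent `s - r` that is sought, so the argument is a bootstrap: each round
improves the second norm by one order, starting from the estimate at `s`. -/
theorem SharpAt.sub_aux {s : ℝ} (h : D.SharpAt s) (j : ℕ) : ∀ q : ℕ, ∀ X ∈ D.filt q,
    ∃ C : ℝ, 0 ≤ C ∧ ∀ v, L.sobNorm r (s - r) (X v) ≤
      C * (L.sobNorm r (s - r + q) v + L.sobNorm r (s + q - j) v) := by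
  induction j with
  | zero =>
    intro q X hX
    obtain ⟨C, hC0, hC⟩ := h q X hX
    obtain ⟨E, hE0, hE⟩ := L.sobNorm_le_of_le r
      (show s - r ≤ s by have : (0 : ℝ) ≤ r := Nat.cast_nonneg r; linarith)
    refine ⟨E * C, by positivity, fun v => (hE _).trans ?_⟩
    rw [mul_assoc]
    refine mul_le_mul_of_nonneg_left ((hC v).trans (mul_le_mul_of_nonneg_left ?_ hC0)) hE0
    rw [Nat.cast_zero, sub_zero]
    exact le_add_of_nonneg_left (L.sobNorm_nonneg _ _ _)
  | succ j ih =>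
    intro q X hX
    obtain ⟨C, hC0, hC⟩ := h q X hX
    obtain ⟨C', hC0', hC'⟩ := ih _ _ (D.filt_comm q X hX)
    obtain ⟨E, hE0, hE⟩ := L.sobNorm_le_of_le r
      (show s - r + (q - 1) ≤ s - r + q by linarith)
    refine ⟨C + C' * (E + 1), by positivity, fun v => ?_⟩
    obtain ⟨w, rfl⟩ : ∃ w, v = L.opEnd w := ⟨L.cpow (-1) v, by
      rw [← cpow_one, ← cpow_add_apply, add_neg_cancel, cpow_zero, Module.End.one_apply]⟩
    have h1 : X (L.opEnd w) = L.opEnd (X w) - ⁅L.opEnd, X⁆ w := by rw [opEnd_mul_eq]; abel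
    have h2 := hC w
    have h3 := hC' w
    have h4 := hE (L.opEnd w)
    rw [D.cast_add_sub_one] at h3
    rw [show s - r + (q + r - 1) = s - r + (q - 1) + r by ring,
      show s + (q + r - 1) - j = s + q - (j + 1 : ℕ) + r by push_cast; ring,
      ← D.sobNorm_opEnd, ← D.sobNorm_opEnd] at h3
    rw [show s + q = s - r + q + r by ring, ← D.sobNorm_opEnd] at h2
    rw [h1]
    refine (L.sobNorm_sub_le _ _ _ _).trans ?_
    rw [D.sobNorm_opEnd, sub_add_cancel]
    refine (add_le_add h2 h3).trans ?_
    have p1 := L.sobNorm_nonneg r (s - r + q) (L.opEnd w)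
    have p2 := L.sobNorm_nonneg r (s + q - (j + 1 : ℕ)) (L.opEnd w)
    have h5 := mul_le_mul_of_nonneg_left h4 hC0'
    have p3 := mul_nonneg hC0 p2
    have p4 := mul_nonneg (mul_nonneg hC0' hE0) p2
    have p5 := mul_nonneg hC0' p1
    linarith

theorem SharpAt.sub {s : ℝ} (h : D.SharpAt s) : D.SharpAt (s - r) := by
  intro q X hX
  obtain ⟨C, hC0, hC⟩ := h.sub_aux D r q X hX
  refine ⟨C * 2, by positivity, fun v => (hC v).trans_eq ?_⟩
  rw [add_sub_right_comm]
  ring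

theorem sharpAt_int (k : ℤ) : D.SharpAt (r * k) := by
  induction k using Int.induction_on with
  | zero => simpa using D.sharpAt_zero
  | succ k ih =>
    have := ih.add
    rwa [show (r : ℝ) * (k : ℤ) + r = r * ((k + 1 : ℤ) : ℝ) by push_cast; ring] at this
  | pred k ih =>
    have := ih.sub
    rwa [show (r : ℝ) * ((-k : ℤ) : ℝ) - r = r * ((-k - 1 : ℤ) : ℝ) by push_cast; ring] at this

/-- Sharp estimates are available at multiples of `r`; rounding `s` up to the next one costs at most
`r` orders. This replaces interpolation, and the fixed loss is harmless because remainders are taken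
to arbitrary depth. -/
theorem isOp {q : ℕ} {X : L.EndSmooth} (hX : X ∈ D.filt q) : L.IsOp r (q + r) X := by
  intro s
  have hr : (0 : ℝ) < r := Nat.cast_pos.2 D.r_pos
  have h1 := (div_le_iff₀' hr).1 (Int.le_ceil (s / r))
  have h2 : r * (⌈s / r⌉ : ℝ) ≤ s + r := by
    have := (Int.ceil_lt_add_one (s / r)).le
    calc r * (⌈s / r⌉ : ℝ) ≤ r * (s / r + 1) := by gcongr
      _ = s + r := by field_simp
  obtain ⟨C, hC0, hC⟩ := D.sharpAt_int ⌈s / r⌉ q X hX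
  obtain ⟨E, hE0, hE⟩ := L.sobNorm_le_of_le r h1
  obtain ⟨E', hE0', hE'⟩ := L.sobNorm_le_of_le r
    (show r * (⌈s / r⌉ : ℝ) + q ≤ s + (q + r) by linarith)
  refine ⟨E * (C * E'), fun v => (hE _).trans ?_⟩
  rw [mul_assoc, mul_assoc]
  exact mul_le_mul_of_nonneg_left
    ((hC v).trans (mul_le_mul_of_nonneg_left (hE' v) hC0)) hE0

end DiffAlgebra

end LaplaceOperator

/-! ### Binomial coefficients and a Beta integral -/

theorem succ_mul_choose_succ (z : ℂ) (k : ℕ) :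
    ((k : ℂ) + 1) * Ring.choose z (k + 1) = (z - k) * Ring.choose z k := by
  rw [Ring.choose_eq_smul, Ring.choose_eq_smul, descPochhammer_succ_right, Polynomial.smeval_mul,
    Polynomial.smeval_sub, Polynomial.smeval_X, Polynomial.smeval_natCast, Nat.factorial_succ]
  have h1 : ((k : ℂ) + 1) ≠ 0 := by exact_mod_cast Nat.succ_ne_zero k
  have h2 : ((k.factorial : ℕ) : ℂ) ≠ 0 := by exact_mod_cast k.factorial_ne_zero
  simp only [smul_eq_mul, pow_one, pow_zero, nsmul_eq_mul, mul_one]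
  push_cast
  field_simp

/-- The binomial coefficient as a polynomial. -/
theorem exists_choose_polynomial (k : ℕ) :
    ∃ p : Polynomial ℂ, ∀ z, p.eval z = Ring.choose z k := by
  induction k with
  | zero => exact ⟨1, fun z => by simp⟩
  | succ k ih =>
    obtain ⟨p, hp⟩ := ih
    refine ⟨Polynomial.C ((k : ℂ) + 1)⁻¹ * (Polynomial.X - Polynomial.C (k : ℂ)) * p, fun z => ?_⟩
    have h1 : ((k : ℂ) + 1) ≠ 0 := by exact_mod_cast Nat.succ_ne_zero k
    rw [Polynomial.eval_mul, Polynomial.eval_mul, hp, Polynomial.eval_sub, Polynomial.eval_C,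
      Polynomial.eval_X, Polynomial.eval_C, mul_assoc, ← succ_mul_choose_succ, inv_mul_cancel_left₀ h1]

theorem differentiable_choose (k : ℕ) : Differentiable ℂ fun z : ℂ => Ring.choose z k := by
  obtain ⟨p, hp⟩ := exists_choose_polynomial k
  simp only [← hp]
  exact p.differentiable

/-- The value `Γ(1 + z) Γ(-z)` of the integral of `t ^ z / (t + 1)` over the half-line. -/
def betaConst (z : ℂ) : ℂ := Complex.Gamma (z + 1) * Complex.Gamma (-z)

/-- The functional equation of `Γ` matches the recursion of the binomial coefficients. Hence the
Beta integrals produce exactly the coefficients of the expansion, with one common factor `betaConst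
z`. -/
theorem Gamma_mul_Gamma_eq {z : ℂ} (hz : z.re < 0) (k : ℕ) :
    Complex.Gamma (z + 1) * Complex.Gamma (k - z) =
      Complex.Gamma (k + 1) * (betaConst z * ((-1) ^ k * Ring.choose z k)) := by
  induction k with
  | zero => simp [betaConst]
  | succ k ih =>
    have h0 : (k : ℂ) - z ≠ 0 := fun h => by
      have := congrArg Complex.re h
      simp only [Complex.sub_re, Complex.natCast_re, Complex.zero_re] at this
      have : (0 : ℝ) ≤ k := Nat.cast_nonneg k
      linarith
    have h1 : ((k : ℂ) + 1) ≠ 0 := by exact_mod_cast Nat.succ_ne_zero k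
    rw [Nat.cast_succ, show (k : ℂ) + 1 - z = k - z + 1 by ring, Complex.Gamma_add_one _ h0,
      Complex.Gamma_add_one _ h1, mul_left_comm, ih, pow_succ]
    linear_combination (-1) * Complex.Gamma (k + 1) * betaConst z * (-1) ^ k *
      succ_mul_choose_succ z k * (-1)

theorem Gamma_div_eq {z : ℂ} (hz : -1 < z.re) (hz' : z.re < 0) (k : ℕ) :
    Complex.betaIntegral (z + 1) (k - z) = betaConst z * ((-1) ^ k * Ring.choose z k) := by
  have h1 : 0 < (z + 1).re := by rw [Complex.add_re, Complex.one_re]; linarith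
  have h2 : 0 < ((k : ℂ) - z).re := by
    rw [Complex.sub_re, Complex.natCast_re]
    have : (0 : ℝ) ≤ k := Nat.cast_nonneg k
    linarith
  have h := Complex.Gamma_mul_Gamma_eq_betaIntegral h1 h2
  rw [Gamma_mul_Gamma_eq hz', show z + 1 + (k - z) = (k : ℂ) + 1 by ring] at h
  refine (mul_left_cancel₀ ?_ h).symm
  refine Complex.Gamma_ne_zero_of_re_pos ?_
  rw [Complex.add_re, Complex.natCast_re, Complex.one_re]
  positivity

theorem image_div_add_Ioi {ν : ℝ} (hν : 0 < ν) :
    (fun t : ℝ => t / (t + ν)) '' Set.Ioi 0 = Set.Ioo 0 1 := by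
  ext x
  constructor
  · rintro ⟨t, ht, rfl⟩
    have ht : 0 < t := ht
    refine ⟨by positivity, ?_⟩
    show t / (t + ν) < 1
    rw [div_lt_one (by positivity)]
    linarith
  · rintro ⟨h0, h1⟩
    have h2 : 0 < 1 - x := by linarith
    refine ⟨ν * x / (1 - x), by show (0 : ℝ) < ν * x / (1 - x); positivity, ?_⟩
    show ν * x / (1 - x) / (ν * x / (1 - x) + ν) = x
    field_simp
    ring

theorem hasDerivAt_div_add {ν t : ℝ} (hν : 0 < ν) (ht : 0 < t) :
    HasDerivAt (fun t : ℝ => t / (t + ν)) (ν / (t + ν) ^ 2) t := by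
  have h := (hasDerivAt_id t).div ((hasDerivAt_id t).add_const ν) (by simp; positivity)
  refine h.congr_deriv ?_
  simp

theorem injOn_div_add {ν : ℝ} (hν : 0 < ν) :
    Set.InjOn (fun t : ℝ => t / (t + ν)) (Set.Ioi 0) := by
  intro s hs t ht h
  have hs : 0 < s := hs
  have ht : 0 < t := ht
  simp only at h
  rw [div_eq_div_iff (by positivity) (by positivity)] at h
  have : ν * (s - t) = 0 := by linarith
  rcases mul_eq_zero.1 this with h | h
  · exact absurd h hν.ne'
  · linarith

theorem ofReal_cpow_eq_exp {x : ℝ} (hx : 0 < x) (w : ℂ) :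
    (x : ℂ) ^ w = Complex.exp (Real.log x * w) := by
  rw [Complex.cpow_def_of_ne_zero (Complex.ofReal_ne_zero.2 hx.ne'), Complex.ofReal_log hx.le]

/-- The change of variable `x = t / (t + ν)` in the Beta integrand. All bases are positive, so each
power is written as an exponential and the exponents are compared. -/
theorem substitution_integrand {ν t : ℝ} (hν : 0 < ν) (ht : 0 < t) (z : ℂ) (k : ℕ) :
    |ν / (t + ν) ^ 2| • (((t / (t + ν) : ℝ) : ℂ) ^ (z + 1 - 1) *
      (1 - ((t / (t + ν) : ℝ) : ℂ)) ^ ((k : ℂ) - z - 1)) =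
      (ν : ℂ) ^ ((k : ℂ) - z) * ((t : ℂ) ^ z * (((t : ℂ) + ν) ^ (k + 1))⁻¹) := by
  have hy : 0 < t + ν := by positivity
  have h1 : (1 - ((t / (t + ν) : ℝ) : ℂ)) = ((ν / (t + ν) : ℝ) : ℂ) := by
    rw [← Complex.ofReal_one, ← Complex.ofReal_sub]
    congr 1
    field_simp
    ring
  have e : ∀ x : ℝ, 0 < x → (x : ℂ) = Complex.exp (Real.log x) := fun x hx => by
    rw [← Complex.ofReal_exp, Real.exp_log hx]
  have h2 : ((t : ℂ) + ν) = Complex.exp (Real.log (t + ν)) := by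
    rw [← e _ hy, Complex.ofReal_add]
  have h3 : |ν / (t + ν) ^ 2| = Real.exp (Real.log ν - 2 * Real.log (t + ν)) := by
    rw [abs_of_pos (by positivity), Real.exp_sub, Real.exp_log hν, two_mul, Real.exp_add,
      Real.exp_log hy, pow_two]
  rw [h1, ofReal_cpow_eq_exp (by positivity), ofReal_cpow_eq_exp (by positivity),
    ofReal_cpow_eq_exp hν, ofReal_cpow_eq_exp ht, h2, h3, Real.log_div ht.ne' hy.ne',
    Real.log_div hν.ne' hy.ne', Complex.real_smul, Complex.ofReal_exp, ← Complex.exp_nat_mul,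
    ← Complex.exp_neg, ← Complex.exp_add, ← Complex.exp_add, ← Complex.exp_add, ← Complex.exp_add]
  congr 1
  push_cast
  ring

open MeasureTheory in
theorem integral_cpow_div_add_pow {z : ℂ} (hz : -1 < z.re) (hz' : z.re < 0) {ν : ℝ} (hν : 0 < ν)
    (k : ℕ) :
    IntegrableOn (fun t : ℝ => (t : ℂ) ^ z * (((t : ℂ) + ν) ^ (k + 1))⁻¹) (Set.Ioi 0) ∧
    ∫ t in Set.Ioi (0 : ℝ), (t : ℂ) ^ z * (((t : ℂ) + ν) ^ (k + 1))⁻¹ =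
      betaConst z * ((-1) ^ k * Ring.choose z k * (ν : ℂ) ^ (z - k)) := by
  have hν0 : (ν : ℂ) ≠ 0 := Complex.ofReal_ne_zero.2 hν.ne'
  have hνc : (ν : ℂ) ^ ((k : ℂ) - z) ≠ 0 := by
    rw [Ne, Complex.cpow_eq_zero_iff]
    exact fun h => hν0 h.1
  have h1 : 0 < (z + 1).re := by rw [Complex.add_re, Complex.one_re]; linarith
  have h2 : 0 < ((k : ℂ) - z).re := by
    rw [Complex.sub_re, Complex.natCast_re]
    have : (0 : ℝ) ≤ k := Nat.cast_nonneg k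
    linarith
  have hder : ∀ t ∈ Set.Ioi (0 : ℝ), HasDerivWithinAt (fun t : ℝ => t / (t + ν))
      (ν / (t + ν) ^ 2) (Set.Ioi 0) t :=
    fun t ht => (hasDerivAt_div_add hν ht).hasDerivWithinAt
  set g : ℝ → ℂ := fun x => (x : ℂ) ^ (z + 1 - 1) * (1 - (x : ℂ)) ^ ((k : ℂ) - z - 1) with hg
  have hint : IntegrableOn g (Set.Ioo 0 1) := by
    have := Complex.betaIntegral_convergent h1 h2
    rw [intervalIntegrable_iff_integrableOn_Ioo_of_le zero_le_one] at this
    exact this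
  have hval : ∫ x in Set.Ioo (0 : ℝ) 1, g x = Complex.betaIntegral (z + 1) (k - z) := by
    rw [Complex.betaIntegral, intervalIntegral.integral_of_le zero_le_one,
      integral_Ioc_eq_integral_Ioo]
  rw [← image_div_add_Ioi hν] at hint hval
  rw [integrableOn_image_iff_integrableOn_abs_deriv_smul measurableSet_Ioi hder
    (injOn_div_add hν)] at hint
  rw [integral_image_eq_integral_abs_deriv_smul measurableSet_Ioi hder (injOn_div_add hν),
    Gamma_div_eq hz hz'] at hval
  have hcongr : ∀ t ∈ Set.Ioi (0 : ℝ), |ν / (t + ν) ^ 2| • g (t / (t + ν)) =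
      (ν : ℂ) ^ ((k : ℂ) - z) * ((t : ℂ) ^ z * (((t : ℂ) + ν) ^ (k + 1))⁻¹) :=
    fun t ht => substitution_integrand hν ht z k
  constructor
  · have h3 := (integrableOn_congr_fun hcongr measurableSet_Ioi).1 hint
    have h4 := h3.const_mul ((ν : ℂ) ^ ((k : ℂ) - z))⁻¹
    refine IntegrableOn.congr_fun h4 (fun t _ => ?_) measurableSet_Ioi
    exact inv_mul_cancel_left₀ hνc _
  · rw [setIntegral_congr_fun measurableSet_Ioi hcongr, integral_const_mul] at hval
    refine mul_left_cancel₀ hνc (hval.trans ?_)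
    rw [show z - (k : ℂ) = -(k - z) by ring, Complex.cpow_neg]
    field_simp

/-- A finite geometric sum: the scalar form of expanding the resolvent at `μ` around `ν`, with its
exact remainder. -/
theorem inv_add_eq_sum {t μ ν : ℂ} (hμ : t + μ ≠ 0) (hν : t + ν ≠ 0) (N : ℕ) :
    (ν - μ) ^ N * ((t + μ)⁻¹ * ((t + ν) ^ N)⁻¹) =
      (t + μ)⁻¹ - ∑ k ∈ Finset.range N, (ν - μ) ^ k * ((t + ν) ^ (k + 1))⁻¹ := by
  induction N with
  | zero => simp
  | succ N ih =>
    rw [Finset.sum_range_succ, ← sub_sub, ← ih]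
    field_simp
    ring

open MeasureTheory in
-- Integrating `inv_add_eq_sum` against `t ^ z` gives the Taylor remainder of `x ↦ x ^ z`, hence by
-- `inner_rem` the matrix coefficients of `rem`. The strip `-1 < Re z < 0` is where the integrals
-- converge at both ends.
theorem integral_remainder {z : ℂ} (hz : -1 < z.re) (hz' : z.re < 0) {μ ν : ℝ} (hμ : 0 < μ)
    (hν : 0 < ν) (N : ℕ) :
    IntegrableOn (fun t : ℝ => (t : ℂ) ^ z * (((ν : ℂ) - μ) ^ N *
      (((t : ℂ) + μ)⁻¹ * (((t : ℂ) + ν) ^ N)⁻¹))) (Set.Ioi 0) ∧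
    ∫ t in Set.Ioi (0 : ℝ), (t : ℂ) ^ z * (((ν : ℂ) - μ) ^ N *
      (((t : ℂ) + μ)⁻¹ * (((t : ℂ) + ν) ^ N)⁻¹)) =
      betaConst z * ((μ : ℂ) ^ z -
        ∑ k ∈ Finset.range N, Ring.choose z k * ((μ : ℂ) - ν) ^ k * (ν : ℂ) ^ (z - k)) := by
  have hcongr : Set.EqOn (fun t : ℝ => (t : ℂ) ^ z * (((t : ℂ) + μ) ^ (0 + 1))⁻¹ -
      ∑ k ∈ Finset.range N, ((ν : ℂ) - μ) ^ k * ((t : ℂ) ^ z * (((t : ℂ) + ν) ^ (k + 1))⁻¹))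
      (fun t : ℝ => (t : ℂ) ^ z * (((ν : ℂ) - μ) ^ N *
      (((t : ℂ) + μ)⁻¹ * (((t : ℂ) + ν) ^ N)⁻¹))) (Set.Ioi 0) := by
    intro t ht
    have ht : 0 < t := ht
    have h1 : (t : ℂ) + μ ≠ 0 := by
      rw [← Complex.ofReal_add]; exact Complex.ofReal_ne_zero.2 (by positivity)
    have h2 : (t : ℂ) + ν ≠ 0 := by
      rw [← Complex.ofReal_add]; exact Complex.ofReal_ne_zero.2 (by positivity)
    simp only
    rw [inv_add_eq_sum h1 h2, mul_sub, Finset.mul_sum, zero_add, pow_one]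
    congr 1
    exact Finset.sum_congr rfl fun k _ => by ring
  have I1 := integral_cpow_div_add_pow hz hz' hμ 0
  have I2 := fun k => integral_cpow_div_add_pow hz hz' hν k
  have hsum : IntegrableOn (fun t : ℝ => ∑ k ∈ Finset.range N, ((ν : ℂ) - μ) ^ k *
      ((t : ℂ) ^ z * (((t : ℂ) + ν) ^ (k + 1))⁻¹)) (Set.Ioi 0) :=
    integrable_finsetSum _ fun k _ => (I2 k).1.const_mul _
  refine ⟨(I1.1.sub hsum).congr_fun hcongr measurableSet_Ioi, ?_⟩
  rw [← setIntegral_congr_fun measurableSet_Ioi hcongr, integral_sub I1.1 hsum, I1.2,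
    integral_finsetSum _ fun k _ => (I2 k).1.const_mul _, mul_sub, Finset.mul_sum]
  congr 1
  · simp
  · refine Finset.sum_congr rfl fun k _ => ?_
    rw [integral_const_mul, (I2 k).2, show (ν : ℂ) - μ = (-1) * (μ - ν) by ring, mul_pow]
    have : ((-1 : ℂ) ^ k) * (-1) ^ k = 1 := by rw [← mul_pow]; simp
    linear_combination (betaConst z * Ring.choose z k * ((μ : ℂ) - ν) ^ k * (ν : ℂ) ^ (z - k)) * this

theorem betaConst_ne_zero {z : ℂ} (hz : -1 < z.re) (hz' : z.re < 0) : betaConst z ≠ 0 :=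
  mul_ne_zero
    (Complex.Gamma_ne_zero_of_re_pos (by rw [Complex.add_re, Complex.one_re]; linarith))
    (Complex.Gamma_ne_zero_of_re_pos (by rw [Complex.neg_re]; linarith))

theorem continuousAt_Gamma_of_re_pos {z : ℂ} (hz : 0 < z.re) : ContinuousAt Complex.Gamma z := by
  refine (Complex.differentiableAt_Gamma z fun m h => ?_).continuousAt
  rw [h, Complex.neg_re, Complex.natCast_re] at hz
  have : (0 : ℝ) ≤ m := Nat.cast_nonneg m
  linarith

theorem continuousAt_betaConst {z : ℂ} (hz : -1 < z.re) (hz' : z.re < 0) :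
    ContinuousAt betaConst z := by
  refine ContinuousAt.mul ?_ ?_
  · exact ContinuousAt.comp (f := fun z : ℂ => z + 1)
      (continuousAt_Gamma_of_re_pos (by rw [Complex.add_re, Complex.one_re]; linarith))
      (by fun_prop)
  · exact ContinuousAt.comp (f := fun z : ℂ => -z)
      (continuousAt_Gamma_of_re_pos (by rw [Complex.neg_re]; linarith)) (by fun_prop)

open MeasureTheory in
theorem integral_rpow_div_add {x : ℝ} (hx : -1 < x) (hx' : x < 0) {c : ℝ} (hc : 0 < c) :
    IntegrableOn (fun t : ℝ => t ^ x * (t + c)⁻¹) (Set.Ioi 0) ∧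
    ∫ t in Set.Ioi (0 : ℝ), t ^ x * (t + c)⁻¹ ≤ ‖betaConst x‖ * c ^ x := by
  obtain ⟨h1, h2⟩ := integral_cpow_div_add_pow (z := (x : ℂ)) (by simpa using hx)
    (by simpa using hx') hc 0
  have hcongr : Set.EqOn (fun t : ℝ => (t : ℂ) ^ (x : ℂ) * (((t : ℂ) + c) ^ (0 + 1))⁻¹)
      (fun t : ℝ => ((t ^ x * (t + c)⁻¹ : ℝ) : ℂ)) (Set.Ioi 0) := by
    intro t ht
    have ht : 0 < t := ht
    simp only [zero_add, pow_one]
    push_cast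
    rw [Complex.ofReal_cpow ht.le]
  have h3 := h1.congr_fun hcongr measurableSet_Ioi
  rw [setIntegral_congr_fun measurableSet_Ioi hcongr, integral_complex_ofReal] at h2
  constructor
  · exact h3.re
  · have h4 := congrArg norm h2
    rw [Complex.norm_real] at h4
    refine (Real.le_norm_self _).trans (h4.trans_le ?_)
    rw [pow_zero, one_mul, Ring.choose_zero_right, one_mul, Nat.cast_zero, sub_zero, norm_mul,
      Complex.norm_cpow_eq_rpow_re_of_pos hc, Complex.ofReal_re]

namespace LaplaceOperator

variable {H : Type*} [NormedAddCommGroup H] [InnerProductSpace ℂ H] [CompleteSpace H]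
  (L : LaplaceOperator H)

/-! ### Finite spectral sums -/

/-- The finite spectral sum `∑ g(μ) P_μ` over `μ` in `F`. -/
def specSum (F : Finset ℝ) (g : ℝ → ℂ) : L.EndSmooth := ∑ μ ∈ F, g μ • L.projEnd μ

theorem specSum_apply (F : Finset ℝ) (g : ℝ → ℂ) (v : L.smooth) :
    L.specSum F g v = ∑ μ ∈ F, g μ • L.projEnd μ v := by
  simp [specSum]

theorem projEnd_specSum (F : Finset ℝ) (g : ℝ → ℂ) (μ : ℝ) (v : L.smooth) [Decidable (μ ∈ F)] :
    L.projEnd μ (L.specSum F g v) = if μ ∈ F then g μ • L.projEnd μ v else 0 := by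
  rw [specSum_apply, map_sum]
  split_ifs with h
  · rw [Finset.sum_eq_single μ, map_smul, projEnd_projEnd]
    · intro ν _ hν
      rw [map_smul, L.projEnd_projEnd_ne hν.symm v, smul_zero]
    · exact fun h' => absurd h h'
  · refine Finset.sum_eq_zero fun ν hν => ?_
    rw [map_smul, L.projEnd_projEnd_ne (by rintro rfl; exact h hν), smul_zero]

theorem sobNorm_specSum_le {r : ℕ} {s t C : ℝ} (hC : 0 ≤ C) (F : Finset ℝ) {g : ℝ → ℂ}
    (hg : ∀ μ, L.bottom ≤ μ → μ ^ (s / r) * ‖g μ‖ ≤ C * μ ^ (t / r)) (v : L.smooth) :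
    L.sobNorm r s (L.specSum F g v) ≤ C * L.sobNorm r t v := by
  classical
  refine L.sobNorm_le_of_forall_projEnd hC fun μ hμ => ?_
  have hμ0 := L.bottom_pos.trans_le hμ
  rw [projEnd_specSum]
  split_ifs with h
  · rw [norm_smul, ← mul_assoc, ← mul_assoc]
    exact mul_le_mul_of_nonneg_right (hg μ hμ) (norm_nonneg _)
  · rw [norm_zero, mul_zero]
    positivity

theorem inner_projEnd_left (μ : ℝ) (u w : L.smooth) :
    (inner ℂ (L.projEnd μ u) w : ℂ) = inner ℂ (L.projEnd μ u) (L.projEnd μ w) :=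
  L.inner_proj_self μ (u : H) (w : H)

theorem inner_specSum (F G : Finset ℝ) (f g : ℝ → ℂ) (B : L.EndSmooth) (u v : L.smooth) :
    inner ℂ (L.specSum F f u) (B (L.specSum G g v)) =
      ∑ μ ∈ F, ∑ ν ∈ G, (starRingEnd ℂ (f μ) * g ν) *
        inner ℂ (L.projEnd μ u) (B (L.projEnd ν v)) := by
  rw [specSum_apply, specSum_apply, map_sum, sum_inner]
  refine Finset.sum_congr rfl fun μ _ => ?_
  rw [inner_sum]
  refine Finset.sum_congr rfl fun ν _ => ?_
  rw [map_smul, inner_smul_left, inner_smul_right, mul_assoc]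

theorem inner_eq_sum {F G : Finset ℝ} (B : L.EndSmooth) {u v : L.smooth} (hu : L.trunc F u = u)
    (hv : L.trunc G v = v) : inner ℂ u (B v) =
      ∑ μ ∈ F, ∑ ν ∈ G, (inner ℂ (L.projEnd μ u) (B (L.projEnd ν v)) : ℂ) := by
  conv_lhs => rw [← hu, ← hv, trunc_apply, trunc_apply, map_sum, sum_inner]
  exact Finset.sum_congr rfl fun μ _ => inner_sum _ _ _

theorem inner_adPow (k : ℕ) (B : L.EndSmooth) (μ ν : ℝ) (u v : L.smooth) :
    (inner ℂ (L.projEnd μ u) (L.adPow k B (L.projEnd ν v)) : ℂ) =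
      ((μ : ℂ) - ν) ^ k * inner ℂ (L.projEnd μ u) (B (L.projEnd ν v)) := by
  rw [inner_projEnd_left, projEnd_adPow_projEnd, inner_smul_right, ← inner_projEnd_left]

theorem inner_cpow (z : ℂ) (μ : ℝ) (u w : L.smooth) :
    (inner ℂ (L.projEnd μ u) (L.cpow z w) : ℂ) =
      (μ : ℂ) ^ z * inner ℂ (L.projEnd μ u) w := by
  rw [inner_projEnd_left, projEnd_cpow, inner_smul_right, ← inner_projEnd_left]

theorem inner_rem (N : ℕ) (z : ℂ) (B : L.EndSmooth) (μ ν : ℝ) (u v : L.smooth) :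
    (inner ℂ (L.projEnd μ u) (L.rem N z B (L.projEnd ν v)) : ℂ) =
      ((μ : ℂ) ^ z -
        ∑ k ∈ Finset.range N, Ring.choose z k * ((μ : ℂ) - ν) ^ k * (ν : ℂ) ^ (z - k)) *
        inner ℂ (L.projEnd μ u) (B (L.projEnd ν v)) := by
  rw [rem, LinearMap.sub_apply, LinearMap.sum_apply, inner_sub_right, inner_sum,
    Module.End.mul_apply, inner_cpow, sub_mul, Finset.sum_mul]
  congr 1
  refine Finset.sum_congr rfl fun k _ => ?_
  rw [LinearMap.smul_apply, Module.End.mul_apply, cpow_projEnd, map_smul, smul_smul,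
    inner_smul_right, inner_adPow]
  ring

/-! ### Local boundedness of the remainders -/

variable {L} {r : ℕ} (D : L.DiffAlgebra r)

/-- The factor `(t + ν)⁻ᴺ ≤ ν⁻ᴺ` lowers the order by `r N`, against the `N (r - 1)` raised by `ad ^
N`: the net gain is `N`. The remaining resolvent supplies `(t + bottom)⁻¹`, integrable against `t ^
Re z`. The constant does not depend on `t`, `F` or `G`. -/
theorem norm_inner_resolvent_le {b : ℕ} {B : L.EndSmooth} (hB : B ∈ D.filt b) (N : ℕ) (s : ℝ) :
    ∃ C : ℝ, 0 ≤ C ∧ ∀ F G : Finset ℝ, ∀ u v : L.smooth, ∀ t : ℝ, 0 < t →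
      ‖(inner ℂ (L.specSum F (fun μ => ((t : ℂ) + μ)⁻¹) u)
        (L.adPow N B (L.specSum G (fun ν => (((t : ℂ) + ν) ^ N)⁻¹) v)) : ℂ)‖ ≤
      C * L.sobNorm r (-s) u * L.sobNorm r (s + (b + r - N)) v * (t + L.bottom)⁻¹ := by
  have hb := L.bottom_pos
  have hr : (r : ℝ) ≠ 0 := Nat.cast_ne_zero.2 D.r_pos.ne'
  obtain ⟨C, hC0, hC⟩ := (D.isOp (D.adPow_mem hB N)).exists_nonneg s
  refine ⟨C, hC0, fun F G u v t ht => ?_⟩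
  have hnorm : ∀ μ : ℝ, L.bottom ≤ μ → ‖(t : ℂ) + μ‖ = t + μ := fun μ hμ => by
    rw [← Complex.ofReal_add, Complex.norm_real, Real.norm_of_nonneg]
    linarith
  have h1 : L.sobNorm r (-s) (L.specSum F (fun μ => ((t : ℂ) + μ)⁻¹) u) ≤
      (t + L.bottom)⁻¹ * L.sobNorm r (-s) u := by
    refine L.sobNorm_specSum_le (by positivity) F (fun μ hμ => ?_) u
    have hμ0 := hb.trans_le hμ
    rw [norm_inv, hnorm μ hμ, mul_comm]
    exact mul_le_mul_of_nonneg_right (inv_anti₀ (by positivity) (by linarith)) (by positivity)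
  set σ : ℝ := s + ((b + N * (r - 1) : ℕ) + r) with hσ
  have h2 : L.sobNorm r σ (L.specSum G (fun ν => (((t : ℂ) + ν) ^ N)⁻¹) v) ≤
      1 * L.sobNorm r (s + (b + r - N)) v := by
    refine L.sobNorm_specSum_le zero_le_one G (fun μ hμ => ?_) v
    have hμ0 := hb.trans_le hμ
    have e : (s + (b + r - N)) / r = σ / r - N := by
      rw [hσ]
      push_cast [Nat.cast_sub (Nat.one_le_iff_ne_zero.2 D.r_pos.ne')]
      field_simp
      ring
    rw [norm_inv, norm_pow, hnorm μ hμ, one_mul, e, Real.rpow_sub hμ0, Real.rpow_natCast,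
      div_eq_mul_inv]
    refine mul_le_mul_of_nonneg_left (inv_anti₀ (by positivity) ?_) (by positivity)
    exact pow_le_pow_left₀ hμ0.le (by linarith) N
  refine (L.norm_inner_le_sobNorm r s _ _).trans ?_
  calc _ ≤ ((t + L.bottom)⁻¹ * L.sobNorm r (-s) u) *
        (C * (1 * L.sobNorm r (s + (b + r - N)) v)) := by
        refine mul_le_mul h1 ((hC _).trans (mul_le_mul_of_nonneg_left h2 hC0))
          (L.sobNorm_nonneg _ _ _) ?_
        have := L.sobNorm_nonneg r (-s) u
        positivity
    _ = _ := by ring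

open MeasureTheory in
theorem norm_inner_rem_le {b : ℕ} {B : L.EndSmooth} (hB : B ∈ D.filt b) (N : ℕ) (s : ℝ) :
    ∃ C : ℝ, 0 ≤ C ∧ ∀ z : ℂ, -1 < z.re → z.re < 0 →
      ∀ F G : Finset ℝ, (∀ μ ∈ F, L.bottom ≤ μ) → (∀ ν ∈ G, L.bottom ≤ ν) →
      ∀ u v : L.smooth, L.trunc F u = u → L.trunc G v = v →
        ‖(inner ℂ u (L.rem N z B v) : ℂ)‖ ≤
          (‖betaConst z‖⁻¹ * (‖betaConst z.re‖ * L.bottom ^ z.re) * C) * L.sobNorm r (-s) u *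
            L.sobNorm r (s + (b + r - N)) v := by
  have hb := L.bottom_pos
  obtain ⟨C, hC0, hC⟩ := norm_inner_resolvent_le D hB N s
  refine ⟨C, hC0, fun z hz hz' F G hF hG u v hu hv => ?_⟩
  set a : ℝ → ℝ → ℂ := fun μ ν => inner ℂ (L.projEnd μ u) (B (L.projEnd ν v)) with ha
  have I := fun (μ : ℝ) (hμ : μ ∈ F) (ν : ℝ) (hν : ν ∈ G) =>
    integral_remainder hz hz' (hb.trans_le (hF μ hμ)) (hb.trans_le (hG ν hν)) N
  -- Finite spectral support makes this an interchange of an integral with finite sums; no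
  -- operator-valued integral is needed.
  have e1 : betaConst z * inner ℂ u (L.rem N z B v) =
      ∫ t in Set.Ioi (0 : ℝ), ∑ μ ∈ F, ∑ ν ∈ G, ((t : ℂ) ^ z * (((ν : ℂ) - μ) ^ N *
        (((t : ℂ) + μ)⁻¹ * (((t : ℂ) + ν) ^ N)⁻¹))) * a μ ν := by
    rw [integral_finsetSum _ fun μ hμ => integrable_finsetSum _ fun ν hν =>
      (I μ hμ ν hν).1.mul_const _, L.inner_eq_sum _ hu hv, Finset.mul_sum]
    refine Finset.sum_congr rfl fun μ hμ => ?_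
    rw [integral_finsetSum _ fun ν hν => (I μ hμ ν hν).1.mul_const _, Finset.mul_sum]
    refine Finset.sum_congr rfl fun ν hν => ?_
    rw [integral_mul_const, (I μ hμ ν hν).2, inner_rem, mul_assoc]
  have e2 : ∀ t : ℝ, ∑ μ ∈ F, ∑ ν ∈ G, ((t : ℂ) ^ z * (((ν : ℂ) - μ) ^ N *
        (((t : ℂ) + μ)⁻¹ * (((t : ℂ) + ν) ^ N)⁻¹))) * a μ ν =
      (t : ℂ) ^ z * ((-1) ^ N * inner ℂ (L.specSum F (fun μ => ((t : ℂ) + μ)⁻¹) u)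
        (L.adPow N B (L.specSum G (fun ν => (((t : ℂ) + ν) ^ N)⁻¹) v))) := by
    intro t
    rw [inner_specSum, Finset.mul_sum, Finset.mul_sum]
    refine Finset.sum_congr rfl fun μ _ => ?_
    rw [Finset.mul_sum, Finset.mul_sum]
    refine Finset.sum_congr rfl fun ν _ => ?_
    rw [inner_adPow, map_inv₀, map_add, Complex.conj_ofReal, Complex.conj_ofReal,
      show (ν : ℂ) - μ = (-1) * (μ - ν) by ring, mul_pow]
    ring
  have hbd := integral_rpow_div_add hz hz' hb
  set K := C * L.sobNorm r (-s) u * L.sobNorm r (s + (b + r - N)) v with hK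
  have hK0 : 0 ≤ K := mul_nonneg (mul_nonneg hC0 (L.sobNorm_nonneg _ _ _)) (L.sobNorm_nonneg _ _ _)
  have e3 : ‖betaConst z‖ * ‖(inner ℂ u (L.rem N z B v) : ℂ)‖ ≤
      K * (‖betaConst z.re‖ * L.bottom ^ z.re) := by
    rw [← norm_mul, e1]
    refine (norm_integral_le_of_norm_le (hbd.1.const_mul K) ?_).trans ?_
    · refine (ae_restrict_mem measurableSet_Ioi).mono fun t ht => ?_
      have ht : 0 < t := ht
      rw [e2, norm_mul, norm_mul, Complex.norm_cpow_eq_rpow_re_of_pos ht, norm_pow, norm_neg,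
        norm_one, one_pow, one_mul]
      have := mul_le_mul_of_nonneg_left (hC F G u v t ht) (Real.rpow_nonneg ht.le z.re)
      refine this.trans_eq ?_
      rw [hK]
      ring
    · rw [integral_const_mul]
      exact mul_le_mul_of_nonneg_left hbd.2 hK0
  have h0 : 0 < ‖betaConst z‖ := norm_pos_iff.2 (betaConst_ne_zero hz hz')
  rw [← le_div_iff₀' h0] at e3
  refine e3.trans_eq ?_
  rw [hK]
  ring

/-- Bounding every term separately yields no gain in `N`. It serves to give each remainder some
finite order, as the density argument of `IsOp.sobNorm_le_of_inner` requires. -/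
theorem rem_isLocBdd_crude {b : ℕ} {B : L.EndSmooth} (hB : B ∈ D.filt b) (N : ℕ) (a : ℝ) :
    IsLocBdd r (r * a + (b + r)) {z | z.re < a} fun z => L.rem N z B := by
  have hU : IsOpen {z : ℂ | z.re < a} := isOpen_lt Complex.continuous_re continuous_const
  have hr : (0 : ℝ) ≤ r := Nat.cast_nonneg r
  have hr1 : ((r - 1 : ℕ) : ℝ) = r - 1 := by
    rw [Nat.cast_sub D.r_pos, Nat.cast_one]
  refine IsLocBdd.sub ?_ (IsLocBdd.sum fun k _ => IsLocBdd.smul ?_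
    (differentiable_choose k).continuous)
  · exact (IsLocBdd.cpow D.r_pos hU continuous_id
      fun z hz => mul_le_mul_of_nonneg_left (le_of_lt hz) hr).mul ((D.isOp hB).isLocBdd _)
  · refine (((D.isOp (D.adPow_mem hB k)).isLocBdd _).mul (IsLocBdd.cpow (t := r * (a - k)) D.r_pos
      hU (by fun_prop) fun z hz => mul_le_mul_of_nonneg_left ?_ hr)).mono ?_
    · have hz : z.re < a := hz
      rw [Complex.sub_re, Complex.natCast_re]
      linarith
    · push_cast
      rw [hr1]
      have : (0 : ℝ) ≤ k := Nat.cast_nonneg k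
      nlinarith

theorem exists_isOp_rem {b : ℕ} {B : L.EndSmooth} (hB : B ∈ D.filt b) (N : ℕ) (z : ℂ) :
    ∃ t, L.IsOp r t (L.rem N z B) :=
  ⟨_, (rem_isLocBdd_crude D hB N (z.re + 1)).isOp (by show z.re < z.re + 1; linarith)⟩

/-- Local boundedness of all remainders on a set of parameters, with the expected gain of order. -/
def RemBdd (U : Set ℂ) : Prop :=
  ∀ b : ℕ, ∀ B ∈ D.filt b, ∀ N : ℕ, IsLocBdd r (b + r - N) U fun z => L.rem N z B

theorem remBdd_strip : RemBdd D {z | -1 < z.re ∧ z.re < 0} := by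
  intro b B hB N s z₀ hz₀
  obtain ⟨C, hC0, hC⟩ := norm_inner_rem_le D hB N s
  have hcont : ContinuousAt (fun z : ℂ =>
      ‖betaConst z‖⁻¹ * (‖betaConst z.re‖ * L.bottom ^ z.re) * C) z₀ := by
    have h1 := continuousAt_betaConst hz₀.1 hz₀.2
    have h2 : ContinuousAt (fun z : ℂ => betaConst (z.re : ℂ)) z₀ :=
      ContinuousAt.comp (f := fun z : ℂ => (z.re : ℂ)) (g := betaConst)
        (continuousAt_betaConst (by simpa using hz₀.1) (by simpa using hz₀.2)) (by fun_prop)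
    have h3 : ContinuousAt (fun z : ℂ => L.bottom ^ z.re) z₀ :=
      (Continuous.rpow continuous_const Complex.continuous_re
        fun _ => Or.inl L.bottom_pos.ne').continuousAt
    exact ((h1.norm.inv₀ (norm_ne_zero_iff.2 (betaConst_ne_zero hz₀.1 hz₀.2))).mul
      (h2.norm.mul h3)).mul continuousAt_const
  have hU : IsOpen {z : ℂ | -1 < z.re ∧ z.re < 0} :=
    (isOpen_lt continuous_const Complex.continuous_re).inter
      (isOpen_lt Complex.continuous_re continuous_const)
  have hpos : ∀ z : ℂ, 0 ≤ ‖betaConst z‖⁻¹ * (‖betaConst z.re‖ * L.bottom ^ z.re) * C := fun z => by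
    have := L.bottom_pos
    positivity
  refine ⟨_ + 1, add_nonneg (hpos z₀) zero_le_one, ?_⟩
  filter_upwards [hcont.eventually_lt continuousAt_const (lt_add_one _), hU.mem_nhds hz₀]
    with z hz hzU v
  obtain ⟨t, ht⟩ := exists_isOp_rem D hB N z
  exact (ht.sobNorm_le_of_inner (hpos z) (hC z hzU.1 hzU.2) v).trans
    (mul_le_mul_of_nonneg_right hz.le (L.sobNorm_nonneg _ _ _))

variable {D}

/-- Apply `rem_add` to `z = z / 2 + z / 2`. In the `k`-th term, `ad ^ k` raises the order by `k (r -
1)`, `Δ ^ (z / 2 - k)` lowers it by at least `r k`, and the shallower remainder lacks `k` orders of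
gain: these balance. -/
theorem RemBdd.double {U : Set ℂ} (h : RemBdd D U) (hU : IsOpen U) (hneg : ∀ z ∈ U, z.re < 0) :
    RemBdd D {z | z / 2 ∈ U} := by
  intro b B hB N
  have hr1 : ((r - 1 : ℕ) : ℝ) = r - 1 := by
    rw [Nat.cast_sub D.r_pos, Nat.cast_one]
  have hr : (0 : ℝ) ≤ r := Nat.cast_nonneg r
  have hV : IsOpen {z : ℂ | z / 2 ∈ U} := hU.preimage (by fun_prop)
  have hφ : Continuous fun z : ℂ => z / 2 := by fun_prop
  refine IsLocBdd.congr (T := fun z => L.cpow (z / 2) * L.rem N (z / 2) B +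
    ∑ k ∈ Finset.range N, Ring.choose (z / 2) k •
      (L.rem (N - k) (z / 2) (L.adPow k B) * L.cpow (z / 2 - k))) ?_ hV fun z _ => ?_
  · refine IsLocBdd.add ?_ (IsLocBdd.sum fun k hk => IsLocBdd.smul ?_
      ((differentiable_choose k).continuous.comp hφ))
    · refine ((IsLocBdd.cpow (t := 0) D.r_pos hV hφ fun z hz => ?_).mul
        ((h b B hB N).comp hφ fun z hz => hz)).mono (by rw [zero_add])
      exact mul_nonpos_of_nonneg_of_nonpos hr (hneg _ hz).le
    · refine (((h _ _ (D.adPow_mem hB k) (N - k)).comp hφ fun z hz => hz).mul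
        (IsLocBdd.cpow (t := r * (-k)) D.r_pos hV (by fun_prop) fun z hz => ?_)).mono ?_
      · refine mul_le_mul_of_nonneg_left ?_ hr
        have := hneg _ hz
        rw [Complex.sub_re, Complex.natCast_re]
        linarith
      · rw [Nat.cast_sub (Finset.mem_range.1 hk).le]
        push_cast
        rw [hr1]
        linarith
  · rw [← L.rem_add, add_halves]

theorem IsLocBdd.of_nhds {t : ℝ} {U : Set ℂ} {T : ℂ → L.EndSmooth}
    (h : ∀ z ∈ U, ∃ V, z ∈ V ∧ IsLocBdd r t V T) : IsLocBdd r t U T := by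
  intro s z hz
  obtain ⟨V, hV, hT⟩ := h z hz
  exact hT s z hV

variable (D) in
theorem remBdd_neg : RemBdd D {z | z.re < 0} := by
  -- Doubling the initial strip repeatedly exhausts the open left half-plane, integer real parts
  -- included.
  have key : ∀ j : ℕ, RemBdd D {z | -2 ^ j < z.re ∧ z.re < 0} := by
    intro j
    induction j with
    | zero => simpa using remBdd_strip D
    | succ j ih =>
      have hU : IsOpen {z : ℂ | -2 ^ j < z.re ∧ z.re < 0} :=
        (isOpen_lt continuous_const Complex.continuous_re).inter
          (isOpen_lt Complex.continuous_re continuous_const)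
      have := ih.double hU fun z hz => hz.2
      intro b B hB N
      refine (this b B hB N).mono_set fun z hz => ?_
      have e : (z / 2).re = z.re / 2 := by simp
      have h1 : -2 ^ (j + 1) < z.re := hz.1
      have h2 : z.re < 0 := hz.2
      rw [pow_succ] at h1
      show -2 ^ j < (z / 2).re ∧ (z / 2).re < 0
      rw [e]
      constructor <;> linarith
  intro b B hB N
  refine IsLocBdd.of_nhds fun z hz => ?_
  obtain ⟨j, hj⟩ := pow_unbounded_of_one_lt (-z.re) one_lt_two
  exact ⟨{z | -2 ^ j < z.re ∧ z.re < 0}, ⟨by linarith, hz⟩, key j b B hB N⟩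

variable (D) in
-- Write `z = (z - n) + n` in `rem_add`: the remainder at the natural number `n` vanishes, and the
-- others are taken at `z - n`, in the left half-plane.
theorem rem_isLocBdd {b : ℕ} {B : L.EndSmooth} (hB : B ∈ D.filt b) (n N : ℕ) (hN : n < N) :
    IsLocBdd r (r * n + (b + r - N)) {z | z.re < n} fun z => L.rem N z B := by
  have hr1 : ((r - 1 : ℕ) : ℝ) = r - 1 := by
    rw [Nat.cast_sub D.r_pos, Nat.cast_one]
  have hr : (0 : ℝ) ≤ r := Nat.cast_nonneg r
  have hU : IsOpen {z : ℂ | z.re < n} := isOpen_lt Complex.continuous_re continuous_const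
  have hφ : Continuous fun z : ℂ => z - n := by fun_prop
  have hmem : ∀ z ∈ {z : ℂ | z.re < n}, z - n ∈ {z : ℂ | z.re < 0} := fun z hz => by
    have hz : z.re < n := hz
    show (z - n).re < 0
    rw [Complex.sub_re, Complex.natCast_re]
    linarith
  refine IsLocBdd.congr (T := fun z => ∑ k ∈ Finset.range N, Ring.choose (n : ℂ) k •
      (L.rem (N - k) (z - n) (L.adPow k B) * L.cpow (n - k))) ?_ hU fun z _ => ?_
  · refine IsLocBdd.sum fun k hk => IsLocBdd.smul ?_ continuous_const
    refine (((remBdd_neg D _ _ (D.adPow_mem hB k) (N - k)).comp hφ hmem).mul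
        (IsLocBdd.cpow (t := r * (n - k)) D.r_pos hU continuous_const fun z hz => ?_)).mono ?_
    · rw [Complex.sub_re, Complex.natCast_re, Complex.natCast_re]
    · rw [Nat.cast_sub (Finset.mem_range.1 hk).le]
      push_cast
      rw [hr1]
      linarith
  · have := L.rem_add N (z - n) n B
    rw [L.rem_natCast hN, mul_zero, zero_add, sub_add_cancel] at this
    exact this

end LaplaceOperator

/-! ### A quantitative Taylor estimate -/

/-- Two Cauchy estimates with radius `ρ / 4` bound the second derivative by `16 M / ρ ^ 2`, and two
mean value inequalities integrate it back. The bounds depend on `f` only through `M`, so they are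
uniform over the matrix coefficients of a locally bounded family. -/
theorem norm_taylor_le {f : ℂ → ℂ} (hf : Differentiable ℂ f) {z₀ : ℂ} {ρ M : ℝ} (hρ : 0 < ρ)
    (hM : ∀ z, ‖z - z₀‖ ≤ ρ → ‖f z‖ ≤ M) :
    ‖deriv f z₀‖ ≤ M / ρ ∧ ∀ z, ‖z - z₀‖ ≤ ρ / 2 →
      ‖f z - f z₀ - (z - z₀) * deriv f z₀‖ ≤ 16 * M / ρ ^ 2 * ‖z - z₀‖ * ‖z - z₀‖ := by
  have hf' : Differentiable ℂ (deriv f) := hf.deriv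
  have hsub : ∀ w x : ℂ, ‖x - z₀‖ ≤ ‖x - w‖ + ‖w - z₀‖ := fun w x => by
    simpa using norm_add_le (x - w) (w - z₀)
  have h1 : ∀ w, ‖w - z₀‖ ≤ 3 * ρ / 4 → ‖deriv f w‖ ≤ M / (ρ / 4) := fun w hw =>
    Complex.norm_deriv_le_of_forall_mem_sphere_norm_le (by positivity) hf.diffContOnCl
      fun x hx => hM x ((hsub w x).trans (by rw [mem_sphere_iff_norm.1 hx]; linarith))
  have h2 : ∀ w, ‖w - z₀‖ ≤ ρ / 2 → ‖deriv (deriv f) w‖ ≤ 16 * M / ρ ^ 2 := fun w hw => by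
    refine (Complex.norm_deriv_le_of_forall_mem_sphere_norm_le (R := ρ / 4) (by positivity)
      hf'.diffContOnCl fun x hx => h1 x ((hsub w x).trans
        (by rw [mem_sphere_iff_norm.1 hx]; linarith))).trans_eq ?_
    field_simp
    norm_num
  refine ⟨Complex.norm_deriv_le_of_forall_mem_sphere_norm_le hρ hf.diffContOnCl
    fun x hx => hM x (mem_sphere_iff_norm.1 hx).le, fun z hz => ?_⟩
  have h3 : ∀ w ∈ Metric.closedBall z₀ ‖z - z₀‖,
      ‖deriv f w - deriv f z₀‖ ≤ 16 * M / ρ ^ 2 * ‖z - z₀‖ := by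
    intro w hw
    have := (convex_closedBall z₀ ‖z - z₀‖).norm_image_sub_le_of_norm_deriv_le
      (fun x _ => hf' x) (fun x hx => h2 x ((mem_closedBall_iff_norm.1 hx).trans hz))
      (Metric.mem_closedBall_self (norm_nonneg _)) hw
    refine this.trans (mul_le_mul_of_nonneg_left (mem_closedBall_iff_norm.1 hw) ?_)
    exact (norm_nonneg _).trans (h2 z₀ (by simpa using by positivity))
  have h4 : ∀ w, HasDerivAt (fun w => f w - (w - z₀) * deriv f z₀) (deriv f w - deriv f z₀) w := by
    intro w
    have := (hf w).hasDerivAt.fun_sub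
      (((hasDerivAt_id' w).sub_const z₀).mul_const (deriv f z₀))
    rwa [one_mul] at this
  have h5 := (convex_closedBall z₀ ‖z - z₀‖).norm_image_sub_le_of_norm_deriv_le
    (fun x _ => (h4 x).differentiableAt)
    (fun x hx => by rw [(h4 x).deriv]; exact h3 x hx)
    (Metric.mem_closedBall_self (norm_nonneg _)) (mem_closedBall_iff_norm.2 le_rfl)
  refine le_of_eq_of_le ?_ h5
  congr 1
  ring

namespace LaplaceOperator

variable {H : Type*} [NormedAddCommGroup H] [InnerProductSpace ℂ H] [CompleteSpace H]
  {L : LaplaceOperator H} {r : ℕ}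

/-! ### Holomorphic families of operators of given analytic order -/

namespace IsOp

variable {t t' : ℝ} {S T : L.EndSmooth}

theorem mono (hT : L.IsOp r t T) (h : t ≤ t') : L.IsOp r t' T :=
  ((hT.isLocBdd Set.univ).mono h).isOp (Set.mem_univ 0)

theorem add (hS : L.IsOp r t S) (hT : L.IsOp r t T) : L.IsOp r t (S + T) :=
  ((hS.isLocBdd Set.univ).add (hT.isLocBdd Set.univ)).isOp (Set.mem_univ 0)

theorem sub (hS : L.IsOp r t S) (hT : L.IsOp r t T) : L.IsOp r t (S - T) :=
  ((hS.isLocBdd Set.univ).sub (hT.isLocBdd Set.univ)).isOp (Set.mem_univ 0)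

theorem smul (hT : L.IsOp r t T) (c : ℂ) : L.IsOp r t (c • T) :=
  ((hT.isLocBdd Set.univ).smul (continuous_const (y := c))).isOp (Set.mem_univ 0)

theorem zero : L.IsOp r t (0 : L.EndSmooth) :=
  (IsLocBdd.zero (U := Set.univ)).isOp (Set.mem_univ 0)

end IsOp

theorem exists_isOp_sub {S T : L.EndSmooth} (hS : ∃ t, L.IsOp r t S) (hT : ∃ t, L.IsOp r t T) :
    ∃ t, L.IsOp r t (S - T) := by
  obtain ⟨t, hS⟩ := hS
  obtain ⟨t', hT⟩ := hT
  exact ⟨max t t', (hS.mono (le_max_left _ _)).sub (hT.mono (le_max_right _ _))⟩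

theorem exists_isOp_add {S T : L.EndSmooth} (hS : ∃ t, L.IsOp r t S) (hT : ∃ t, L.IsOp r t T) :
    ∃ t, L.IsOp r t (S + T) := by
  obtain ⟨t, hS⟩ := hS
  obtain ⟨t', hT⟩ := hT
  exact ⟨max t t', (hS.mono (le_max_left _ _)).add (hT.mono (le_max_right _ _))⟩

theorem exists_isOp_sum {ι : Type*} (A : Finset ι) {F : ι → L.EndSmooth}
    (h : ∀ i ∈ A, ∃ t, L.IsOp r t (F i)) : ∃ t, L.IsOp r t (∑ i ∈ A, F i) := by
  classical
  induction A using Finset.induction_on with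
  | empty => exact ⟨0, by simpa using IsOp.zero⟩
  | insert i A hi ih =>
    rw [Finset.sum_insert hi]
    exact exists_isOp_add (h i (Finset.mem_insert_self _ _))
      (ih fun j hj => h j (Finset.mem_insert_of_mem hj))

theorem isOp_logEnd (hr : 0 < r) : L.IsOp r r L.logEnd := by
  have hr' : (r : ℝ) ≠ 0 := by positivity
  intro s
  refine ⟨1 + (L.bottom⁻¹) ^ 2, fun v => L.sobNorm_le_of_forall_projEnd (by positivity)
    fun μ hμ => ?_⟩
  have hμ0 := L.bottom_pos.trans_le hμ
  rw [projEnd_logEnd, norm_smul, Complex.norm_real, Real.norm_eq_abs, add_div, div_self hr',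
    Real.rpow_add_one hμ0.ne']
  have := mul_le_mul_of_nonneg_right (L.abs_log_le hμ)
    (show 0 ≤ μ ^ (s / r) * ‖L.projEnd μ v‖ by positivity)
  calc _ = |Real.log μ| * (μ ^ (s / r) * ‖L.projEnd μ v‖) := by ring
    _ ≤ _ := this
    _ = _ := by ring

theorem logEnd_projEnd (ν : ℝ) (v : L.smooth) :
    L.logEnd (L.projEnd ν v) = (Real.log ν : ℂ) • L.projEnd ν v := by
  refine L.ext_projEnd fun μ => ?_
  rw [projEnd_logEnd, map_smul]
  rcases eq_or_ne μ ν with rfl | h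
  · rfl
  · rw [L.projEnd_projEnd_ne h, smul_zero, smul_zero]

theorem inner_logEnd (μ : ℝ) (u w : L.smooth) :
    (inner ℂ (L.projEnd μ u) (L.logEnd w) : ℂ) =
      (Real.log μ : ℂ) * inner ℂ (L.projEnd μ u) w := by
  rw [inner_projEnd_left, projEnd_logEnd, inner_smul_right, ← inner_projEnd_left]

/-- A locally bounded family with holomorphic matrix coefficients between finite spectral vectors
is holomorphic. -/
theorem IsLocBdd.isHolomorphicInOp {m a : ℝ} {R R' : ℂ → L.EndSmooth}
    (hR : IsLocBdd r m {z | z.re < a} R) (hR' : ∀ z, ∃ t, L.IsOp r t (R' z))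
    (h : ∀ F G : Finset ℝ, (∀ μ ∈ F, L.bottom ≤ μ) → (∀ ν ∈ G, L.bottom ≤ ν) →
      ∀ u v : L.smooth, L.trunc F u = u → L.trunc G v = v →
        ∀ z, HasDerivAt (fun z => (inner ℂ u (R z v) : ℂ)) (inner ℂ u (R' z v)) z) :
    L.IsHolomorphicInOp r m a R := by
  have hU : IsOpen {z : ℂ | z.re < a} := isOpen_lt Complex.continuous_re continuous_const
  intro z₀ hz₀
  have hz₀' : z₀ ∈ {z : ℂ | z.re < a} := hz₀
  have key : ∀ s : ℝ, ∃ C ρ : ℝ, 0 ≤ C ∧ 0 < ρ ∧ (∀ z, ‖z - z₀‖ ≤ ρ → z.re < a) ∧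
      ∀ z, ‖z - z₀‖ ≤ ρ → ∀ v, L.sobNorm r s (R z v) ≤ C * L.sobNorm r (s + m) v := by
    intro s
    obtain ⟨C, hC0, hC⟩ := hR s z₀ hz₀'
    obtain ⟨δ, hδ, hball⟩ := Metric.eventually_nhds_iff.1 (hC.and (hU.mem_nhds hz₀'))
    have hlt : ∀ z, ‖z - z₀‖ ≤ δ / 2 → dist z z₀ < δ := fun z hz => by
      rw [dist_eq_norm]; linarith
    exact ⟨C, δ / 2, hC0, by positivity, fun z hz => (hball (hlt z hz)).2,
      fun z hz => (hball (hlt z hz)).1⟩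
  have hbd : ∀ s C ρ : ℝ, (∀ z, ‖z - z₀‖ ≤ ρ → ∀ v,
      L.sobNorm r s (R z v) ≤ C * L.sobNorm r (s + m) v) → ∀ u v : L.smooth, ∀ z, ‖z - z₀‖ ≤ ρ →
      ‖(inner ℂ u (R z v) : ℂ)‖ ≤ C * L.sobNorm r (-s) u * L.sobNorm r (s + m) v := by
    intro s C ρ hC u v z hz
    refine (L.norm_inner_le_sobNorm r s _ _).trans ?_
    refine (mul_le_mul_of_nonneg_left (hC z hz v) (L.sobNorm_nonneg r (-s) u)).trans_eq ?_
    ring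
  have hOp' : L.IsOp r m (R' z₀) := by
    intro s
    obtain ⟨C, ρ, hC0, hρ, -, hC⟩ := key s
    -- The order `t` of the candidate derivative is arbitrary; the Cauchy estimate on its
    -- coefficients improves it to `m`.
    obtain ⟨t, ht⟩ := hR' z₀
    refine ⟨C / ρ, ht.sobNorm_le_of_inner (by positivity) fun F G hF hG u v hu hv => ?_⟩
    have hd := h F G hF hG u v hu hv
    have h1 := (norm_taylor_le (fun z => (hd z).differentiableAt) hρ
      (hbd s C ρ hC u v)).1
    rw [(hd z₀).deriv] at h1
    refine h1.trans_eq ?_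
    ring
  refine ⟨hR.isOp hz₀', R' z₀, hOp', fun s ε hε => ?_⟩
  obtain ⟨C, ρ, hC0, hρ, hUρ, hC⟩ := key s
  -- The first bound keeps `z` in the range of the Taylor estimate; the second makes one factor `‖z
  -- - z₀‖` of its quadratic error absorb the constant into `ε`.
  refine ⟨min (ρ / 2) (ε / (16 * C / ρ ^ 2 + 1)), by positivity, fun z hz => ?_⟩
  have hz1 : ‖z - z₀‖ ≤ ρ / 2 := (hz.trans_le (min_le_left _ _)).le
  have hz2 : (16 * C / ρ ^ 2) * ‖z - z₀‖ ≤ ε := by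
    have := (hz.trans_le (min_le_right _ _)).le
    rw [le_div_iff₀ (by positivity)] at this
    nlinarith [norm_nonneg (z - z₀)]
  refine IsOp.sobNorm_le_of_inner (((hR.isOp (hUρ z (by linarith))).sub (hR.isOp hz₀')).sub
    (hOp'.smul (z - z₀))) (by positivity) fun F G hF hG u v hu hv => ?_
  have hd := h F G hF hG u v hu hv
  have h1 := (norm_taylor_le (fun z => (hd z).differentiableAt) hρ (hbd s C ρ hC u v)).2 z hz1
  rw [(hd z₀).deriv] at h1
  rw [LinearMap.sub_apply, LinearMap.sub_apply, LinearMap.smul_apply, inner_sub_right,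
    inner_sub_right, inner_smul_right]
  refine h1.trans ?_
  have hK : 0 ≤ L.sobNorm r (-s) u * L.sobNorm r (s + m) v :=
    mul_nonneg (L.sobNorm_nonneg _ _ _) (L.sobNorm_nonneg _ _ _)
  calc _ = (16 * C / ρ ^ 2 * ‖z - z₀‖) * (‖z - z₀‖ *
        (L.sobNorm r (-s) u * L.sobNorm r (s + m) v)) := by ring
    _ ≤ ε * (‖z - z₀‖ * (L.sobNorm r (-s) u * L.sobNorm r (s + m) v)) := by gcongr
    _ = _ := by ring

variable (L) in
/-- The derivative of the remainder with respect to the exponent. -/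
def remDeriv (N : ℕ) (z : ℂ) (B : L.EndSmooth) : L.EndSmooth :=
  L.cpow z * (L.logEnd * B) - ∑ k ∈ Finset.range N,
    (deriv (fun z : ℂ => Ring.choose z k) z • (L.adPow k B * L.cpow (z - k)) +
      Ring.choose z k • (L.adPow k B * (L.cpow (z - k) * L.logEnd)))

theorem inner_remDeriv (N : ℕ) (z : ℂ) (B : L.EndSmooth) (μ ν : ℝ) (u v : L.smooth) :
    (inner ℂ (L.projEnd μ u) (L.remDeriv N z B (L.projEnd ν v)) : ℂ) =
      ((μ : ℂ) ^ z * Real.log μ -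
        ∑ k ∈ Finset.range N,
          (deriv (fun z : ℂ => Ring.choose z k) z * ((μ : ℂ) - ν) ^ k * (ν : ℂ) ^ (z - k) +
            Ring.choose z k * ((μ : ℂ) - ν) ^ k * ((ν : ℂ) ^ (z - k) * Real.log ν))) *
        inner ℂ (L.projEnd μ u) (B (L.projEnd ν v)) := by
  rw [remDeriv, LinearMap.sub_apply, LinearMap.sum_apply, inner_sub_right, inner_sum,
    Module.End.mul_apply, inner_cpow, Module.End.mul_apply, inner_logEnd, sub_mul, Finset.sum_mul,
    mul_assoc]
  congr 1
  refine Finset.sum_congr rfl fun k _ => ?_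
  rw [LinearMap.add_apply, LinearMap.smul_apply, LinearMap.smul_apply, Module.End.mul_apply,
    Module.End.mul_apply, Module.End.mul_apply, logEnd_projEnd, map_smul, cpow_projEnd, map_smul,
    map_smul, map_smul, inner_add_right, inner_smul_right, inner_smul_right, inner_smul_right,
    inner_smul_right, inner_smul_right, inner_adPow]
  ring

theorem hasDerivAt_ofReal_cpow_const {μ : ℝ} (hμ : 0 < μ) (c z : ℂ) :
    HasDerivAt (fun z => (μ : ℂ) ^ (z - c)) ((μ : ℂ) ^ (z - c) * Real.log μ) z := by
  have h := ((hasDerivAt_id z).sub_const c).const_cpow (c := (μ : ℂ))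
    (Or.inl (Complex.ofReal_ne_zero.2 hμ.ne'))
  rw [mul_one, ← Complex.ofReal_log hμ.le] at h
  exact h

theorem hasDerivAt_inner_rem (N : ℕ) (B : L.EndSmooth) {F G : Finset ℝ}
    (hF : ∀ μ ∈ F, L.bottom ≤ μ) (hG : ∀ ν ∈ G, L.bottom ≤ ν) {u v : L.smooth}
    (hu : L.trunc F u = u) (hv : L.trunc G v = v) (z : ℂ) :
    HasDerivAt (fun z => (inner ℂ u (L.rem N z B v) : ℂ)) (inner ℂ u (L.remDeriv N z B v)) z := by
  have e : (fun z => (inner ℂ u (L.rem N z B v) : ℂ)) = fun z => _ :=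
    funext fun z => L.inner_eq_sum (L.rem N z B) hu hv
  rw [e, L.inner_eq_sum (L.remDeriv N z B) hu hv]
  refine HasDerivAt.fun_sum fun μ hμ => HasDerivAt.fun_sum fun ν hν => ?_
  simp only [inner_rem, inner_remDeriv]
  have hμ0 := L.bottom_pos.trans_le (hF μ hμ)
  have hν0 := L.bottom_pos.trans_le (hG ν hν)
  refine HasDerivAt.mul_const (HasDerivAt.sub ?_ (HasDerivAt.fun_sum fun k _ => ?_)) _
  · simpa using hasDerivAt_ofReal_cpow_const hμ0 0 z
  · exact (((differentiable_choose k z).hasDerivAt).mul_const _).mul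
      (hasDerivAt_ofReal_cpow_const hν0 k z)

theorem exists_isOp_remDeriv (D : L.DiffAlgebra r) {b : ℕ} {B : L.EndSmooth} (hB : B ∈ D.filt b)
    (N : ℕ) (z : ℂ) : ∃ t, L.IsOp r t (L.remDeriv N z B) := by
  have hc : ∀ z, L.IsOp r (r * z.re) (L.cpow z) := fun z => IsOp.cpow D.r_pos le_rfl
  exact exists_isOp_sub ⟨_, (hc z).mul ((isOp_logEnd D.r_pos).mul (D.isOp hB))⟩
    (exists_isOp_sum _ fun k _ => exists_isOp_add
      ⟨_, ((D.isOp (D.adPow_mem hB k)).mul (hc _)).smul _⟩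
      ⟨_, ((D.isOp (D.adPow_mem hB k)).mul ((hc _).mul (isOp_logEnd D.r_pos))).smul _⟩)

/-- The expansion of `Δ ^ z B` is asymptotic. -/
theorem exists_isHolomorphicInOp_rem (D : L.DiffAlgebra r) {b : ℕ} {B : L.EndSmooth}
    (hB : B ∈ D.filt b) (a m : ℝ) :
    ∃ N₀ : ℕ, ∀ N, N₀ ≤ N → L.IsHolomorphicInOp r m a fun z => L.rem N z B := by
  obtain ⟨n, hn⟩ := exists_nat_ge a
  obtain ⟨M, hM⟩ := exists_nat_ge (r * n + (b + r) - m)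
  -- Depth above `n` covers the half-plane through `rem_isLocBdd`; depth at least `M` brings the
  -- order down to `m`.
  refine ⟨max (n + 1) M, fun N hN => ?_⟩
  have h1 : n < N := (le_max_left _ _).trans hN
  have h2 : (M : ℝ) ≤ N := Nat.cast_le.2 ((le_max_right _ _).trans hN)
  refine IsLocBdd.isHolomorphicInOp
    (((rem_isLocBdd D hB n N h1).mono (by linarith)).mono_set fun z hz => lt_of_lt_of_le hz hn)
    (fun z => exists_isOp_remDeriv D hB N z) fun F G hF hG u v hu hv z =>
      hasDerivAt_inner_rem N B hF hG hu hv z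

namespace IsHolomorphicInOp

variable {m a : ℝ} {R S : ℂ → L.EndSmooth}

theorem add (hR : L.IsHolomorphicInOp r m a R) (hS : L.IsHolomorphicInOp r m a S) :
    L.IsHolomorphicInOp r m a fun z => R z + S z := by
  intro z₀ hz₀
  obtain ⟨h1, R', h2, h3⟩ := hR z₀ hz₀
  obtain ⟨g1, S', g2, g3⟩ := hS z₀ hz₀
  refine ⟨h1.add g1, R' + S', h2.add g2, fun s ε hε => ?_⟩
  obtain ⟨δ, hδ, h⟩ := h3 s (ε / 2) (by positivity)
  obtain ⟨δ', hδ', g⟩ := g3 s (ε / 2) (by positivity)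
  refine ⟨min δ δ', lt_min hδ hδ', fun z hz v => ?_⟩
  have e : R z + S z - (R z₀ + S z₀) - (z - z₀) • (R' + S') =
      (R z - R z₀ - (z - z₀) • R') + (S z - S z₀ - (z - z₀) • S') := by
    rw [smul_add]; abel
  rw [e, LinearMap.add_apply]
  refine (L.sobNorm_add_le _ _ _ _).trans ((add_le_add (h z (hz.trans_le (min_le_left _ _)) v)
    (g z (hz.trans_le (min_le_right _ _)) v)).trans_eq ?_)
  ring

theorem zero : L.IsHolomorphicInOp r m a fun _ => (0 : L.EndSmooth) := fun _ _ =>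
  ⟨IsOp.zero, 0, IsOp.zero, fun s ε hε => ⟨1, one_pos, fun z _ v => by
    rw [sub_zero, smul_zero, sub_zero, LinearMap.zero_apply, sobNorm_zero_right]
    exact mul_nonneg (mul_nonneg hε.le (norm_nonneg _)) (L.sobNorm_nonneg _ _ _)⟩⟩

theorem sum {ι : Type*} {A : Finset ι} {F : ι → ℂ → L.EndSmooth}
    (h : ∀ i ∈ A, L.IsHolomorphicInOp r m a (F i)) :
    L.IsHolomorphicInOp r m a fun z => ∑ i ∈ A, F i z := by
  classical
  induction A using Finset.induction_on with
  | empty => simpa using zero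
  | insert i A hi ih =>
    simp only [Finset.sum_insert hi]
    exact (h i (Finset.mem_insert_self _ _)).add
      (ih fun j hj => h j (Finset.mem_insert_of_mem hj))

theorem mul_left {t m' : ℝ} {A : L.EndSmooth} (hA : L.IsOp r t A)
    (hR : L.IsHolomorphicInOp r m a R) (hm : t + m = m') :
    L.IsHolomorphicInOp r m' a fun z => A * R z := by
  subst hm
  intro z₀ hz₀
  obtain ⟨h1, R', h2, h3⟩ := hR z₀ hz₀
  refine ⟨hA.mul h1, A * R', hA.mul h2, fun s ε hε => ?_⟩
  obtain ⟨C, hC0, hC⟩ := hA.exists_nonneg s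
  obtain ⟨δ, hδ, h⟩ := h3 (s + t) (ε / (C + 1)) (by positivity)
  refine ⟨δ, hδ, fun z hz v => ?_⟩
  have e : A * R z - A * R z₀ - (z - z₀) • (A * R') = A * (R z - R z₀ - (z - z₀) • R') := by
    rw [mul_sub, mul_sub, mul_smul_comm]
  rw [e, Module.End.mul_apply, ← add_assoc]
  refine (hC _).trans ((mul_le_mul_of_nonneg_left (h z hz v) hC0).trans ?_)
  have hK : 0 ≤ ‖z - z₀‖ * L.sobNorm r (s + t + m) v :=
    mul_nonneg (norm_nonneg _) (L.sobNorm_nonneg _ _ _)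
  have : C * (ε / (C + 1)) ≤ ε := by
    rw [mul_div_assoc', div_le_iff₀ (by positivity)]
    nlinarith
  calc _ = (C * (ε / (C + 1))) * (‖z - z₀‖ * L.sobNorm r (s + t + m) v) := by ring
    _ ≤ ε * (‖z - z₀‖ * L.sobNorm r (s + t + m) v) := by gcongr
    _ = _ := by ring

theorem const_smul (hR : L.IsHolomorphicInOp r m a R) (c : ℂ) :
    L.IsHolomorphicInOp r m a fun z => c • R z := by
  have h1 : L.IsOp r 0 (c • (1 : L.EndSmooth)) :=
    IsOp.smul (fun s => ⟨1, fun v => by rw [add_zero, one_mul, Module.End.one_apply]⟩) c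
  simpa using hR.mul_left h1 (zero_add m)

theorem id_smul (hR : L.IsHolomorphicInOp r m a R) :
    L.IsHolomorphicInOp r m a fun z => z • R z := by
  intro z₀ hz₀
  obtain ⟨h1, R', h2, h3⟩ := hR z₀ hz₀
  refine ⟨h1.smul z₀, R z₀ + z₀ • R', h1.add (h2.smul z₀), fun s ε hε => ?_⟩
  obtain ⟨C, hC0, hC⟩ := h2.exists_nonneg s
  obtain ⟨δ, hδ, h⟩ := h3 s (ε / (2 * (‖z₀‖ + 1))) (by positivity)
  -- The bound `1` gives `‖z‖ ≤ ‖z₀‖ + 1`; the last one controls the quadratic term `(z - z₀) ^ 2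
  -- R'` left by the product rule.
  refine ⟨min δ (min 1 (ε / (2 * (C + 1)))), by positivity, fun z hz v => ?_⟩
  have hz1 := hz.trans_le (min_le_left _ _)
  have hz2 := (hz.trans_le ((min_le_right _ _).trans (min_le_left _ _))).le
  have hz3 := (hz.trans_le ((min_le_right _ _).trans (min_le_right _ _))).le
  have e : z • R z - z₀ • R z₀ - (z - z₀) • (R z₀ + z₀ • R') =
      z • (R z - R z₀ - (z - z₀) • R') + ((z - z₀) * (z - z₀)) • R' := by
    module
  rw [e, LinearMap.add_apply, LinearMap.smul_apply, LinearMap.smul_apply]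
  refine (L.sobNorm_add_le _ _ _ _).trans ?_
  rw [sobNorm_smul, sobNorm_smul, norm_mul]
  have hn : ‖z‖ ≤ ‖z₀‖ + 1 := by
    have := norm_add_le (z - z₀) z₀
    rw [sub_add_cancel] at this
    linarith
  have hK := L.sobNorm_nonneg r (s + m) v
  have hd := norm_nonneg (z - z₀)
  have b1 : ‖z‖ * L.sobNorm r s ((R z - R z₀ - (z - z₀) • R') v) ≤
      ε / 2 * ‖z - z₀‖ * L.sobNorm r (s + m) v := by
    refine (mul_le_mul hn (h z hz1 v) (L.sobNorm_nonneg _ _ _) (by positivity)).trans_eq ?_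
    field_simp
  have b2 : ‖z - z₀‖ * ‖z - z₀‖ * L.sobNorm r s (R' v) ≤
      ε / 2 * ‖z - z₀‖ * L.sobNorm r (s + m) v := by
    rw [le_div_iff₀ (by positivity)] at hz3
    have hz4 : ‖z - z₀‖ * C ≤ ε / 2 := by nlinarith
    calc _ ≤ ‖z - z₀‖ * ‖z - z₀‖ * (C * L.sobNorm r (s + m) v) := by
          gcongr
          exact hC v
      _ = (‖z - z₀‖ * C) * (‖z - z₀‖ * L.sobNorm r (s + m) v) := by ring
      _ ≤ ε / 2 * (‖z - z₀‖ * L.sobNorm r (s + m) v) := by gcongr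
      _ = _ := by ring
  linarith

theorem polynomial_smul (hR : L.IsHolomorphicInOp r m a R) (p : Polynomial ℂ) :
    L.IsHolomorphicInOp r m a fun z => p.eval z • R z := by
  induction p using Polynomial.induction_on with
  | C c => simpa using hR.const_smul c
  | add p q hp hq => simpa [add_smul] using hp.add hq
  | monomial n c h =>
    have := h.id_smul
    simp only [smul_smul] at this
    convert this using 2 with z
    simp only [Polynomial.eval_mul, Polynomial.eval_C, Polynomial.eval_pow, Polynomial.eval_X]
    congr 1
    ring

end IsHolomorphicInOp

end LaplaceOperator

namespace LaplaceOperator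

variable {H : Type*} [NormedAddCommGroup H] [InnerProductSpace ℂ H] [CompleteSpace H]
  {L : LaplaceOperator H} {r : ℕ}

/-! ### Sums of elementary families -/

variable (L) in
/-- The finite sums of elementary families. -/
def elementarySums (r : ℕ) (F : ℤ → Submodule ℂ L.EndSmooth) (k : ℤ) :
    AddSubmonoid (ℂ → L.EndSmooth) :=
  AddSubmonoid.closure {T | L.IsElementaryFamily r F k T}

theorem mem_elementarySums {F : ℤ → Submodule ℂ L.EndSmooth} {k : ℤ} (p : Polynomial ℂ) (n : ℕ)
    {X : L.EndSmooth} (hX : X ∈ F (r * n + k)) :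
    (fun z => p.eval z • (X * L.cpow (z - n))) ∈ L.elementarySums r F k :=
  AddSubmonoid.subset_closure ⟨p, n, X, hX, fun _ => rfl⟩

theorem exists_fin_of_mem_closure {M : Type*} [AddCommMonoid M] {s : Set M} {x : M}
    (hx : x ∈ AddSubmonoid.closure s) :
    ∃ (N : ℕ) (f : Fin N → M), (∀ j, f j ∈ s) ∧ x = ∑ j, f j := by
  obtain ⟨l, hl, rfl⟩ := AddSubmonoid.exists_list_of_mem_closure hx
  refine ⟨l.length, l.get, fun j => hl _ (List.get_mem _ _), ?_⟩
  rw [← List.sum_ofFn, List.ofFn_get]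

theorem IsHolFamily.of_elementarySums {F : ℤ → Submodule ℂ L.EndSmooth} {k : ℤ}
    {T : ℂ → L.EndSmooth} (h : ∀ a m : ℝ, ∃ E ∈ L.elementarySums r F k, ∃ R : ℂ → L.EndSmooth,
      L.IsHolomorphicInOp r m a R ∧ ∀ z, T z = E z + R z) : L.IsHolFamily r F k T := by
  intro a m
  obtain ⟨E, hE, R, hR, hT⟩ := h a m
  obtain ⟨N, f, hf, rfl⟩ := exists_fin_of_mem_closure hE
  exact ⟨N, f, R, hf, hR, fun z _ => by rw [hT, Finset.sum_apply]⟩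

/-! ### The filtration by polynomials in the Laplace operator -/

namespace DiffAlgebra

variable (D : L.DiffAlgebra r)

theorem mem_filtZ {c : ℕ} {t : ℤ} (h : (c : ℤ) ≤ t) {X : L.EndSmooth} (hX : X ∈ D.filt c) :
    X ∈ D.filtZ t := by
  rw [filtZ, if_pos (by omega)]
  exact D.filt_mono (by omega) hX

theorem mul_opEnd_pow_mem_polyFilt {c j : ℕ} {t : ℤ} (h : (c : ℤ) + r * j ≤ t) {X : L.EndSmooth}
    (hX : X ∈ D.filt c) : X * L.opEnd ^ j ∈ D.polyFilt t := by
  obtain ⟨i, hi⟩ := Int.eq_ofNat_of_zero_le (show 0 ≤ t - r * j by omega)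
  have hle : Submodule.span ℂ {Y | ∃ X ∈ D.filt i, ∃ l ≤ j, Y = X * L.opEnd ^ l} ≤ D.polyFilt t :=
    le_iSup_of_le i (le_iSup_of_le j (le_iSup_of_le (by omega) le_rfl))
  exact hle (Submodule.subset_span ⟨X, D.filt_mono (by omega) hX, j, le_rfl, rfl⟩)

theorem filtZ_le_polyFilt (t : ℤ) : D.filtZ t ≤ D.polyFilt t := by
  intro X hX
  rw [filtZ] at hX
  split_ifs at hX with h
  · simpa using D.mul_opEnd_pow_mem_polyFilt (j := 0) (t := t) (by simp [h]) hX
  · rw [(Submodule.mem_bot ℂ).1 hX]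
    exact Submodule.zero_mem _

theorem mul_opEnd_pow_mem_filt (h : L.opEnd ∈ D.filt r) {i : ℕ} {X : L.EndSmooth}
    (hX : X ∈ D.filt i) (j : ℕ) : X * L.opEnd ^ j ∈ D.filt (i + r * j) := by
  induction j with
  | zero => simpa using hX
  | succ j ih =>
    rw [pow_succ, ← mul_assoc, mul_add, mul_one, ← add_assoc]
    exact D.filt_mul _ _ _ ih _ h

theorem polyFilt_le_filtZ (h : L.opEnd ∈ D.filt r) (t : ℤ) : D.polyFilt t ≤ D.filtZ t := by
  refine iSup_le fun i => iSup_le fun d => iSup_le fun e => Submodule.span_le.2 ?_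
  rintro _ ⟨X, hX, j, hj, rfl⟩
  refine D.mem_filtZ ?_ (D.mul_opEnd_pow_mem_filt h hX j)
  have : r * j ≤ r * d := Nat.mul_le_mul_left r hj
  rw [← e]
  exact_mod_cast Nat.add_le_add_left this i

/-- The operators which define sums of elementary families of type `k` when multiplied by the
powers of exponent `z - n`. -/
def leadingCoeffs (k : ℤ) (n : ℕ) : Submodule ℂ L.EndSmooth where
  carrier := {E | ∀ p : Polynomial ℂ,
    (fun z => p.eval z • (E * L.cpow (z - n))) ∈ L.elementarySums r D.filtZ k}
  zero_mem' p := by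
    have := (L.elementarySums r D.filtZ k).zero_mem
    convert this using 1
    funext z
    simp
  add_mem' {E E'} hE hE' p := by
    have := (L.elementarySums r D.filtZ k).add_mem (hE p) (hE' p)
    convert this using 1
    funext z
    simp [add_mul]
  smul_mem' c E hE p := by
    have := hE (p * Polynomial.C c)
    convert this using 1
    funext z
    simp [mul_smul]

/-- The powers of `Δ` in a generator are absorbed: `X Δ ^ j Δ ^ (z - n) = X Δ ^ (z - (n - j))`. This
is an elementary family for `D` itself as soon as `j ≤ n`. -/
theorem polyFilt_le_leadingCoeffs {q : ℕ} (hq : q ≤ r) (n : ℕ) :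
    D.polyFilt (r * n + ((q : ℤ) - 1)) ≤ D.leadingCoeffs ((q : ℤ) - 1) n := by
  refine iSup_le fun i => iSup_le fun d => iSup_le fun e => Submodule.span_le.2 ?_
  rintro _ ⟨X, hX, j, hj, rfl⟩ p
  -- Here `r d ≤ r n + q - 1 < r (n + 1)`, by `q ≤ r`.
  have hdn : d ≤ n := by
    by_contra hlt
    have h1 : r * (n + 1) ≤ r * d := Nat.mul_le_mul_left r (by omega)
    have h2 : ((r * (n + 1) : ℕ) : ℤ) ≤ (r * d : ℕ) := by exact_mod_cast h1
    push_cast at h2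
    have : (q : ℤ) ≤ r := by exact_mod_cast hq
    linarith [Int.natCast_nonneg i]
  have hjn : j ≤ n := hj.trans hdn
  have e2 : (fun z => p.eval z • (X * L.opEnd ^ j * L.cpow (z - n))) =
      fun z => p.eval z • (X * L.cpow (z - (n - j : ℕ))) := by
    funext z
    rw [mul_assoc, ← cpow_natCast, ← cpow_add, Nat.cast_sub hjn]
    congr 3
    ring
  rw [e2]
  refine mem_elementarySums p (n - j) (D.mem_filtZ ?_ hX)
  have h1 : ((r * j : ℕ) : ℤ) ≤ (r * d : ℕ) := by exact_mod_cast Nat.mul_le_mul_left r hj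
  push_cast [Nat.cast_sub hjn] at h1 ⊢
  linarith

/-- The members of the algebra of order at most `b`, together with the identity. -/
def Adm (b : ℕ) (B : L.EndSmooth) : Prop := B ∈ D.filt b ∨ B = 1

variable {D}

theorem Adm.mul_adPow_mem {a b : ℕ} {A B : L.EndSmooth} (hB : D.Adm b B) (hA : A ∈ D.filt a)
    (k : ℕ) : A * L.adPow k B ∈ D.filt (a + b + k * (r - 1)) := by
  rcases hB with hB | rfl
  · rw [add_assoc]
    exact D.filt_mul _ _ _ hA _ (D.adPow_mem hB k)
  · rcases k with - | k
    · rw [adPow_zero, mul_one]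
      exact D.filt_mono (by omega) hA
    · rw [adPow_succ_one, mul_zero]
      exact Submodule.zero_mem _

theorem Adm.exists_isHolomorphicInOp_rem {b : ℕ} {B : L.EndSmooth} (hB : D.Adm b B) (a m : ℝ) :
    ∃ N₀ : ℕ, ∀ N, N₀ ≤ N → L.IsHolomorphicInOp r m a fun z => L.rem N z B := by
  rcases hB with hB | rfl
  · exact LaplaceOperator.exists_isHolomorphicInOp_rem D hB a m
  · refine ⟨1, fun N hN => ?_⟩
    simp only [L.rem_one_left hN]
    exact IsHolomorphicInOp.zero

end DiffAlgebra

/-! ### Expansion of families `∑ p(z) A Δ ^ z B` -/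

section Expansion

variable {D : L.DiffAlgebra r} {n : ℕ} (P : Fin n → Polynomial ℂ) (A B : Fin n → L.EndSmooth)

variable (L) in
/-- The sum of the leading `K` terms of the expansion. -/
def leading (K : ℕ) (z : ℂ) : L.EndSmooth :=
  ∑ l, ∑ k ∈ Finset.range K,
    ((P l).eval z * Ring.choose z k) • (A l * L.adPow k (B l) * L.cpow (z - k))

theorem sum_eq_leading_add {K N : ℕ} (hKN : K ≤ N) (z : ℂ) :
    ∑ l, (P l).eval z • (A l * (L.cpow z * B l)) = leading L P A B K z +
      ∑ l, ∑ k ∈ Finset.Ico K N,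
        ((P l).eval z * Ring.choose z k) • (A l * L.adPow k (B l) * L.cpow (z - k)) +
      ∑ l, (P l).eval z • (A l * L.rem N z (B l)) := by
  rw [leading, ← Finset.sum_add_distrib, ← Finset.sum_add_distrib]
  refine Finset.sum_congr rfl fun l _ => ?_
  rw [Finset.sum_range_add_sum_Ico _ hKN, L.cpow_mul_eq N, mul_add, smul_add, Finset.mul_sum,
    Finset.smul_sum]
  congr 1
  refine Finset.sum_congr rfl fun k _ => ?_
  rw [mul_smul_comm, smul_smul, mul_assoc]

/-- Up to right multiplication by `Δ ^ (-z)`, the leading part is polynomial in `z`, so Lagrange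
interpolation recovers it from integer values. The nodes start at `K + 1`: they are at least `K`, as
`leading_natCast_mem` needs, and positive. -/
theorem exists_leading_eq (K : ℕ) : ∃ (d : ℕ) (ℓ : Fin d → Polynomial ℂ), ∀ z : ℂ,
    leading L P A B K z = ∑ j : Fin d, (ℓ j).eval z •
      (leading L P A B K ((K + 1 + j : ℕ) : ℂ) * L.cpow (z - (K + 1 + j : ℕ))) := by
  choose c hc using exists_choose_polynomial
  set Q : Fin n → ℕ → Polynomial ℂ := fun l k => P l * c k with hQ
  have hQe : ∀ l k z, (Q l k).eval z = (P l).eval z * Ring.choose z k := fun l k z => by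
    rw [hQ, Polynomial.eval_mul, hc]
  -- The sum dominates every individual degree, so one set of `d` nodes interpolates all the
  -- coefficients.
  set d : ℕ := (∑ l, ∑ k ∈ Finset.range K, (Q l k).natDegree) + 1 with hd
  set x : Fin d → ℂ := fun j => ((K + 1 + j : ℕ) : ℂ) with hx
  have hinj : Set.InjOn x (Finset.univ : Finset (Fin d)) := by
    intro i _ j _ h
    have : K + 1 + (i : ℕ) = K + 1 + j := Nat.cast_injective (R := ℂ) h
    exact Fin.ext (by omega)
  refine ⟨d, fun j => Lagrange.basis Finset.univ x j, fun z => ?_⟩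
  have hint : ∀ l, ∀ k ∈ Finset.range K, (Q l k).eval z =
      ∑ j, (Q l k).eval (x j) * (Lagrange.basis Finset.univ x j).eval z := by
    intro l k hk
    have hdeg : (Q l k).degree < (Finset.univ : Finset (Fin d)).card := by
      refine Polynomial.degree_le_natDegree.trans_lt ?_
      rw [Finset.card_univ, Fintype.card_fin, Nat.cast_lt, hd, Nat.lt_succ_iff]
      refine (Finset.single_le_sum (f := fun k => (Q l k).natDegree) (fun _ _ => Nat.zero_le _)
        hk).trans ?_
      exact Finset.single_le_sum (f := fun l => ∑ k ∈ Finset.range K, (Q l k).natDegree)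
        (fun _ _ => Nat.zero_le _) (Finset.mem_univ l)
    have h := Lagrange.eq_interpolate hinj hdeg
    rw [Lagrange.interpolate_apply] at h
    have h2 := congrArg (Polynomial.eval z) h
    rw [Polynomial.eval_finsetSum] at h2
    simpa using h2
  have hterm : ∀ j : Fin d, leading L P A B K (x j) * L.cpow (z - x j) =
      ∑ l, ∑ k ∈ Finset.range K, (Q l k).eval (x j) •
        (A l * L.adPow k (B l) * L.cpow (z - k)) := by
    intro j
    rw [leading, Finset.sum_mul]
    refine Finset.sum_congr rfl fun l _ => ?_
    rw [Finset.sum_mul]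
    refine Finset.sum_congr rfl fun k _ => ?_
    rw [smul_mul_assoc, mul_assoc _ (L.cpow _), ← cpow_add, hQe]
    congr 3
    ring
  have hgoal : ∀ j : Fin d, (((K + 1 + j : ℕ) : ℂ)) = x j := fun _ => rfl
  simp only [hgoal, hterm, Finset.smul_sum]
  rw [Finset.sum_comm, leading]
  refine Finset.sum_congr rfl fun l _ => ?_
  rw [Finset.sum_comm]
  refine Finset.sum_congr rfl fun k hk => ?_
  rw [← hQe, hint l k hk, Finset.sum_smul]
  refine Finset.sum_congr rfl fun j _ => ?_
  rw [smul_smul, mul_comm]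

variable {P A B} {a b : Fin n → ℕ} (hA : ∀ l, A l ∈ D.filt (a l)) (hB : ∀ l, D.Adm (b l) (B l))
  {q K : ℕ} (hK : ∀ l, a l + b l + 1 ≤ K + q)

include hA hB hK

/-- The order is at most `a + b + k (r - 1) = r k + (a + b - k)`, and `K` is chosen so that `a + b -
k ≤ q - 1` once `k ≥ K`. -/
theorem coeff_mem_filtZ (l : Fin n) {k : ℕ} (hk : K ≤ k) :
    A l * L.adPow k (B l) ∈ D.filtZ (r * k + ((q : ℤ) - 1)) := by
  refine D.mem_filtZ ?_ ((hB l).mul_adPow_mem (hA l) k)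
  have h1 := hK l
  have h2 : k * (r - 1) + k = r * k := by
    obtain ⟨s, hs⟩ := Nat.exists_eq_add_of_lt D.r_pos
    rw [hs]
    simp
    ring
  have h3 : ((k * (r - 1) + k : ℕ) : ℤ) = r * k := by rw [h2]; push_cast; ring
  push_cast at h3 ⊢
  omega

/-- At the natural number `i` the expansion to depth `i + 1` has no remainder, and its terms with `K
≤ k ≤ i` already lie in the required space; hence so does the leading part, as a difference. -/
theorem leading_natCast_mem {i : ℕ} (hi : K ≤ i)
    (hR : ∑ l, (P l).eval (i : ℂ) • (A l * (L.cpow i * B l)) ∈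
      D.polyFilt (r * i + ((q : ℤ) - 1))) :
    leading L P A B K i ∈ D.polyFilt (r * i + ((q : ℤ) - 1)) := by
  have h := sum_eq_leading_add P A B (show K ≤ i + 1 by omega) (i : ℂ)
  have h0 : ∑ l, (P l).eval (i : ℂ) • (A l * L.rem (i + 1) i (B l)) = 0 :=
    Finset.sum_eq_zero fun l _ => by
      rw [L.rem_natCast (Nat.lt_succ_self i), mul_zero, smul_zero]
  rw [h0, add_zero] at h
  rw [eq_sub_of_add_eq h.symm]
  refine Submodule.sub_mem _ hR (Submodule.sum_mem _ fun l _ => Submodule.sum_mem _ fun k hk =>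
    Submodule.smul_mem _ _ ?_)
  obtain ⟨hk1, hk2⟩ := Finset.mem_Ico.1 hk
  have hki : k ≤ i := Nat.lt_succ_iff.1 hk2
  rw [← Nat.cast_sub hki, cpow_natCast]
  have hm := coeff_mem_filtZ hA hB hK l hk1
  rw [DiffAlgebra.filtZ] at hm
  split_ifs at hm with h1
  · refine D.mul_opEnd_pow_mem_polyFilt ?_ hm
    rw [Int.toNat_of_nonneg h1, Nat.cast_sub hki]
    linarith
  · rw [(Submodule.mem_bot ℂ).1 hm, zero_mul]
    exact Submodule.zero_mem _

/-- The tail is of type `q - 1` already for the filtration of `D`, so the choice of `F` matters only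
for the leading part. This treats both conclusions of the theorem at once. -/
theorem isHolFamily_of_leading {F : ℤ → Submodule ℂ L.EndSmooth} (hF : ∀ t, D.filtZ t ≤ F t)
    (hlead : leading L P A B K ∈ L.elementarySums r F ((q : ℤ) - 1)) :
    L.IsHolFamily r F ((q : ℤ) - 1) fun z => ∑ l, (P l).eval z • (A l * (L.cpow z * B l)) := by
  refine IsHolFamily.of_elementarySums fun c m => ?_
  -- The remainders are taken of order lower by `a l + r`, the analytic order of the left factor `A
  -- l`.
  choose N₀ hN₀ using fun l => (hB l).exists_isHolomorphicInOp_rem c (m - (a l + r))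
  set N := max K (∑ l, N₀ l) with hN
  have hNl : ∀ l, N₀ l ≤ N := fun l =>
    (Finset.single_le_sum (f := N₀) (fun _ _ => Nat.zero_le _) (Finset.mem_univ l)).trans
      (le_max_right _ _)
  refine ⟨leading L P A B K + ∑ l, ∑ k ∈ Finset.Ico K N, fun z =>
      ((P l).eval z * Ring.choose z k) • (A l * L.adPow k (B l) * L.cpow (z - k)),
    add_mem hlead (sum_mem fun l _ => sum_mem fun k hk => ?_), _,
    IsHolomorphicInOp.sum (A := (Finset.univ : Finset (Fin n))) fun l _ =>
      ((hN₀ l N (hNl l)).mul_left (D.isOp (hA l)) (add_sub_cancel _ _)).polynomial_smul (P l),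
    fun z => ?_⟩
  · obtain ⟨p, hp⟩ := exists_choose_polynomial k
    have := mem_elementarySums (P l * p) k
      (hF _ (coeff_mem_filtZ hA hB hK l (Finset.mem_Ico.1 hk).1))
    simpa only [Polynomial.eval_mul, hp] using this
  · rw [sum_eq_leading_add P A B (le_max_left K (∑ l, N₀ l)) z]
    simp only [Pi.add_apply, Finset.sum_apply, hN]

end Expansion

end LaplaceOperator

namespace LaplaceOperator

variable {H : Type*} [NormedAddCommGroup H] [InnerProductSpace ℂ H] [CompleteSpace H]
  {L : LaplaceOperator H} {r : ℕ}

/-! ### Polynomial families of sums of two-sided multiplications -/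

variable (L) in
/-- The family `s ↦ (W ↦ p(s) A W B)`. -/
def twoSided (p : Polynomial ℂ) (A B : L.EndSmooth) : ℂ → Module.End ℂ L.EndSmooth :=
  fun s => p.eval s • (LinearMap.mulLeft ℂ A ∘ₗ LinearMap.mulRight ℂ B)

theorem twoSided_apply (p : Polynomial ℂ) (A B : L.EndSmooth) (s : ℂ) (W : L.EndSmooth) :
    L.twoSided p A B s W = p.eval s • (A * (W * B)) := rfl

namespace DiffAlgebra

variable (D : L.DiffAlgebra r)

/-- The members of the algebra, together with the identity. -/
def unitized : Submonoid L.EndSmooth where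
  carrier := {A | A ∈ D.carrier ∨ A = 1}
  one_mem' := Or.inr rfl
  mul_mem' := by
    rintro A B (hA | rfl) (hB | rfl)
    · exact Or.inl (mul_mem hA hB)
    · exact Or.inl (by rwa [mul_one])
    · exact Or.inl (by rwa [one_mul])
    · exact Or.inr (mul_one 1)

/-- The polynomial families of two-sided multiplications by members of the algebra. -/
def twoSidedMonoid : Submonoid (ℂ → Module.End ℂ L.EndSmooth) where
  carrier := {Φ | ∃ p : Polynomial ℂ, ∃ A ∈ D.unitized, ∃ B ∈ D.unitized, Φ = L.twoSided p A B}
  one_mem' := by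
    refine ⟨1, 1, one_mem _, 1, one_mem _, ?_⟩
    funext s
    refine LinearMap.ext fun W => ?_
    rw [twoSided_apply, Pi.one_apply, Module.End.one_apply]
    simp
  mul_mem' := by
    rintro _ _ ⟨p, A, hA, B, hB, rfl⟩ ⟨p', A', hA', B', hB', rfl⟩
    refine ⟨p * p', A * A', mul_mem hA hA', B' * B, mul_mem hB' hB, ?_⟩
    funext s
    refine LinearMap.ext fun W => ?_
    rw [Pi.mul_apply, Module.End.mul_apply, twoSided_apply, twoSided_apply, twoSided_apply,
      Polynomial.eval_mul, smul_mul_assoc, mul_smul_comm, smul_smul]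
    simp only [mul_assoc]

/-- The polynomial families of sums of two-sided multiplications by members of the algebra. -/
def twoSidedSemiring : Subsemiring (ℂ → Module.End ℂ L.EndSmooth) :=
  D.twoSidedMonoid.subsemiringClosure

theorem twoSided_mem (p : Polynomial ℂ) {A B : L.EndSmooth} (hA : A ∈ D.unitized)
    (hB : B ∈ D.unitized) : L.twoSided p A B ∈ D.twoSidedSemiring :=
  AddSubmonoid.subset_closure ⟨p, A, hA, B, hB, rfl⟩

theorem commOp_sub_mem {n : ℕ} {P Q : Fin n → L.EndSmooth} (hP : ∀ i, P i ∈ D.carrier)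
    (hQ : ∀ i, Q i ∈ D.carrier) (a b : Fin n → ℂ) (α β : ℂ) :
    (fun s => L.commOp P Q a b - (α * s + β) • (1 : Module.End ℂ L.EndSmooth)) ∈
      D.twoSidedSemiring := by
  have hP' : ∀ i, P i ∈ D.unitized := fun i => Or.inl (hP i)
  have hQ' : ∀ i, Q i ∈ D.unitized := fun i => Or.inl (hQ i)
  have h1 : (1 : L.EndSmooth) ∈ D.unitized := one_mem _
  have e : (fun s => L.commOp P Q a b - (α * s + β) • (1 : Module.End ℂ L.EndSmooth)) =
      ∑ i, ((L.twoSided (Polynomial.C (-a i)) (Q i * P i) 1 +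
        L.twoSided (Polynomial.C (a i)) (P i) (Q i)) +
        (L.twoSided (Polynomial.C (b i)) (P i * Q i) 1 +
        L.twoSided (Polynomial.C (-b i)) (Q i) (P i))) +
      L.twoSided (-(Polynomial.C α * Polynomial.X + Polynomial.C β)) 1 1 := by
    funext s
    refine LinearMap.ext fun W => ?_
    simp only [Pi.add_apply, Finset.sum_apply, LinearMap.add_apply, LinearMap.sum_apply,
      twoSided_apply, LinearMap.sub_apply, LinearMap.smul_apply, Module.End.one_apply,
      Polynomial.eval_C, Polynomial.eval_neg, Polynomial.eval_add, Polynomial.eval_mul,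
      Polynomial.eval_X, mul_one, one_mul]
    have hn : ∀ (c : ℂ) (Y : L.EndSmooth), (-c) • Y = -(c • Y) := fun c Y => neg_smul c Y
    rw [Finset.sum_add_distrib, hn (α * s + β), ← sub_eq_add_neg]
    congr 1
    show ∑ i, a i • ⁅-Q i, P i * W⁆ + ∑ i, b i • ⁅P i, Q i * W⁆ = _
    congr 1
    · refine Finset.sum_congr rfl fun i _ => ?_
      rw [Ring.lie_def, hn]
      refine Eq.trans (congrArg (a i • ·) ?_)
        ((smul_add (a i) (-(Q i * P i * W)) (P i * (W * Q i))).trans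
          (congrArg (· + _) (smul_neg (a i) _)))
      refine LinearMap.ext fun v => ?_
      simp only [LinearMap.sub_apply, LinearMap.add_apply, LinearMap.neg_apply,
        Module.End.mul_apply, map_neg]
      abel
    · refine Finset.sum_congr rfl fun i _ => ?_
      rw [Ring.lie_def, hn, ← sub_eq_add_neg]
      refine Eq.trans (congrArg (b i • ·) ?_)
        (smul_sub (b i) (P i * Q i * W) (Q i * (W * P i)))
      noncomm_ring
  rw [e]
  refine add_mem (sum_mem fun i _ => add_mem (add_mem ?_ ?_) (add_mem ?_ ?_)) ?_
  · exact D.twoSided_mem _ (mul_mem (hQ' i) (hP' i)) h1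
  · exact D.twoSided_mem _ (hP' i) (hQ' i)
  · exact D.twoSided_mem _ (mul_mem (hP' i) (hQ' i)) h1
  · exact D.twoSided_mem _ (hQ' i) (hP' i)
  · exact D.twoSided_mem _ h1 h1

/-- Two-sided multiplications are closed under composition, so a product of factors that are sums of
them, with coefficients polynomial in `s`, is again such a sum. -/
theorem opT_mem {n p : ℕ} {P Q : Fin n → L.EndSmooth} (hP : ∀ i, P i ∈ D.carrier)
    (hQ : ∀ i, Q i ∈ D.carrier) (Λ : ReductionData n p) :
    (fun s => Λ.opT P Q s) ∈ D.twoSidedSemiring := by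
  have e : (fun s => Λ.opT P Q s) = (List.ofFn fun m : Fin p => fun s : ℂ =>
    L.commOp P Q (fun i => (Λ.a m i : ℂ)) (fun i => (Λ.b m i : ℂ)) -
      ((Λ.α m : ℂ) * s + (Λ.β m : ℂ)) • (1 : Module.End ℂ L.EndSmooth)).reverse.prod := by
    funext s
    rw [ReductionData.opT]
    have := map_list_prod (Pi.evalMonoidHom (fun _ : ℂ => Module.End ℂ L.EndSmooth) s)
      (List.ofFn fun m : Fin p => fun s : ℂ =>
        L.commOp P Q (fun i => (Λ.a m i : ℂ)) (fun i => (Λ.b m i : ℂ)) -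
          ((Λ.α m : ℂ) * s + (Λ.β m : ℂ)) • (1 : Module.End ℂ L.EndSmooth)).reverse
    rw [List.map_reverse, List.map_ofFn] at this
    exact this.symm
  rw [e]
  refine Subsemiring.list_prod_mem _ fun Φ hΦ => ?_
  rw [List.mem_reverse, List.mem_ofFn] at hΦ
  obtain ⟨m, rfl⟩ := hΦ
  exact D.commOp_sub_mem hP hQ _ _ _ _

/-- The families `opT (r z + q) (X Δ ^ z)` are sums of families `p(z) A Δ ^ z B`. -/
theorem exists_opT_eq {n p : ℕ} {P Q : Fin n → L.EndSmooth} (hP : ∀ i, P i ∈ D.carrier)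
    (hQ : ∀ i, Q i ∈ D.carrier) (Λ : ReductionData n p) {q : ℕ} {X : L.EndSmooth}
    (hX : X ∈ D.filt q) : ∃ (N : ℕ) (p : Fin N → Polynomial ℂ) (A B : Fin N → L.EndSmooth)
      (a b : Fin N → ℕ), (∀ l, A l ∈ D.filt (a l)) ∧ (∀ l, D.Adm (b l) (B l)) ∧
      ∀ (z : ℂ), Λ.opT P Q ((r : ℂ) * z + q) (X * L.cpow z) =
        ∑ l, (p l).eval z • (A l * (L.cpow z * B l)) := by
  obtain ⟨N, f, hf, hsum⟩ := exists_fin_of_mem_closure (D.opT_mem hP hQ Λ)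
  choose p A hA B hB hfe using hf
  -- The factor `X` keeps the left coefficient in the algebra even when `A l` is the identity; on
  -- the right the identity must be allowed, as in `Adm`.
  have hA' : ∀ l, ∃ a, A l * X ∈ D.filt a := fun l => by
    rcases hA l with h | h
    · exact (D.mem_carrier _).1 (mul_mem h ((D.mem_carrier X).2 ⟨q, hX⟩))
    · exact ⟨q, by rwa [h, one_mul]⟩
  have hB' : ∀ l, ∃ b, D.Adm b (B l) := fun l => by
    rcases hB l with h | h
    · obtain ⟨b, hb⟩ := (D.mem_carrier _).1 h
      exact ⟨b, Or.inl hb⟩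
    · exact ⟨0, Or.inr h⟩
  choose a ha using hA'
  choose b hb using hB'
  refine ⟨N, fun l => (p l).comp (Polynomial.C (r : ℂ) * Polynomial.X + Polynomial.C (q : ℂ)),
    fun l => A l * X, B, a, b, ha, hb, fun z => ?_⟩
  have h := congrFun hsum ((r : ℂ) * z + q)
  rw [h, Finset.sum_apply, LinearMap.sum_apply]
  refine Finset.sum_congr rfl fun l _ => ?_
  rw [hfe l, twoSided_apply, Polynomial.eval_comp]
  simp only [Polynomial.eval_add, Polynomial.eval_mul, Polynomial.eval_C, Polynomial.eval_X,
    mul_assoc]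

end DiffAlgebra

end LaplaceOperator

end

end GDO

/-! ### The reduction theorem -/

open GDO LaplaceOperator in
theorem theorem1p1 {H : Type*} [NormedAddCommGroup H] [InnerProductSpace ℂ H] [CompleteSpace H]
    [TopologicalSpace.SeparableSpace H]
    (L : GDO.LaplaceOperator H) {r : ℕ} (D : L.DiffAlgebra r)
    {n p : ℕ} (P Q : Fin n → L.EndSmooth)
    (hP : ∀ i, P i ∈ D.carrier) (hQ : ∀ i, Q i ∈ D.carrier)
    (Λ : GDO.ReductionData n p) (T : ℕ → Module.End ℂ L.EndSmooth)
    (hT : Λ.IsReductionSequence D P Q T)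
    (q : ℕ) (X : L.EndSmooth) (hX : X ∈ D.filt q) :
    ∃ R : ℂ → L.EndSmooth,
      (∀ z : ℂ, Λ.opH P Q ((r : ℂ) * z + q) (X * L.cpow z) =
        Λ.bFun ((r : ℂ) * z + q) • (X * L.cpow z) + R z) ∧
      L.IsHolFamily r D.polyFilt ((q : ℤ) - 1) R ∧
      ((L.opEnd ∈ D.filt r ∨ q ≤ r) → L.IsHolFamily r D.filtZ ((q : ℤ) - 1) R) := by
  obtain ⟨N, p, A, B, a, b, hA, hB, hR⟩ := D.exists_opT_eq hP hQ Λ hX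
  obtain ⟨K, hK⟩ : ∃ K : ℕ, ∀ l, a l + b l + 1 ≤ K + q :=
    ⟨∑ l, (a l + b l + 1), fun l => (Finset.single_le_sum (f := fun l => a l + b l + 1)
      (fun _ _ => Nat.zero_le _) (Finset.mem_univ l)).trans (Nat.le_add_right _ _)⟩
  -- The reduction hypothesis is used here. At a node `i = K + 1 + j` the index `q + r i` is at
  -- least `1`, so `T` is given there by the explicit formula, which need not hold for `T 0`.
  have hpoly : ∀ j : ℕ, leading L p A B K ((K + 1 + j : ℕ) : ℂ) ∈
      D.polyFilt (r * (K + 1 + j : ℕ) + ((q : ℤ) - 1)) := by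
    intro j
    refine leading_natCast_mem hA hB hK (by omega) ?_
    rw [← hR, L.cpow_natCast]
    have h1 := hT.reduces q (K + 1 + j) X hX
    have hpos : 1 ≤ r * (K + 1 + j) := Nat.mul_pos D.r_pos (by omega)
    rw [hT.eq_opT _ (by omega)] at h1
    convert h1 using 2
    · ring
    · congr 1
      push_cast
      ring
  obtain ⟨d, ℓ, hℓ⟩ := exists_leading_eq (L := L) p A B K
  have hlead : leading L p A B K = ∑ j : Fin d, fun z => (ℓ j).eval z •
      (leading L p A B K ((K + 1 + j : ℕ) : ℂ) * L.cpow (z - (K + 1 + j : ℕ))) := by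
    funext z
    rw [hℓ z, Finset.sum_apply]
  -- The witness is `opT` applied to `X Δ ^ z`, which is what `opH` leaves after removing its `bFun`
  -- term.
  refine ⟨fun z => ∑ l, (p l).eval z • (A l * (L.cpow z * B l)), fun z => ?_, ?_, ?_⟩
  · rw [ReductionData.opH, LinearMap.add_apply, LinearMap.smul_apply, Module.End.one_apply, hR,
      add_comm]
  · refine isHolFamily_of_leading hA hB hK D.filtZ_le_polyFilt ?_
    rw [hlead]
    exact sum_mem fun j _ => mem_elementarySums _ _ (hpoly j)
  · intro h
    refine isHolFamily_of_leading hA hB hK (fun _ => le_rfl) ?_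
    rw [hlead]
    refine sum_mem fun j _ => ?_
    rcases h with h | h
    · exact mem_elementarySums _ _ (D.polyFilt_le_filtZ h _ (hpoly j))
    · exact D.polyFilt_le_leadingCoeffs h _ (hpoly j) _
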